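/- Let $D\ge 3$ with $D \bmod 8\in\{2,3,4\}$, and let $M=\mathbb{R}\times\mathbb{T}^{D-1}$ with the flat metric $g=-dt^2+\sum_{i=1}^{D-1}d\varphi_i^2$, $\varphi_i\in[0,2\pi)$. Let $\gamma^0,\dots,\gamma^{D-1}$ be complex $2^{\lfloor D/2\rfloor}\times 2^{\lfloor D/2\rfloor}$ matrices with $\{\gamma^a,\gamma^b\}=2\eta^{ab}$, $\eta=\mathrm{diag}(-1,1,\dots,1)$, $\gamma^0$ antihermitian and $\gamma^i$ hermitian, and let $C$ be a unitary antisymmetric matrix with $(\gamma^a)^{\mathrm T}=-C\gamma^aC^{-1}$. Put $\beta=i\gamma^0$ and call a spinor $\chi$ Majorana if $\chi=-\beta C^*\chi^*$; on Majorana spinors use the real antisymmetric form $\langle v,w\rangle=-i\,v^{\mathrm T}Cw$. For a spin structure on $M$ let $W$ be the bundle of Majorana spinors and $V=W\otimes T^*M$ with the form $\langle\psi,\chi\rangle_V=\langle\psi_\mu,\chi^\mu\rangle+\frac1{D-2}\langle\gamma^\mu\psi_\mu,\gamma^\nu\chi_\nu\rangle$. Put $$(P\psi)_\mu=\gamma^\nu\nabla_\nu\psi_\mu-\gamma_\mu\nabla^\nu\psi_\nu,\qquad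 K^\dagger\psi=-\nabla^\mu\psi_\mu,\qquad (T\epsilon)_\mu=-\gamma_\mu\epsilon,\qquad \widetilde P=P+T\circ K^\dagger .$$ Let $\Gamma^\infty(V)$ and $\Gamma^\infty_0(V)$ be the smooth sections and those of compact support. Let $\mathcal{E}=\{f\in\Gamma_0^\infty(V):K^\dagger f=0\}/P[\Gamma_0^\infty(V)]$ and $\tau([f],[h])=\int_M\langle f,(G_+-G_-)h\rangle_V$, where $G_\pm$ are retarded/advanced Green's operators of $\widetilde P$ (continuous linear maps $\Gamma_0^\infty(V)\to\Gamma^\infty(V)$, inverse to $\widetilde P$ on both sides, with $\mathrm{supp}\,G_\pm f\subseteq J^\pm(\mathrm{supp} f)$). The theory is of positive type if $(\mathcal E,\tau)$ is a real pre-Hilbert space, i.e. $\tau$ is a well-defined, symmetric and positive definite bilinear form on $\mathcal E$. For $\psi_1,\psi_2\in\Gamma^\infty(V)$ with spacelike compact support and $P\psi_1=P\psi_2=0$ put $\langle\psi_1,\psi_2\rangle_{\mathrm{Sol}}=\int_M\langle P\psi_1^+,\psi_2\rangle_V$, where $\psi_1=\psi_1^++\psi_1^-$ is any splitting into smooth sections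 with $\mathrm{supp}\,\psi_1^\pm\subseteq J^\pm(B)$ for a compact set $B$. Then: 1. For every spin structure on $M$, Green's operators $G_\pm$ exist and $\tau$ is a well-defined bilinear map on $\mathcal E$. 2. For the trivial spin structure the theory is not of positive type. 3. For the trivial spin structure, every constant Majorana-valued section $\psi$ of $V$ satisfies $P\psi=0$, and $$\langle\psi,\psi\rangle_{\mathrm{Sol}}=(2\pi)^{D-1}\Big(\psi_\mu^\dagger\psi^\mu-\frac1{D-2}(\gamma^\mu\psi_\mu)^\dagger(\gamma^\nu\psi_\nu)\Big).$$ There are constant solutions with $\psi_0=0$, $\gamma^i\psi_i=0$ and $\langle\psi,\psi\rangle_{\mathrm{Sol}}>0$, and constant solutions with $\psi_i=0$ for all $i\geq 1$ and $\langle\psi,\psi\rangle_{\mathrm{Sol}}<0$. 4. Up to isomorphism there are exactly $2^{D-1}-1$ non-trivial spin structures on $M$. For each of them the induced Dirac operator $\gamma^i\nabla_i$ on every slice $\{t\}\times\mathbb{T}^{D-1}$ has trivial kernel, and the theory is of positive type. -/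

import Mathlib

open scoped ContDiff

namespace RaritaSchwinger

/-! ## Minkowski metric and gamma matrices in dimension `D = n + 1` -/

/-- Diagonal entries of the Minkowski metric `diag(-1, 1, ..., 1)` (equal to those of its inverse). -/
def eta {n : ℕ} (μ : Fin (n + 1)) : ℝ := if μ = 0 then -1 else 1

/-- Dimension `2 ^ ⌊D / 2⌋` of the space of Dirac spinors. -/
abbrev spinDim (n : ℕ) : ℕ := 2 ^ ((n + 1) / 2)

abbrev Spinor (n : ℕ) : Type := Fin (spinDim n) → ℂ

abbrev SpinMatrix (n : ℕ) : Type := Matrix (Fin (spinDim n)) (Fin (spinDim n)) ℂ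

/-- Gamma matrices `γ^a` (upper index) together with a charge conjugation matrix `C`. -/
structure GammaRep (n : ℕ) where
  gam : Fin (n + 1) → SpinMatrix n
  C : SpinMatrix n
  clifford : ∀ a b, gam a * gam b + gam b * gam a = if a = b then (2 * (eta a : ℂ)) • 1 else 0
  timelike : (gam 0).conjTranspose = -gam 0
  spacelike : ∀ i : Fin n, (gam i.succ).conjTranspose = gam i.succ
  C_transpose : C.transpose = -C
  C_unitary : C.conjTranspose * C = 1
  C_gam : ∀ a, (gam a).transpose * C = -(C * gam a)

variable {n : ℕ} (γ : GammaRep n)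

/-- The matrix `β = i γ^0`. -/
noncomputable def GammaRep.beta : SpinMatrix n := Complex.I • γ.gam 0

/-- Charge conjugation `χ^c = -β C^* χ^*`. -/
noncomputable def GammaRep.chargeConj (χ : Spinor n) : Spinor n :=
  -(γ.beta.mulVec ((γ.C.map star).mulVec (star χ)))

/-- The real vector space of Majorana spinors `χ^c = χ`. -/
noncomputable def GammaRep.majorana : Submodule ℝ (Spinor n) where
  carrier := {χ | γ.chargeConj χ = χ}
  zero_mem' := by simp [GammaRep.chargeConj]
  add_mem' := by
    intro a b ha hb
    simp only [Set.mem_ofPred_eq, GammaRep.chargeConj] at *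
    rw [star_add, Matrix.mulVec_add, Matrix.mulVec_add, neg_add, ha, hb]
  smul_mem' := by
    intro c a ha
    simp only [Set.mem_ofPred_eq, GammaRep.chargeConj] at *
    rw [star_smul, star_trivial, Matrix.mulVec_smul, Matrix.mulVec_smul, ← smul_neg, ha]

/-! ## The spacetime `M = ℝ × T^n`, its universal cover and its causal structure -/

/-- The spacetime `ℝ × T^n`, with angles modulo `2π`. -/
abbrev Spacetime (n : ℕ) : Type := ℝ × (Fin n → AddCircle (2 * Real.pi))

/-- The universal cover of the spacetime: Minkowski space, with time coordinate `x 0`. -/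
abbrev Mink (n : ℕ) : Type := Fin (n + 1) → ℝ

/-- The covering projection. -/
noncomputable def proj (x : Mink n) : Spacetime n := (x 0, fun i => (x i.succ : AddCircle (2 * Real.pi)))

/-- The translation by `2π k`; these are the deck transformations of `proj`. -/
noncomputable def deck (k : Fin n → ℤ) (x : Mink n) : Mink n :=
  x + Fin.cons 0 (fun i => 2 * Real.pi * (k i : ℝ))

/-- Future-directed causal vectors for the metric `-dt² + ∑ dφᵢ²`. -/
def IsFutureCausal (v : Mink n) : Prop := 0 < v 0 ∧ ∑ μ, eta μ * v μ ^ 2 ≤ 0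

/-- `q` is reachable from `p` along a (possibly trivial) future-directed causal curve; curves
in the spacetime are written through their lifts to the universal cover. -/
def CausalLE (p q : Spacetime n) : Prop :=
  p = q ∨ ∃ c : ℝ → Mink n, ContDiff ℝ 1 c ∧ (∀ t ∈ Set.Icc (0 : ℝ) 1, IsFutureCausal (deriv c t)) ∧
    proj (c 0) = p ∧ proj (c 1) = q

/-- Causal future. -/
def Jplus (A : Set (Spacetime n)) : Set (Spacetime n) := {q | ∃ p ∈ A, CausalLE p q}

/-- Causal past. -/
def Jminus (A : Set (Spacetime n)) : Set (Spacetime n) := {q | ∃ p ∈ A, CausalLE q p}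

/-! ## Restricted Lorentz group, spin group, spin structures -/

/-- The matrix of the Minkowski metric. -/
def etaMat (n : ℕ) : Matrix (Fin (n + 1)) (Fin (n + 1)) ℝ := Matrix.diagonal eta

lemma eta_mul_eta (μ : Fin (n + 1)) : eta μ * eta μ = 1 := by
  unfold eta; split_ifs <;> norm_num

lemma etaMat_sq : etaMat n * etaMat n = 1 := by
  simp [etaMat, Matrix.diagonal_mul_diagonal, eta_mul_eta]

/-- If `Aᵀ η A = η`, then also `A η Aᵀ = η`. -/
lemma lorentz_transpose {A : Matrix (Fin (n + 1)) (Fin (n + 1)) ℝ}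
    (h : A.transpose * etaMat n * A = etaMat n) : A * etaMat n * A.transpose = etaMat n := by
  have h1 : (etaMat n * A.transpose * etaMat n) * A = 1 := by
    rw [Matrix.mul_assoc, Matrix.mul_assoc, ← Matrix.mul_assoc A.transpose, h, etaMat_sq]
  have h2 := mul_eq_one_comm.mp h1
  calc A * etaMat n * A.transpose
      = A * (etaMat n * A.transpose * etaMat n) * etaMat n := by
        simp only [Matrix.mul_assoc, etaMat_sq, Matrix.mul_one]
    _ = etaMat n := by rw [h2, Matrix.one_mul]

lemma lorentz_col {A : Matrix (Fin (n + 1)) (Fin (n + 1)) ℝ}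
    (h : A.transpose * etaMat n * A = etaMat n) :
    ∑ i : Fin n, A i.succ 0 ^ 2 = A 0 0 ^ 2 - 1 := by
  have h0 := congrFun (congrFun h 0) 0
  rw [Matrix.mul_apply] at h0
  simp only [etaMat, Matrix.mul_diagonal, Matrix.transpose_apply, Matrix.diagonal_apply_eq] at h0
  rw [Fin.sum_univ_succ] at h0
  simp only [eta, Fin.succ_ne_zero, if_true, if_false] at h0
  have : ∑ i : Fin n, A i.succ 0 ^ 2 = ∑ i : Fin n, A i.succ 0 * 1 * A i.succ 0 :=
    Finset.sum_congr rfl fun i _ => by ring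
  rw [this]; linarith

lemma lorentz_mul_pos {A B : Matrix (Fin (n + 1)) (Fin (n + 1)) ℝ}
    (hA : A.transpose * etaMat n * A = etaMat n) (hB : B.transpose * etaMat n * B = etaMat n)
    (hA0 : 0 < A 0 0) (hB0 : 0 < B 0 0) : 0 < (A * B) 0 0 := by
  have hA' : A.transpose.transpose * etaMat n * A.transpose = etaMat n := by
    rw [Matrix.transpose_transpose]; exact lorentz_transpose hA
  have a := lorentz_col hA'
  have b := lorentz_col hB
  simp only [Matrix.transpose_apply] at a
  have cs := Finset.sum_mul_sq_le_sq_mul_sq Finset.univ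
    (fun i : Fin n => A 0 i.succ) (fun i : Fin n => B i.succ 0)
  rw [a, b] at cs
  have hAn : 0 ≤ A 0 0 ^ 2 - 1 := a ▸ Finset.sum_nonneg fun i _ => sq_nonneg _
  have hBn : 0 ≤ B 0 0 ^ 2 - 1 := b ▸ Finset.sum_nonneg fun i _ => sq_nonneg _
  rw [Matrix.mul_apply, Fin.sum_univ_succ]
  set s := ∑ i : Fin n, A 0 i.succ * B i.succ 0
  have hlt : s ^ 2 < (A 0 0 * B 0 0) ^ 2 := by nlinarith
  have h3 := (abs_lt.mp (abs_lt_of_sq_lt_sq hlt (by positivity))).1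
  linarith

/-- The restricted (proper orthochronous) Lorentz group `SO⁺(1, n)`. -/
def restrictedLorentz (n : ℕ) : Subgroup (Matrix.GeneralLinearGroup (Fin (n + 1)) ℝ) where
  carrier := {A | A.1.transpose * etaMat n * A.1 = etaMat n ∧ A.1.det = 1 ∧ 0 < A.1 0 0}
  one_mem' := by simp
  mul_mem' := by
    rintro A B ⟨hA, hA1, hA0⟩ ⟨hB, hB1, hB0⟩
    refine ⟨?_, ?_, ?_⟩
    · rw [Units.val_mul, Matrix.transpose_mul]
      calc B.1.transpose * A.1.transpose * etaMat n * (A.1 * B.1)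
          = B.1.transpose * (A.1.transpose * etaMat n * A.1) * B.1 := by
            simp only [Matrix.mul_assoc]
        _ = etaMat n := by rw [hA, hB]
    · rw [Units.val_mul, Matrix.det_mul, hA1, hB1, one_mul]
    · rw [Units.val_mul]; exact lorentz_mul_pos hA hB hA0 hB0
  inv_mem' := by
    rintro A ⟨hA, hA1, hA0⟩
    have h1 : (etaMat n * A.1.transpose * etaMat n) * A.1 = 1 := by
      rw [Matrix.mul_assoc, Matrix.mul_assoc, ← Matrix.mul_assoc A.1.transpose, hA, etaMat_sq]
    have hinv : (A⁻¹).1 = etaMat n * A.1.transpose * etaMat n := by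
      calc (A⁻¹).1 = (etaMat n * A.1.transpose * etaMat n) * A.1 * (A⁻¹).1 := by
            rw [h1, Matrix.one_mul]
        _ = etaMat n * A.1.transpose * etaMat n := by
            rw [Matrix.mul_assoc _ A.1, ← Units.val_mul, mul_inv_cancel]; simp
    have hdet : (etaMat n).det * (etaMat n).det = 1 := by
      rw [← Matrix.det_mul, etaMat_sq, Matrix.det_one]
    refine ⟨?_, ?_, ?_⟩
    · rw [hinv]
      have hT : (etaMat n).transpose = etaMat n := by simp [etaMat]
      simp only [Matrix.transpose_mul, Matrix.transpose_transpose, hT]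
      calc etaMat n * (A.1 * etaMat n) * etaMat n * (etaMat n * A.1.transpose * etaMat n)
          = etaMat n * (A.1 * (etaMat n * (etaMat n * etaMat n)) * A.1.transpose) * etaMat n := by
            simp only [Matrix.mul_assoc]
        _ = etaMat n := by
            rw [etaMat_sq, Matrix.mul_one, lorentz_transpose hA, etaMat_sq, Matrix.one_mul]
    · rw [hinv, Matrix.det_mul, Matrix.det_mul, Matrix.det_transpose, hA1]
      linarith
    · rw [hinv]
      have : (etaMat n * A.1.transpose * etaMat n) 0 0 = A.1 0 0 := by
        simp [etaMat, Matrix.mul_diagonal, Matrix.diagonal_mul, eta]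
      rw [this]; exact hA0

/-- The spin group of the restricted Lorentz group in the Majorana representation, realised as
the graph of its covering homomorphism: pairs `(S, Λ)` with `Λ ∈ SO⁺(1, n)` and
`S⁻¹ γ^a S = Λ^a_b γ^b`, where `S` preserves the bilinear form given by `C` and commutes with
charge conjugation. Given `Λ`, such an `S` exists and is unique up to sign. -/
def spinGroup : Subgroup
    (Matrix.GeneralLinearGroup (Fin (spinDim n)) ℂ × Matrix.GeneralLinearGroup (Fin (n + 1)) ℝ) where
  carrier := {g | g.2 ∈ restrictedLorentz n ∧
    (∀ a, γ.gam a * g.1.1 = g.1.1 * ∑ b, ((g.2.1 a b : ℝ) : ℂ) • γ.gam b) ∧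
    g.1.1.transpose * γ.C * g.1.1 = γ.C ∧
    ∀ χ, γ.chargeConj (g.1.1.mulVec χ) = g.1.1.mulVec (γ.chargeConj χ)}
  one_mem' := by
    refine ⟨one_mem _, fun a => ?_, by simp, by simp⟩
    simp [Matrix.one_apply, Finset.sum_ite_eq]
  mul_mem' := by
    rintro ⟨S, A⟩ ⟨T, B⟩ ⟨hA, hS, hSC, hSc⟩ ⟨hB, hT, hTC, hTc⟩
    dsimp only at hA hS hSC hSc hB hT hTC hTc
    refine ⟨mul_mem hA hB, fun a => ?_, ?_, fun χ => ?_⟩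
    · simp only [Prod.mk_mul_mk, Units.val_mul]
      rw [← Matrix.mul_assoc, hS a, Matrix.mul_assoc, Matrix.mul_assoc]
      congr 1
      rw [Finset.sum_mul]
      simp only [Matrix.smul_mul, hT]
      simp only [Matrix.mul_apply, Complex.ofReal_sum, Complex.ofReal_mul, Finset.sum_smul]
      rw [Finset.sum_comm, Matrix.mul_sum]
      simp only [Matrix.mul_sum, Finset.smul_sum, Matrix.mul_smul, smul_smul]
    · simp only [Prod.mk_mul_mk, Units.val_mul, Matrix.transpose_mul]
      calc T.1.transpose * S.1.transpose * γ.C * (S.1 * T.1)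
          = T.1.transpose * (S.1.transpose * γ.C * S.1) * T.1 := by simp only [Matrix.mul_assoc]
        _ = γ.C := by rw [hSC, hTC]
    · simp only [Prod.mk_mul_mk, Units.val_mul]
      rw [← Matrix.mulVec_mulVec, hSc, hTc, Matrix.mulVec_mulVec]
  inv_mem' := by
    rintro ⟨S, A⟩ ⟨hA, hS, hSC, hSc⟩
    dsimp only at hA hS hSC hSc
    have hSS : S.1 * (S⁻¹).1 = 1 := by rw [← Units.val_mul, mul_inv_cancel]; rfl
    have hSS' : (S⁻¹).1 * S.1 = 1 := by rw [← Units.val_mul, inv_mul_cancel]; rfl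
    have hAA : (A⁻¹).1 * A.1 = 1 := by rw [← Units.val_mul, inv_mul_cancel]; rfl
    refine ⟨inv_mem hA, fun a => ?_, ?_, fun χ => ?_⟩
    · have key : S.1 * γ.gam a = (∑ b, (((A⁻¹).1 a b : ℝ) : ℂ) • γ.gam b) * S.1 := by
        rw [Finset.sum_mul]
        simp only [Matrix.smul_mul, hS]
        simp only [← Matrix.mul_smul, ← Matrix.mul_sum]
        congr 1
        simp only [Finset.smul_sum, smul_smul]
        rw [Finset.sum_comm]
        simp only [← Finset.sum_smul, ← Complex.ofReal_mul, ← Complex.ofReal_sum,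
          ← Matrix.mul_apply, hAA]
        simp [Matrix.one_apply]
      calc γ.gam a * (S⁻¹).1 = (S⁻¹).1 * (S.1 * γ.gam a) * (S⁻¹).1 := by
            rw [← Matrix.mul_assoc, hSS', Matrix.one_mul]
        _ = (S⁻¹).1 * ∑ b, (((A⁻¹).1 a b : ℝ) : ℂ) • γ.gam b := by
            rw [key, Matrix.mul_assoc, Matrix.mul_assoc, hSS, Matrix.mul_one]
    · simp only [Prod.inv_mk]
      have hT : (S⁻¹).1.transpose * S.1.transpose = 1 := by
        rw [← Matrix.transpose_mul, hSS, Matrix.transpose_one]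
      calc (S⁻¹).1.transpose * γ.C * (S⁻¹).1
          = (S⁻¹).1.transpose * (S.1.transpose * γ.C * S.1) * (S⁻¹).1 := by rw [hSC]
        _ = ((S⁻¹).1.transpose * S.1.transpose) * γ.C * (S.1 * (S⁻¹).1) := by
            simp only [Matrix.mul_assoc]
        _ = γ.C := by rw [hT, hSS, Matrix.one_mul, Matrix.mul_one]
    · simp only [Prod.inv_mk]
      have h := hSc ((S⁻¹).1.mulVec χ)
      rw [Matrix.mulVec_mulVec, hSS, Matrix.one_mulVec] at h
      rw [h, Matrix.mulVec_mulVec, hSS', Matrix.one_mulVec]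

/-- A spin structure on `ℝ × T^n`, given as the quotient of the spin structure
`Mink n × Spin → Mink n × SO⁺(1, n)` of the simply connected universal cover: a lift of the
action of the deck group on the bundle `Mink n × SO⁺(1, n)` of orthonormal frames, which is
`(x, Λ) ↦ (deck k x, Λ)`, to an action on `Mink n × Spin` by automorphisms of the principal
`Spin`-bundle. -/
structure SpinStructure where
  lift : (Fin n → ℤ) → Mink n × spinGroup γ → Mink n × spinGroup γ
  lift_zero : ∀ p, lift 0 p = p
  lift_add : ∀ k l p, lift (k + l) p = lift k (lift l p)
  continuous : ∀ k, Continuous (lift k)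
  equivariant : ∀ k x s g, lift k (x, s * g) = ((lift k (x, s)).1, (lift k (x, s)).2 * g)
  covers : ∀ k x s, (lift k (x, s)).1 = deck k x ∧ (lift k (x, s)).2.1.2 = s.1.2

/-- The trivial spin structure. -/
noncomputable def SpinStructure.trivial : SpinStructure γ where
  lift k p := (deck k p.1, p.2)
  lift_zero p := by
    refine Prod.ext ?_ rfl
    funext μ
    refine Fin.cases ?_ (fun i => ?_) μ <;> simp [deck]
  lift_add k l p := by
    refine Prod.ext ?_ rfl
    funext μ
    refine Fin.cases ?_ (fun i => ?_) μ
    · simp [deck]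
    · simp [deck]; ring
  continuous k := by
    unfold deck
    fun_prop
  equivariant _ _ _ _ := rfl
  covers _ _ _ := ⟨rfl, rfl⟩

variable {γ}

/-- Isomorphism of spin structures: an isomorphism of principal `Spin`-bundles over the identity
of the frame bundle, written on the universal cover as one that intertwines the deck actions. -/
def SpinStructure.IsIso (σ σ' : SpinStructure γ) : Prop :=
  ∃ Φ : Mink n × spinGroup γ ≃ₜ Mink n × spinGroup γ,
    (∀ x s g, Φ (x, s * g) = ((Φ (x, s)).1, (Φ (x, s)).2 * g)) ∧
    (∀ x s, (Φ (x, s)).1 = x ∧ (Φ (x, s)).2.1.2 = s.1.2) ∧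
    ∀ k p, Φ (σ.lift k p) = σ'.lift k (Φ p)

/-- The transition matrix: the spin frame `(x, 1)` over `x` is identified with the spin frame
`(deck k x, transition k x)` over `deck k x`. -/
def SpinStructure.transition (σ : SpinStructure γ) (k : Fin n → ℤ) (x : Mink n) : SpinMatrix n :=
  (σ.lift k (x, 1)).2.1.1.1

/-! ## Sections of `V = DM_ℝ ⊗ T^*M` -/

variable (n) in
/-- Components `ψ_μ(x)`, with respect to the parallel coordinate frame and the parallel spin frame
on the universal cover, of a field with values in `DM ⊗ T^*M`. -/
abbrev Field : Type := Mink n → Fin (n + 1) → Spinor n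

/-- `Γ^∞(V)`: smooth Majorana valued fields on the universal cover that descend to the spacetime. -/
noncomputable def sections (σ : SpinStructure γ) : Submodule ℝ (Field n) where
  carrier := {ψ | ContDiff ℝ ∞ ψ ∧ (∀ x μ, ψ x μ ∈ γ.majorana) ∧
    ∀ k x μ, ψ (deck k x) μ = (σ.transition k x).mulVec (ψ x μ)}
  zero_mem' := ⟨contDiff_const, fun _ _ => zero_mem _, fun _ _ _ => by simp⟩
  add_mem' := by
    rintro a b ⟨ha, ha', ha''⟩ ⟨hb, hb', hb''⟩
    exact ⟨ha.add hb, fun x μ => add_mem (ha' x μ) (hb' x μ), fun k x μ => by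
      simp [ha'', hb'', Matrix.mulVec_add]⟩
  smul_mem' := by
    rintro c a ⟨ha, ha', ha''⟩
    exact ⟨contDiff_const.smul ha, fun x μ => Submodule.smul_mem _ c (ha' x μ), fun k x μ => by
      simp [ha'', Matrix.mulVec_smul]⟩

/-- Support of a field, as a closed subset of the spacetime. -/
def supp (ψ : Field n) : Set (Spacetime n) := closure (proj '' Function.support ψ)

lemma supp_add_subset (a b : Field n) : supp (a + b) ⊆ supp a ∪ supp b := by
  unfold supp
  rw [← closure_union, ← Set.image_union]
  exact closure_mono (Set.image_mono (Function.support_add a b))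

/-- `Γ^∞_0(V)`: sections with compact support. -/
noncomputable def sections₀ (σ : SpinStructure γ) : Submodule ℝ (Field n) where
  carrier := {ψ | ψ ∈ sections σ ∧ IsCompact (supp ψ)}
  zero_mem' := ⟨zero_mem _, by simp [supp]⟩
  add_mem' := by
    rintro a b ⟨ha, ha'⟩ ⟨hb, hb'⟩
    exact ⟨add_mem ha hb, (ha'.union hb').of_isClosed_subset isClosed_closure
      (supp_add_subset a b)⟩
  smul_mem' := by
    rintro c a ⟨ha, ha'⟩
    exact ⟨Submodule.smul_mem _ c ha, ha'.of_isClosed_subset isClosed_closure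
      (closure_mono (Set.image_mono (Function.support_const_smul_subset c a)))⟩

/-! ## Differential operators -/

/-- `∂_ν f`; for the flat metric this is the covariant derivative in the parallel frames. -/
noncomputable def pd {F : Type*} [NormedAddCommGroup F] [NormedSpace ℝ F] {m : ℕ}
    (ν : Fin m) (f : (Fin m → ℝ) → F) (x : Fin m → ℝ) : F :=
  fderiv ℝ f x (Pi.single ν 1)

lemma pd_add {a b : Field n} (ha : ContDiff ℝ ∞ a) (hb : ContDiff ℝ ∞ b) (ν : Fin (n + 1))
    (x : Mink n) : pd ν (a + b) x = pd ν a x + pd ν b x := by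
  unfold pd
  rw [fderiv_add (ha.differentiable (by simp) x) (hb.differentiable (by simp) x)]; rfl

lemma pd_smul {a : Field n} (ha : ContDiff ℝ ∞ a) (c : ℝ) (ν : Fin (n + 1))
    (x : Mink n) : pd ν (c • a) x = c • pd ν a x := by
  unfold pd
  rw [fderiv_const_smul (ha.differentiable (by simp) x)]; rfl

lemma pd_zero (ν : Fin (n + 1)) (x : Mink n) : pd ν (0 : Field n) x = 0 := by
  unfold pd
  rw [fderiv_zero]; rfl

variable (γ)

/-- The twisted Dirac operator `(∇̸ψ)_μ = γ^ν ∂_ν ψ_μ`. -/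
noncomputable def dirac (ψ : Field n) : Field n :=
  fun x μ => ∑ ν, (γ.gam ν).mulVec (pd ν ψ x μ)

/-- The divergence `∂^ν ψ_ν`. -/
noncomputable def divergence (ψ : Field n) : Mink n → Spinor n :=
  fun x => ∑ ν, eta ν • pd ν ψ x ν

/-- The lower index gamma matrices `γ_μ`. -/
noncomputable def GammaRep.low (μ : Fin (n + 1)) : SpinMatrix n := eta μ • γ.gam μ

/-- The gamma trace `γ^μ v_μ`. -/
noncomputable def gammaTrace (v : Fin (n + 1) → Spinor n) : Spinor n :=
  ∑ μ, (γ.gam μ).mulVec (v μ)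

/-- The Rarita-Schwinger operator `(Pψ)_μ = ∇̸ψ_μ - γ_μ ∂^ν ψ_ν`. -/
noncomputable def opP (ψ : Field n) : Field n :=
  fun x μ => dirac γ ψ x μ - (γ.low μ).mulVec (divergence ψ x)

/-- The generator of gauge transformations `(Kε)_μ = ∂_μ ε - (1/2) γ_μ ∇̸ε`. -/
noncomputable def opK (ε : Mink n → Spinor n) : Field n :=
  fun x μ => pd μ ε x - (1 / 2 : ℝ) • (γ.low μ).mulVec (∑ ν, (γ.gam ν).mulVec (pd ν ε x))

/-- The formal adjoint of `K`, `K^†ψ = -∂^μ ψ_μ`. -/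
noncomputable def opKdag (ψ : Field n) : Mink n → Spinor n := fun x => -divergence ψ x

/-- `(Tε)_μ = -γ_μ ε`. -/
noncomputable def opT (ε : Mink n → Spinor n) : Field n := fun x μ => -((γ.low μ).mulVec (ε x))

/-- The gauge fixed operator `P + T ∘ K^†`. -/
noncomputable def opPtilde (ψ : Field n) : Field n := opP γ ψ + opT γ (opKdag ψ)

lemma divergence_add {a b : Field n} (ha : ContDiff ℝ ∞ a) (hb : ContDiff ℝ ∞ b) :
    divergence (a + b) = divergence a + divergence b := by
  funext x
  simp [divergence, pd_add ha hb, Finset.sum_add_distrib]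

lemma divergence_smul {a : Field n} (ha : ContDiff ℝ ∞ a) (c : ℝ) :
    divergence (c • a) = c • divergence a := by
  funext x
  simp only [divergence, pd_smul ha, Pi.smul_apply, Finset.smul_sum]
  exact Finset.sum_congr rfl fun _ _ => smul_comm _ _ _

lemma divergence_zero : divergence (0 : Field n) = 0 := by
  funext x
  simp [divergence, pd_zero]

lemma opP_add {a b : Field n} (ha : ContDiff ℝ ∞ a) (hb : ContDiff ℝ ∞ b) :
    opP γ (a + b) = opP γ a + opP γ b := by
  funext x μ
  simp only [opP, dirac, divergence_add ha hb, pd_add ha hb, Pi.add_apply, Matrix.mulVec_add,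
    Finset.sum_add_distrib]
  abel

lemma opP_smul {a : Field n} (ha : ContDiff ℝ ∞ a) (c : ℝ) :
    opP γ (c • a) = c • opP γ a := by
  funext x μ
  simp only [opP, dirac, divergence_smul ha, pd_smul ha, Pi.smul_apply, Matrix.mulVec_smul,
    ← Finset.smul_sum, smul_sub]

lemma opP_zero : opP γ (0 : Field n) = 0 := by
  funext x μ
  simp [opP, dirac, divergence_zero, pd_zero]

/-! ## Bilinear forms -/

/-- The antisymmetric real bilinear form on Majorana spinors: `vᵀ C w` is purely imaginary there,
and it is rescaled by `-i` to a real number. -/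
noncomputable def formW (v w : Spinor n) : ℝ := (-Complex.I * (v ⬝ᵥ γ.C.mulVec w)).re

/-- `⟨v, w⟩_V = ⟨v_μ, w^μ⟩_W + (D - 2)⁻¹ ⟨γ^μ v_μ, γ^ν w_ν⟩_W`. -/
noncomputable def formV (v w : Fin (n + 1) → Spinor n) : ℝ :=
  ∑ μ, eta μ * formW γ (v μ) (w μ) +
    (((n + 1 : ℕ) : ℝ) - 2)⁻¹ * formW γ (gammaTrace γ v) (gammaTrace γ w)

/-- The fundamental domain `ℝ × [0, 2π)^n` of the covering. -/
def fundDomain (n : ℕ) : Set (Mink n) := {x | ∀ i : Fin n, x i.succ ∈ Set.Ico 0 (2 * Real.pi)}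

/-- `⟨f, h⟩_{Γ(V)} = ∫_M ⟨f, h⟩_V`. -/
noncomputable def pairing (f h : Field n) : ℝ :=
  ∫ x in fundDomain n, formV γ (f x) (h x)

variable {γ}

/-! ## Green's operators and the inner product space `(𝓔, τ)` -/

/-- Continuity of a linear map `Γ^∞_0(V) → Γ^∞(V)`: on sections supported in a fixed compact set,
each `C^m`-seminorm over a compact set of the image is bounded by a multiple of some `C^l`-norm. -/
def IsContinuousOp {σ : SpinStructure γ} (G : sections₀ σ →ₗ[ℝ] sections σ) : Prop :=
  ∀ (K : Set (Spacetime n)) (L : Set (Mink n)) (m : ℕ), IsCompact K → IsCompact L →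
    ∃ (l : ℕ) (c : ℝ), ∀ (f : sections₀ σ) (b : ℝ), supp f.1 ⊆ K →
      (∀ j ≤ l, ∀ x, ‖iteratedFDeriv ℝ j f.1 x‖ ≤ b) →
      ∀ j ≤ m, ∀ x ∈ L, ‖iteratedFDeriv ℝ j (G f).1 x‖ ≤ c * b

/-- Green's operators for `P + T ∘ K^†` whose support lies in the set `J (supp f)`: retarded
for `J = Jplus`, advanced for `J = Jminus`. -/
structure IsGreen {σ : SpinStructure γ} (J : Set (Spacetime n) → Set (Spacetime n))
    (G : sections₀ σ →ₗ[ℝ] sections σ) : Prop where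
  continuous : IsContinuousOp G
  right_inv : ∀ f : sections₀ σ, opPtilde γ (G f).1 = f.1
  left_inv : ∀ f h : sections₀ σ, h.1 = opPtilde γ f.1 → (G h).1 = f.1
  support : ∀ f : sections₀ σ, supp (G f).1 ⊆ J (supp f.1)

/-- `Ker_0(K^†)`. -/
noncomputable def kerKdag (σ : SpinStructure γ) : Submodule ℝ (Field n) where
  carrier := {f | f ∈ sections₀ σ ∧ opKdag f = 0}
  zero_mem' := ⟨zero_mem _, by funext x; simp [opKdag, divergence_zero]⟩
  add_mem' := by
    rintro a b ⟨ha, ha'⟩ ⟨hb, hb'⟩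
    refine ⟨add_mem ha hb, ?_⟩
    funext x
    have h1 := congrFun ha' x
    have h2 := congrFun hb' x
    simp only [opKdag, divergence_add ha.1.1 hb.1.1, Pi.add_apply, neg_add] at *
    rw [h1, h2]; simp
  smul_mem' := by
    rintro c a ⟨ha, ha'⟩
    refine ⟨Submodule.smul_mem _ c ha, ?_⟩
    funext x
    have h1 := congrFun ha' x
    simp only [opKdag, divergence_smul ha.1.1, Pi.smul_apply, ← smul_neg] at *
    rw [h1]; simp

/-- `P[Γ^∞_0(V)]`, as a subspace of `Ker_0(K^†)`, in which it is contained. -/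
noncomputable def rangeP (σ : SpinStructure γ) : Submodule ℝ (kerKdag σ) where
  carrier := {f | ∃ h ∈ sections₀ σ, f.1 = opP γ h}
  zero_mem' := ⟨0, zero_mem _, (opP_zero γ).symm⟩
  add_mem' := by
    rintro a b ⟨u, hu, hu'⟩ ⟨v, hv, hv'⟩
    exact ⟨u + v, add_mem hu hv, by rw [opP_add γ hu.1.1 hv.1.1, ← hu', ← hv']; rfl⟩
  smul_mem' := by
    rintro c a ⟨u, hu, hu'⟩
    exact ⟨c • u, Submodule.smul_mem _ c hu, by rw [opP_smul γ hu.1.1, ← hu']; rfl⟩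

/-- `𝓔 = Ker_0(K^†) / P[Γ^∞_0(V)]`. -/
abbrev Obs (σ : SpinStructure γ) : Type := kerKdag σ ⧸ rangeP σ

/-- `τ` is the bilinear map `τ([f], [h]) = ∫_M ⟨f, (G₊ - G₋) h⟩_V` on `𝓔`, for retarded and
advanced Green's operators `G₊` and `G₋` of `P + T ∘ K^†`. -/
def IsTau (σ : SpinStructure γ) (τ : Obs σ →ₗ[ℝ] Obs σ →ₗ[ℝ] ℝ) : Prop :=
  ∃ Gp Gm : sections₀ σ →ₗ[ℝ] sections σ, IsGreen Jplus Gp ∧ IsGreen Jminus Gm ∧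
    ∀ f h : kerKdag σ, τ ((rangeP σ).mkQ f) ((rangeP σ).mkQ h) =
      pairing γ f.1 ((Gp ⟨h.1, h.2.1⟩).1 - (Gm ⟨h.1, h.2.1⟩).1)

/-- The Rarita-Schwinger gauge field is of positive type: `(𝓔, τ)` is a real pre-Hilbert space. -/
def IsPositiveType (σ : SpinStructure γ) : Prop :=
  ∃ τ : Obs σ →ₗ[ℝ] Obs σ →ₗ[ℝ] ℝ, IsTau σ τ ∧ (∀ e e', τ e e' = τ e' e) ∧ ∀ e ≠ 0, 0 < τ e e

/-! ## Solutions -/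

/-- `ψ = ψ₊ + ψ₋` is a splitting of a section of spacelike compact support, with
`supp ψ ⊆ J(C)` and `supp ψ₊ ⊆ J⁺(C)`, `supp ψ₋ ⊆ J⁻(C)` for a compact set `C`. -/
def IsSplitting (σ : SpinStructure γ) (ψ ψp ψm : Field n) : Prop :=
  ψ ∈ sections σ ∧ ψp ∈ sections σ ∧ ψm ∈ sections σ ∧ ψ = ψp + ψm ∧
    ∃ C : Set (Spacetime n), IsCompact C ∧ supp ψ ⊆ Jplus C ∪ Jminus C ∧
      supp ψp ⊆ Jplus C ∧ supp ψm ⊆ Jminus C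

/-- `Sol`: sections of spacelike compact support with `Pψ = 0`. -/
def IsSol (σ : SpinStructure γ) (ψ : Field n) : Prop :=
  ψ ∈ sections σ ∧ (∃ C : Set (Spacetime n), IsCompact C ∧ supp ψ ⊆ Jplus C ∪ Jminus C) ∧
    opP γ ψ = 0

/-- `r = ⟨ψ₁, ψ₂⟩_Sol`: splittings of `ψ₁` exist, and `r = ⟨P ψ₁₊, ψ₂⟩_{Γ(V)}` for all of them. -/
def IsSolPairing (σ : SpinStructure γ) (ψ₁ ψ₂ : Field n) (r : ℝ) : Prop :=
  (∃ ψp ψm, IsSplitting σ ψ₁ ψp ψm) ∧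
    ∀ ψp ψm, IsSplitting σ ψ₁ ψp ψm → pairing γ (opP γ ψp) ψ₂ = r

/-- `v† v`. -/
noncomputable def normSq (v : Spinor n) : ℝ := (star v ⬝ᵥ v).re

/-! ## The Dirac operator of the torus -/

/-- Smooth (complex) spinor fields on the slice `{t} × T^n` for the induced spin structure. -/
def IsTorusSpinor (σ : SpinStructure γ) (t : ℝ) (χ : (Fin n → ℝ) → Spinor n) : Prop :=
  ContDiff ℝ ∞ χ ∧ ∀ (k : Fin n → ℤ) (y : Fin n → ℝ),
    χ (fun i => y i + 2 * Real.pi * (k i : ℝ)) = (σ.transition k (Fin.cons t y)).mulVec (χ y)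

variable (γ) in
/-- The induced Dirac operator `γ^i ∂_i` on the torus. -/
noncomputable def torusDirac (χ : (Fin n → ℝ) → Spinor n) : (Fin n → ℝ) → Spinor n :=
  fun y => ∑ i : Fin n, (γ.gam i.succ).mulVec (pd i χ y)

end RaritaSchwinger

open RaritaSchwinger

/-!
# The Rarita-Schwinger field on a flat spacetime torus

*Spin structures.* By Schur's lemma for the gamma matrices (`exists_eq_smul_one_of_commute`, which
rests on the dimension bound `two_pow_le_finrank_of_anticommute`) the spin group covers the
restricted Lorentz group with kernel `{±1}`. Over the contractible cover `ℝ^D` a spin structure is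
therefore a character of the deck group `ℤ^(D-1)` with values in `{±1}`
(`SpinStructure.quotEquivSigns`), and sections of `V` are Majorana fields on `ℝ^D` that are periodic
up to these signs (`mem_sections_iff`).

*Green's operators.* The operator `P + T K†` is the Dirac operator on each component
(`opPtilde_eq_dirac`), whose square is the wave operator `□`. After conjugation with `e^t` the symbol
of `□` stays away from zero (`waveSymbol_lower`), so `□` can be inverted on Schwartz functions by a
Fourier multiplier; applying the Dirac operator to the result gives solutions that decay in the past
(`minkGreen`). The Dirac current is causal, and the energy estimate in a backward light cone shows
that such solutions are unique and propagate with finite speed (`eq_zero_of_past_cone`). Sources that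
vanish at early times are therefore treated by cutting off (`exists_retarded`), with estimates that
come from the continuity of the multiplier (`exists_bound_retarded`), and uniqueness transfers the
Majorana condition and the periodicity from the source to the solution (`mem_sections_of_dirac_eq`).
Advanced solutions are retarded ones for the reversed time.

*The form as a charge.* For solutions `u`, `χ` of `P u = P χ = 0` the current `⟨Γ^ν u, χ⟩_V`, with
`Γ^ν` the symbol of `P`, is conserved, and its time component is the density
`u_μ† χ^μ - (D-2)⁻¹ (γ^μ u_μ)† (γ^ν χ_ν)` (`formV_symbolP_zero`). A source `f` with `K† f = 0` is
`P` applied to the retarded part of the solution `(G₊ - G₋) f`, so Green's identity identifies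
`τ([f], [h])` with the total charge of the two generated solutions (`pairing_opP_eq`,
`pairing_causalProp`). Thus `τ` is well defined and symmetric (`existsUnique_isTau`), and positivity of
`τ` is positivity of the charge of solutions generated by sources outside `P[Γ₀]`
(`isPositiveType_iff`).

*Trivial spin structure.* Constant fields are solutions, their charge is `(2π)^(D-1)` times the
density, and the density is indefinite: a constant field with only a time component has negative
charge, and so does the source it comes from (`not_isPositiveType_trivial`).

*Nontrivial spin structures.* The wave vectors lie in a shifted lattice that does not contain zero
(`waveVec_sq_pos`), which makes the Dirac operator of the slices injective (`torusDirac_injective`).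
The generated solutions satisfy `∂^μ ψ_μ = 0` and the Dirac equation, hence the Gauss constraint
`∂_i ψ_i = γ⁰ γ^i ∂_i ψ_0`. Put `ω_μ = ψ_μ - (D-2)⁻¹ γ_μ γ^ν ψ_ν`. For each Fourier mode the constraint
turns the density into the squared norm of the part of `ω` that is transverse to the wave vector
(`density_eq_sum_transverse`), so the charge is nonnegative (`sliceCharge_nonneg`). If it vanishes, `ω`
has no spatial curl, and the field equations in the form `γ^ν (∂_ν ω_μ - ∂_μ ω_ν) = 0` remove the
remaining components of the curl. A closed one-form on `ℝ^D` is exact, and antiperiodicity fixes the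
constant in its primitive (`exists_twisted_primitive`); therefore `ω_μ = ∂_μ ε` and
`ψ_μ = (K ε)_μ = ∂_μ ε - ½ γ_μ γ^ν ∂_ν ε` (`exists_eq_opK`). As `P K = 0`, cutting off `ε` instead of
`ψ` shows that the source lies in `P[Γ₀]` (`mem_rangeP_of_sliceCharge_eq_zero`), that is, it
represents zero, and the charge is positive definite.
-/

namespace RaritaSchwinger

/-! ### Algebra of gamma matrices and Majorana spinors -/

section GammaAlgebra

variable {n : ℕ} (γ : GammaRep n)

open Matrix

lemma eta_zero : eta (0 : Fin (n + 1)) = -1 := by simp [eta]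

lemma eta_succ (i : Fin n) : eta i.succ = 1 := by simp [eta, Fin.succ_ne_zero]

/-- The real inner product `Re (v† w)` of spinors. -/
noncomputable def ip {N : ℕ} (v w : Fin N → ℂ) : ℝ := (star v ⬝ᵥ w).re

section ip

variable {N : ℕ}

lemma ip_eq_sum (v w : Fin N → ℂ) : ip v w = ∑ s, ((v s).re * (w s).re + (v s).im * (w s).im) := by
  simp [ip, dotProduct, Complex.mul_re]

lemma ip_comm (v w : Fin N → ℂ) : ip v w = ip w v := by
  simp only [ip_eq_sum, mul_comm]

lemma ip_add_left (u v w : Fin N → ℂ) : ip (u + v) w = ip u w + ip v w := by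
  simp [ip]

lemma ip_add_right (u v w : Fin N → ℂ) : ip u (v + w) = ip u v + ip u w := by
  simp [ip]

lemma ip_smul_left (c : ℝ) (v w : Fin N → ℂ) : ip (c • v) w = c * ip v w := by
  simp [ip_eq_sum, Finset.mul_sum, mul_add, mul_assoc]

lemma ip_smul_right (c : ℝ) (v w : Fin N → ℂ) : ip v (c • w) = c * ip v w := by
  rw [ip_comm, ip_smul_left, ip_comm]

lemma ip_neg_left (v w : Fin N → ℂ) : ip (-v) w = -ip v w := by simp [ip]

lemma ip_neg_right (v w : Fin N → ℂ) : ip v (-w) = -ip v w := by simp [ip]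

lemma ip_sub_left (u v w : Fin N → ℂ) : ip (u - v) w = ip u w - ip v w := by
  simp [ip]

lemma ip_sub_right (u v w : Fin N → ℂ) : ip u (v - w) = ip u v - ip u w := by
  simp [ip]

@[simp] lemma ip_zero_left (w : Fin N → ℂ) : ip 0 w = 0 := by simp [ip]

@[simp] lemma ip_zero_right (w : Fin N → ℂ) : ip w 0 = 0 := by simp [ip]

lemma ip_sum_left {ι : Type*} (s : Finset ι) (f : ι → Fin N → ℂ) (w : Fin N → ℂ) :
    ip (∑ i ∈ s, f i) w = ∑ i ∈ s, ip (f i) w := by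
  classical
  induction s using Finset.induction_on with
  | empty => simp
  | insert a s ha ih => rw [Finset.sum_insert ha, Finset.sum_insert ha, ip_add_left, ih]

lemma ip_sum_right {ι : Type*} (s : Finset ι) (f : ι → Fin N → ℂ) (w : Fin N → ℂ) :
    ip w (∑ i ∈ s, f i) = ∑ i ∈ s, ip w (f i) := by
  simp only [ip_comm w, ip_sum_left]

lemma ip_self_eq_sum (v : Fin N → ℂ) : ip v v = ∑ s, ‖v s‖ ^ 2 := by
  rw [ip_eq_sum]
  refine Finset.sum_congr rfl fun s _ => ?_
  rw [← Complex.normSq_eq_norm_sq, Complex.normSq_apply]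

lemma ip_self_nonneg (v : Fin N → ℂ) : 0 ≤ ip v v := by
  rw [ip_self_eq_sum]; positivity

lemma ip_self_eq_zero {v : Fin N → ℂ} : ip v v = 0 ↔ v = 0 := by
  refine ⟨fun h => ?_, fun h => by simp [h]⟩
  rw [ip_self_eq_sum, Finset.sum_eq_zero_iff_of_nonneg fun _ _ => by positivity] at h
  funext s
  simpa using h s (Finset.mem_univ s)

lemma ip_mulVec_left (A : Matrix (Fin N) (Fin N) ℂ) (v w : Fin N → ℂ) :
    ip (A *ᵥ v) w = ip v (Aᴴ *ᵥ w) := by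
  rw [ip, ip, star_mulVec, dotProduct_mulVec]

lemma ip_sq_le (v w : Fin N → ℂ) : ip v w ^ 2 ≤ ip v v * ip w w := by
  have h : ∀ t : ℝ, 0 ≤ ip w w * (t * t) + (2 * ip v w) * t + ip v v := by
    intro t
    have := ip_self_nonneg (v + t • w)
    rw [ip_add_left, ip_add_right, ip_add_right, ip_smul_left, ip_smul_left, ip_smul_right,
      ip_smul_right, ip_comm w v] at this
    linarith
  have := discrim_le_zero h
  unfold discrim at this
  linarith

end ip

lemma GammaRep.sq_apply (a : Fin (n + 1)) (v : Spinor n) :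
    γ.gam a *ᵥ (γ.gam a *ᵥ v) = eta a • v := by
  have h := γ.clifford a a
  rw [if_pos rfl, ← two_smul ℂ, mul_smul] at h
  have h2 := smul_right_injective _ (two_ne_zero (α := ℂ)) h
  rw [mulVec_mulVec, h2, smul_mulVec, one_mulVec]
  ext s; simp

lemma GammaRep.anticomm_apply {a b : Fin (n + 1)} (hab : a ≠ b) (v : Spinor n) :
    γ.gam a *ᵥ (γ.gam b *ᵥ v) = -(γ.gam b *ᵥ (γ.gam a *ᵥ v)) := by
  have h := γ.clifford a b
  rw [if_neg hab] at h
  rw [mulVec_mulVec, mulVec_mulVec, eq_neg_of_add_eq_zero_left h, neg_mulVec]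

/-- The Clifford relation, uniformly in both indices. -/
lemma GammaRep.clifford_apply (a b : Fin (n + 1)) (v : Spinor n) :
    γ.gam a *ᵥ (γ.gam b *ᵥ v) =
      (if a = b then (2 * eta a) • v else 0) - γ.gam b *ᵥ (γ.gam a *ᵥ v) := by
  split_ifs with h
  · subst h
    rw [γ.sq_apply, mul_smul, two_smul]; abel
  · rw [γ.anticomm_apply h, zero_sub]

lemma mulVec_smul_real (A : SpinMatrix n) (c : ℝ) (v : Spinor n) : A *ᵥ (c • v) = c • A *ᵥ v :=
  mulVec_smul A c v

lemma GammaRep.ip_gam_zero (v w : Spinor n) : ip (γ.gam 0 *ᵥ v) w = -ip v (γ.gam 0 *ᵥ w) := by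
  rw [ip_mulVec_left, γ.timelike, neg_mulVec, ip_neg_right]

lemma GammaRep.ip_gam_succ (i : Fin n) (v w : Spinor n) :
    ip (γ.gam i.succ *ᵥ v) w = ip v (γ.gam i.succ *ᵥ w) := by
  rw [ip_mulVec_left, γ.spacelike]

lemma GammaRep.ip_gam_zero_gam_zero (v w : Spinor n) :
    ip (γ.gam 0 *ᵥ v) (γ.gam 0 *ᵥ w) = ip v w := by
  rw [γ.ip_gam_zero, γ.sq_apply, eta_zero, ip_smul_right]; ring

lemma GammaRep.ip_gam_succ_gam_succ (i : Fin n) (v w : Spinor n) :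
    ip (γ.gam i.succ *ᵥ v) (γ.gam i.succ *ᵥ w) = ip v w := by
  rw [γ.ip_gam_succ, γ.sq_apply, eta_succ, one_smul]

/-! #### The bilinear forms -/

lemma formW_add_left (u v w : Spinor n) : formW γ (u + v) w = formW γ u w + formW γ v w := by
  simp [formW, add_dotProduct]

lemma formW_smul_left (c : ℝ) (v w : Spinor n) : formW γ (c • v) w = c * formW γ v w := by
  simp [formW, smul_dotProduct]

lemma formW_swap (v w : Spinor n) : formW γ v w = -formW γ w v := by
  have : v ⬝ᵥ γ.C *ᵥ w = -(w ⬝ᵥ γ.C *ᵥ v) := by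
    rw [dotProduct_mulVec, ← mulVec_transpose, γ.C_transpose, neg_mulVec, neg_dotProduct,
      dotProduct_comm]
  simp [formW, this]

lemma formW_add_right (u v w : Spinor n) : formW γ u (v + w) = formW γ u v + formW γ u w := by
  rw [formW_swap, formW_add_left, formW_swap γ u v, formW_swap γ u w]; ring

lemma formW_gam (a : Fin (n + 1)) (v w : Spinor n) :
    formW γ (γ.gam a *ᵥ v) w = -formW γ v (γ.gam a *ᵥ w) := by
  have : (γ.gam a *ᵥ v) ⬝ᵥ γ.C *ᵥ w = -(v ⬝ᵥ γ.C *ᵥ (γ.gam a *ᵥ w)) := by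
    rw [← vecMul_transpose, ← dotProduct_mulVec, mulVec_mulVec, mulVec_mulVec, γ.C_gam,
      neg_mulVec, dotProduct_neg]
  simp [formW, this]

lemma gammaTrace_add (v w : Fin (n + 1) → Spinor n) :
    gammaTrace γ (v + w) = gammaTrace γ v + gammaTrace γ w := by
  simp [gammaTrace, mulVec_add, Finset.sum_add_distrib]

lemma gammaTrace_smul (c : ℝ) (v : Fin (n + 1) → Spinor n) :
    gammaTrace γ (c • v) = c • gammaTrace γ v := by
  simp [gammaTrace, mulVec_smul, Finset.smul_sum]

lemma formV_add_left (u v w : Fin (n + 1) → Spinor n) :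
    formV γ (u + v) w = formV γ u w + formV γ v w := by
  simp only [formV, Pi.add_apply, formW_add_left, gammaTrace_add, mul_add, Finset.sum_add_distrib]
  ring

lemma formV_smul_left (c : ℝ) (v w : Fin (n + 1) → Spinor n) :
    formV γ (c • v) w = c * formV γ v w := by
  simp only [formV, Pi.smul_apply, formW_smul_left, gammaTrace_smul, mul_add, Finset.mul_sum]
  congr 1
  · exact Finset.sum_congr rfl fun _ _ => by ring
  · ring

lemma formV_swap (v w : Fin (n + 1) → Spinor n) : formV γ v w = -formV γ w v := by
  simp only [formV, formW_swap γ (v _) (w _), formW_swap γ (gammaTrace γ v) (gammaTrace γ w),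
    mul_neg, Finset.sum_neg_distrib]
  ring

lemma formV_add_right (u v w : Fin (n + 1) → Spinor n) :
    formV γ u (v + w) = formV γ u v + formV γ u w := by
  rw [formV_swap, formV_add_left, formV_swap γ u v, formV_swap γ u w]; ring

lemma formV_smul_right (c : ℝ) (v w : Fin (n + 1) → Spinor n) :
    formV γ v (c • w) = c * formV γ v w := by
  rw [formV_swap, formV_smul_left, formV_swap γ v w]; ring

/-- The form on `V` as a bilinear map. -/
noncomputable def formVBilin :
    (Fin (n + 1) → Spinor n) →ₗ[ℝ] (Fin (n + 1) → Spinor n) →ₗ[ℝ] ℝ :=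
  LinearMap.mk₂ ℝ (formV γ) (formV_add_left γ) (formV_smul_left γ) (formV_add_right γ)
    (formV_smul_right γ)

lemma formVBilin_apply (v w : Fin (n + 1) → Spinor n) : formVBilin γ v w = formV γ v w := rfl

/-- The symbol `Γ^ν` of the Rarita-Schwinger operator `P = Γ^ν ∂_ν`. -/
noncomputable def symbolP (ν : Fin (n + 1)) (v : Fin (n + 1) → Spinor n) :
    Fin (n + 1) → Spinor n :=
  fun μ => γ.gam ν *ᵥ v μ - γ.low μ *ᵥ (eta ν • v ν)

lemma low_mulVec (μ : Fin (n + 1)) (v : Spinor n) : γ.low μ *ᵥ v = eta μ • γ.gam μ *ᵥ v := by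
  rw [GammaRep.low, smul_mulVec]

lemma gammaTrace_low (v : Spinor n) :
    gammaTrace γ (fun μ => γ.low μ *ᵥ v) = ((n : ℝ) + 1) • v := by
  simp only [gammaTrace, low_mulVec, mulVec_smul_real, γ.sq_apply, smul_smul, eta_mul_eta, one_smul]
  ext; simp

lemma gammaTrace_gam (ν : Fin (n + 1)) (v : Fin (n + 1) → Spinor n) :
    gammaTrace γ (fun μ => γ.gam ν *ᵥ v μ) = (2 * eta ν) • v ν - γ.gam ν *ᵥ gammaTrace γ v := by
  simp only [gammaTrace]
  rw [Finset.sum_congr rfl fun μ _ => γ.clifford_apply μ ν (v μ), Finset.sum_sub_distrib,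
    mulVec_sum]
  congr 1
  rw [Finset.sum_eq_single ν]
  · simp
  · intro b _ hb; simp [hb]
  · simp

lemma gammaTrace_symbolP (ν : Fin (n + 1)) (v : Fin (n + 1) → Spinor n) :
    gammaTrace γ (symbolP γ ν v) =
      -(((n : ℝ) - 1) • eta ν • v ν) - γ.gam ν *ᵥ gammaTrace γ v := by
  have h1 : symbolP γ ν v =
      (fun μ => γ.gam ν *ᵥ v μ) + (-1 : ℝ) • fun μ => γ.low μ *ᵥ (eta ν • v ν) := by
    funext μ; simp [symbolP, sub_eq_add_neg]
  rw [h1, gammaTrace_add, gammaTrace_smul, gammaTrace_low, gammaTrace_gam]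
  module

/-- The current `⟨Γ^ν v, w⟩_V`, in which the two terms with a divergence cancel. -/
lemma formV_symbolP (hn : 2 ≤ n) (ν : Fin (n + 1)) (v w : Fin (n + 1) → Spinor n) :
    formV γ (symbolP γ ν v) w = ∑ μ, eta μ * formW γ (γ.gam ν *ᵥ v μ) (w μ) -
      (((n + 1 : ℕ) : ℝ) - 2)⁻¹ * formW γ (γ.gam ν *ᵥ gammaTrace γ v) (gammaTrace γ w) := by
  have hn1 : (((n + 1 : ℕ) : ℝ) - 2) = (n : ℝ) - 1 := by push_cast; ring
  have hn2 : (n : ℝ) - 1 ≠ 0 := by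
    have : (2 : ℝ) ≤ n := by exact_mod_cast hn
    intro h; linarith
  have h1 : ∀ μ, eta μ * formW γ (symbolP γ ν v μ) (w μ) =
      eta μ * formW γ (γ.gam ν *ᵥ v μ) (w μ) + eta ν * formW γ (v ν) (γ.gam μ *ᵥ w μ) := by
    intro μ
    have : symbolP γ ν v μ = γ.gam ν *ᵥ v μ + (-(eta μ * eta ν)) • γ.gam μ *ᵥ v ν := by
      rw [symbolP, low_mulVec, mulVec_smul_real]; module
    rw [this, formW_add_left, formW_smul_left, formW_gam γ μ]
    linear_combination (eta ν * formW γ (v ν) (γ.gam μ *ᵥ w μ)) * eta_mul_eta μ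
  have h2 : ∀ s : Finset (Fin (n + 1)), ∑ μ ∈ s, formW γ (v ν) (γ.gam μ *ᵥ w μ) =
      formW γ (v ν) (∑ μ ∈ s, γ.gam μ *ᵥ w μ) := by
    intro s
    induction s using Finset.induction_on with
    | empty => simp [formW]
    | insert a s ha ih => rw [Finset.sum_insert ha, Finset.sum_insert ha, formW_add_right, ih]
  have h3 : gammaTrace γ (symbolP γ ν v) =
      (-(((n : ℝ) - 1) * eta ν)) • v ν + (-1 : ℝ) • γ.gam ν *ᵥ gammaTrace γ v := by
    rw [gammaTrace_symbolP]; module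
  rw [formV, Finset.sum_congr rfl fun μ _ => h1 μ, Finset.sum_add_distrib, ← Finset.mul_sum, h2, h3,
    formW_add_left, formW_smul_left, formW_smul_left, hn1]
  change _ + eta ν * formW γ (v ν) (gammaTrace γ w) + _ = _
  field_simp
  ring

lemma formV_symbolP_symm (hn : 2 ≤ n) (ν : Fin (n + 1)) (v w : Fin (n + 1) → Spinor n) :
    formV γ (symbolP γ ν v) w = formV γ (symbolP γ ν w) v := by
  have h : ∀ a b : Spinor n, formW γ (γ.gam ν *ᵥ a) b = formW γ (γ.gam ν *ᵥ b) a := by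
    intro a b
    rw [formW_gam, formW_swap γ (γ.gam ν *ᵥ b)]
  rw [formV_symbolP γ hn, formV_symbolP γ hn, h]
  simp only [h (v _)]

/-- The symbol of `P` is skew for the form on `V`; after an integration by parts, `P` is therefore
formally self-adjoint. -/
lemma formV_symbolP_right (hn : 2 ≤ n) (ν : Fin (n + 1)) (v w : Fin (n + 1) → Spinor n) :
    formV γ v (symbolP γ ν w) = -formV γ (symbolP γ ν v) w := by
  rw [formV_swap, formV_symbolP_symm γ hn]

/-! #### Majorana spinors -/

lemma mem_majorana {v : Spinor n} : v ∈ γ.majorana ↔ γ.chargeConj v = v := Iff.rfl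

lemma GammaRep.map_star_C_mul_C : γ.C.map star * γ.C = -1 := by
  have h : γ.C.map star = -γ.Cᴴ := by
    rw [conjTranspose, γ.C_transpose]; ext; simp
  rw [h, neg_mul, γ.C_unitary]

lemma GammaRep.C_mul_map_star_C : γ.C * γ.C.map star = -1 := by
  have h : (-(γ.C.map star)) * γ.C = 1 := by rw [neg_mul, γ.map_star_C_mul_C, neg_neg]
  have := mul_eq_one_comm.mp h
  rw [mul_neg] at this
  rw [← this, neg_neg]

lemma star_mulVec_map (A : SpinMatrix n) (v : Spinor n) :
    star (A *ᵥ v) = A.map star *ᵥ star v := by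
  ext s; simp [mulVec, dotProduct]

lemma GammaRep.map_star_C_mul (a : Fin (n + 1)) :
    γ.C.map star * (γ.gam a).map star = (-eta a) • (γ.gam a * γ.C.map star) := by
  have h1 : (γ.gam a).map star = eta a • (γ.gam a)ᵀ := by
    have : (γ.gam a)ᴴ = eta a • γ.gam a := by
      refine Fin.cases ?_ (fun i => ?_) a
      · rw [γ.timelike, eta_zero]; simp
      · rw [γ.spacelike, eta_succ]; simp
    rw [← transpose_smul, ← this]; ext; simp
  have h2 : γ.C.map star * (γ.gam a)ᵀ = -(γ.gam a * γ.C.map star) := by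
    calc γ.C.map star * (γ.gam a)ᵀ = -(γ.C.map star * (γ.gam a)ᵀ * (γ.C * γ.C.map star)) := by
          rw [γ.C_mul_map_star_C]; simp
      _ = -(γ.C.map star * ((γ.gam a)ᵀ * γ.C) * γ.C.map star) := by simp only [Matrix.mul_assoc]
      _ = (γ.C.map star * γ.C) * (γ.gam a * γ.C.map star) := by
          rw [γ.C_gam]; simp [Matrix.mul_assoc]
      _ = _ := by rw [γ.map_star_C_mul_C]; simp
  rw [h1, Matrix.mul_smul, h2]; simp

/-- Charge conjugation commutes with all gamma matrices. -/
lemma GammaRep.chargeConj_gam (a : Fin (n + 1)) (v : Spinor n) :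
    γ.chargeConj (γ.gam a *ᵥ v) = γ.gam a *ᵥ γ.chargeConj v := by
  unfold GammaRep.chargeConj GammaRep.beta
  rw [star_mulVec_map, mulVec_mulVec _ (γ.C.map star), γ.map_star_C_mul, smul_mulVec, smul_mulVec,
    ← mulVec_mulVec (star v)]
  generalize γ.C.map star *ᵥ star v = w
  rw [mulVec_neg, smul_mulVec, mulVec_smul, mulVec_smul]
  refine Fin.cases ?_ (fun i => ?_) a
  · simp [eta_zero]
  · rw [γ.anticomm_apply (Fin.succ_ne_zero i), eta_succ]; simp

lemma GammaRep.chargeConj_add (v w : Spinor n) :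
    γ.chargeConj (v + w) = γ.chargeConj v + γ.chargeConj w := by
  simp only [GammaRep.chargeConj, star_add, mulVec_add, neg_add]

lemma GammaRep.chargeConj_smul (c : ℝ) (v : Spinor n) :
    γ.chargeConj (c • v) = c • γ.chargeConj v := by
  simp only [GammaRep.chargeConj, star_smul, star_trivial, mulVec_smul, smul_neg]

lemma GammaRep.chargeConj_I_smul (v : Spinor n) :
    γ.chargeConj (Complex.I • v) = -(Complex.I • γ.chargeConj v) := by
  have h : star (Complex.I • v) = -(Complex.I • star v) := by
    rw [star_smul, Complex.star_def, Complex.conj_I, neg_smul]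
  simp only [GammaRep.chargeConj, h, mulVec_smul, mulVec_neg, smul_neg]

lemma GammaRep.chargeConj_chargeConj (v : Spinor n) : γ.chargeConj (γ.chargeConj v) = v := by
  have h0 : γ.chargeConj v = -(Complex.I • γ.gam 0 *ᵥ (γ.C.map star *ᵥ star v)) := by
    rw [GammaRep.chargeConj, GammaRep.beta, smul_mulVec]
  have h1 : γ.chargeConj (γ.C.map star *ᵥ star v) = Complex.I • γ.gam 0 *ᵥ v := by
    rw [GammaRep.chargeConj, GammaRep.beta, star_mulVec_map, star_star, Matrix.map_map]
    have : γ.C.map (star ∘ star) = γ.C := by ext; simp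
    rw [this, mulVec_mulVec _ (γ.C.map star), γ.map_star_C_mul_C, neg_mulVec, one_mulVec, mulVec_neg, neg_neg,
      smul_mulVec]
  rw [h0, ← neg_one_smul ℝ, γ.chargeConj_smul, γ.chargeConj_I_smul, γ.chargeConj_gam, h1,
    mulVec_smul, smul_smul, Complex.I_mul_I, γ.sq_apply, eta_zero]
  simp

/-- Charge conjugation as a real linear map. -/
noncomputable def GammaRep.chargeConjLin : Spinor n →ₗ[ℝ] Spinor n where
  toFun := γ.chargeConj
  map_add' := γ.chargeConj_add
  map_smul' := γ.chargeConj_smul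

lemma GammaRep.gam_mem_majorana (a : Fin (n + 1)) {v : Spinor n} (hv : v ∈ γ.majorana) :
    γ.gam a *ᵥ v ∈ γ.majorana := by
  rw [mem_majorana] at *
  rw [γ.chargeConj_gam, hv]

lemma GammaRep.low_mem_majorana (a : Fin (n + 1)) {v : Spinor n} (hv : v ∈ γ.majorana) :
    γ.low a *ᵥ v ∈ γ.majorana := by
  rw [low_mulVec]
  exact Submodule.smul_mem _ _ (γ.gam_mem_majorana a hv)

lemma gammaTrace_mem_majorana {v : Fin (n + 1) → Spinor n} (hv : ∀ μ, v μ ∈ γ.majorana) :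
    gammaTrace γ v ∈ γ.majorana :=
  Submodule.sum_mem _ fun μ _ => γ.gam_mem_majorana μ (hv μ)

/-- Majorana spinors span the complex spinor space, so there are non-zero ones. -/
lemma GammaRep.exists_majorana_ne_zero : ∃ v ∈ γ.majorana, v ≠ 0 := by
  have h : ∀ v : Spinor n, v + γ.chargeConj v ∈ γ.majorana := fun v => by
    rw [mem_majorana, γ.chargeConj_add, γ.chargeConj_chargeConj, add_comm]
  by_contra! hall
  have h0 : ∀ v : Spinor n, γ.chargeConj v = -v := fun v =>
    eq_neg_of_add_eq_zero_right (hall _ (h v))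
  have h1 := γ.chargeConj_I_smul 1
  rw [h0, h0, smul_neg, neg_neg, neg_eq_iff_add_eq_zero, ← two_smul ℂ, smul_smul] at h1
  have := congrFun h1 ⟨0, by positivity⟩
  simp at this

/-- On Majorana spinors the form is given by `v† γ^0 w`. -/
lemma formW_eq_ip {v : Spinor n} (hv : v ∈ γ.majorana) (w : Spinor n) :
    formW γ v w = ip v (γ.gam 0 *ᵥ w) := by
  have hb : (γ.beta * γ.C.map star)ᵀ * γ.C = -γ.beta := by
    have hC : (γ.C.map star)ᵀ = γ.Cᴴ := rfl
    rw [transpose_mul, hC, GammaRep.beta, transpose_smul, Matrix.mul_assoc, smul_mul, γ.C_gam,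
      Matrix.mul_smul, Matrix.mul_neg, ← Matrix.mul_assoc, γ.C_unitary, Matrix.one_mul, smul_neg]
  have h : v ⬝ᵥ γ.C *ᵥ w = star v ⬝ᵥ γ.beta *ᵥ w := by
    calc v ⬝ᵥ γ.C *ᵥ w = γ.chargeConj v ⬝ᵥ γ.C *ᵥ w := by rw [(mem_majorana γ).1 hv]
      _ = -(star v ⬝ᵥ ((γ.beta * γ.C.map star)ᵀ * γ.C) *ᵥ w) := by
        rw [GammaRep.chargeConj, neg_dotProduct, mulVec_mulVec, ← vecMul_transpose,
          ← dotProduct_mulVec, mulVec_mulVec]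
      _ = _ := by rw [hb, neg_mulVec, dotProduct_neg, neg_neg]
  rw [formW, h, GammaRep.beta, smul_mulVec, dotProduct_smul, ip, smul_eq_mul, ← mul_assoc]
  simp

/-- The charge density `v_μ† w^μ - (D - 2)⁻¹ (γ^μ v_μ)† (γ^ν w_ν)`. -/
noncomputable def density (v w : Fin (n + 1) → Spinor n) : ℝ :=
  ∑ μ, eta μ * ip (v μ) (w μ) -
    (((n + 1 : ℕ) : ℝ) - 2)⁻¹ * ip (gammaTrace γ v) (gammaTrace γ w)

lemma density_comm (v w : Fin (n + 1) → Spinor n) : density γ v w = density γ w v := by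
  simp only [density, ip_comm (v _) (w _), ip_comm (gammaTrace γ v)]

/-- The time component of the current is the charge density. -/
lemma formV_symbolP_zero (hn : 2 ≤ n) {v : Fin (n + 1) → Spinor n} (hv : ∀ μ, v μ ∈ γ.majorana)
    (w : Fin (n + 1) → Spinor n) : formV γ (symbolP γ 0 v) w = density γ v w := by
  have h : ∀ {a : Spinor n} (_ : a ∈ γ.majorana) (b : Spinor n),
      formW γ (γ.gam 0 *ᵥ a) b = ip a b := by
    intro a ha b
    rw [formW_eq_ip γ (γ.gam_mem_majorana 0 ha), γ.ip_gam_zero_gam_zero]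
  rw [formV_symbolP γ hn, density, h (gammaTrace_mem_majorana γ hv)]
  simp only [h (hv _)]

/-- Reversing the sign of `γ^0` gives the gamma matrices of the time-reversed spacetime. -/
def GammaRep.reverse : GammaRep n where
  gam := fun a => if a = 0 then -γ.gam a else γ.gam a
  C := γ.C
  clifford a b := by
    by_cases ha : a = 0 <;> by_cases hb : b = 0
    · subst ha; subst hb
      simpa using γ.clifford 0 0
    · have h := γ.clifford a b
      have hab : a ≠ b := fun h => hb (h ▸ ha)
      simp only [if_neg hab, if_pos ha, if_neg hb] at h ⊢
      rw [Matrix.neg_mul, Matrix.mul_neg, ← neg_add, h, neg_zero]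
    · have h := γ.clifford a b
      have hab : a ≠ b := fun h => ha (h ▸ hb)
      simp only [if_neg hab, if_pos hb, if_neg ha] at h ⊢
      rw [Matrix.neg_mul, Matrix.mul_neg, ← neg_add, h, neg_zero]
    · simpa only [if_neg ha, if_neg hb] using γ.clifford a b
  timelike := by simp [γ.timelike]
  spacelike i := by simpa [Fin.succ_ne_zero] using γ.spacelike i
  C_transpose := γ.C_transpose
  C_unitary := γ.C_unitary
  C_gam a := by
    split_ifs
    · rw [transpose_neg, Matrix.neg_mul, γ.C_gam, Matrix.mul_neg]
    · exact γ.C_gam a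

end GammaAlgebra

/-! ### Partial derivatives and the Dirac operator on the universal cover -/

section Calculus

variable {n : ℕ} (γ : GammaRep n)

open Matrix

section pd

variable {F G : Type*} [NormedAddCommGroup F] [NormedSpace ℝ F] [NormedAddCommGroup G]
  [NormedSpace ℝ G] {m : ℕ}

lemma contDiff_pd {f : (Fin m → ℝ) → F} (hf : ContDiff ℝ ∞ f) (ν : Fin m) :
    ContDiff ℝ ∞ (pd ν f) :=
  (hf.fderiv_right (m := ∞) (by simp)).clm_apply contDiff_const

lemma pd_comm {f : (Fin m → ℝ) → F} (hf : ContDiff ℝ ∞ f) (μ ν : Fin m) (x : Fin m → ℝ) :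
    pd μ (pd ν f) x = pd ν (pd μ f) x := by
  have hd : DifferentiableAt ℝ (fderiv ℝ f) x :=
    (hf.fderiv_right (m := ∞) (by simp)).differentiable (by simp) x
  have h : ∀ a b : Fin m, pd a (pd b f) x = fderiv ℝ (fderiv ℝ f) x (Pi.single a 1)
      (Pi.single b 1) := by
    intro a b
    unfold pd
    rw [fderiv_clm_apply hd (differentiableAt_const _)]
    simp
  rw [h, h]
  exact (hf.contDiffAt.isSymmSndFDerivAt (by simpa using WithTop.coe_le_coe.2 (le_top : (2 : ℕ∞) ≤ ⊤))) _ _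

lemma pd_clm (L : F →L[ℝ] G) {f : (Fin m → ℝ) → F} {x : Fin m → ℝ} (hf : DifferentiableAt ℝ f x)
    (ν : Fin m) : pd ν (fun y => L (f y)) x = L (pd ν f x) := by
  unfold pd
  rw [show (fun y => L (f y)) = L ∘ f from rfl, fderiv_comp _ L.differentiableAt hf]
  simp

lemma pd_bilin (B : F →ₗ[ℝ] G →ₗ[ℝ] ℝ) [FiniteDimensional ℝ F] [FiniteDimensional ℝ G]
    {f : (Fin m → ℝ) → F} {g : (Fin m → ℝ) → G} {x : Fin m → ℝ} (hf : DifferentiableAt ℝ f x)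
    (hg : DifferentiableAt ℝ g x) (ν : Fin m) :
    pd ν (fun y => B (f y) (g y)) x = B (pd ν f x) (g x) + B (f x) (pd ν g x) := by
  have h := (LinearMap.toContinuousBilinearMap B).hasFDerivAt_of_bilinear hf.hasFDerivAt
    hg.hasFDerivAt
  unfold pd
  rw [show (fun y => B (f y) (g y)) =
    fun y => (LinearMap.toContinuousBilinearMap B) (f y) (g y) from rfl, h.fderiv]
  simp [add_comm]

lemma contDiff_bilin (B : F →ₗ[ℝ] G →ₗ[ℝ] ℝ) [FiniteDimensional ℝ F] [FiniteDimensional ℝ G]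
    {H : Type*} [NormedAddCommGroup H] [NormedSpace ℝ H] {k : WithTop ℕ∞}
    {f : H → F} {g : H → G} (hf : ContDiff ℝ k f) (hg : ContDiff ℝ k g) :
    ContDiff ℝ k fun y => B (f y) (g y) :=
  (LinearMap.toContinuousBilinearMap B).isBoundedBilinearMap.contDiff.comp (hf.prodMk hg)

lemma pd_smul_fun {c : (Fin m → ℝ) → ℝ} {f : (Fin m → ℝ) → F} {x : Fin m → ℝ}
    (hc : DifferentiableAt ℝ c x) (hf : DifferentiableAt ℝ f x) (ν : Fin m) :
    pd ν (fun y => c y • f y) x = c x • pd ν f x + pd ν c x • f x := by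
  unfold pd
  rw [fderiv_fun_smul hc hf]
  simp

lemma pd_fun_add {f g : (Fin m → ℝ) → F} {x : Fin m → ℝ} (hf : DifferentiableAt ℝ f x)
    (hg : DifferentiableAt ℝ g x) (ν : Fin m) :
    pd ν (fun y => f y + g y) x = pd ν f x + pd ν g x := by
  unfold pd
  rw [fderiv_fun_add hf hg]; rfl

lemma pd_fun_sub {f g : (Fin m → ℝ) → F} {x : Fin m → ℝ} (hf : DifferentiableAt ℝ f x)
    (hg : DifferentiableAt ℝ g x) (ν : Fin m) :
    pd ν (fun y => f y - g y) x = pd ν f x - pd ν g x := by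
  unfold pd
  rw [fderiv_fun_sub hf hg]; rfl

lemma pd_fun_sum {ι : Type*} {s : Finset ι} {f : ι → (Fin m → ℝ) → F} {x : Fin m → ℝ}
    (hf : ∀ i ∈ s, DifferentiableAt ℝ (f i) x) (ν : Fin m) :
    pd ν (fun y => ∑ i ∈ s, f i y) x = ∑ i ∈ s, pd ν (f i) x := by
  unfold pd
  rw [fderiv_fun_sum hf]
  simp

lemma pd_const (c : F) (ν : Fin m) (x : Fin m → ℝ) : pd ν (fun _ => c) x = 0 := by
  simp [pd]

lemma pd_apply {ι : Type*} [Fintype ι] {f : (Fin m → ℝ) → ι → F} {x : Fin m → ℝ}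
    (hf : DifferentiableAt ℝ f x) (ν : Fin m) (i : ι) :
    pd ν f x i = pd ν (fun y => f y i) x :=
  (pd_clm (ContinuousLinearMap.proj (R := ℝ) (φ := fun _ : ι => F) i) hf ν).symm

lemma pd_eq_of_eventuallyEq {f g : (Fin m → ℝ) → F} {x : Fin m → ℝ} (h : f =ᶠ[nhds x] g)
    (ν : Fin m) : pd ν f x = pd ν g x := by
  unfold pd
  rw [h.fderiv_eq]

lemma pd_comp_add (f : (Fin m → ℝ) → F) (a x : Fin m → ℝ) (ν : Fin m) :
    pd ν (fun y => f (y + a)) x = pd ν f (x + a) := by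
  unfold pd
  rw [fderiv_comp_add_right]

/-- A derivative along the standard basis determines the whole derivative. -/
lemma fderiv_apply_eq_sum_pd (f : (Fin m → ℝ) → F) (x v : Fin m → ℝ) :
    fderiv ℝ f x v = ∑ ν, v ν • pd ν f x := by
  conv_lhs => rw [pi_eq_sum_univ' v]
  simp [pd, map_sum]

end pd

/-- Multiplication by a complex matrix, as a continuous real linear map. -/
noncomputable def mulVecCLM (A : SpinMatrix n) : Spinor n →L[ℝ] Spinor n :=
  LinearMap.toContinuousLinearMap (A.mulVecLin.restrictScalars ℝ)

lemma pd_mulVec {m : ℕ} (A : SpinMatrix n) {f : (Fin m → ℝ) → Spinor n} {x : Fin m → ℝ}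
    (hf : DifferentiableAt ℝ f x) (ν : Fin m) :
    pd ν (fun y => A *ᵥ f y) x = A *ᵥ pd ν f x :=
  pd_clm (mulVecCLM A) hf ν

lemma contDiff_mulVec {E : Type*} [NormedAddCommGroup E] [NormedSpace ℝ E] {k : WithTop ℕ∞}
    (A : SpinMatrix n) {f : E → Spinor n} (hf : ContDiff ℝ k f) :
    ContDiff ℝ k (fun y => A *ᵥ f y) :=
  (mulVecCLM A).contDiff.comp hf

/-- Charge conjugation as a continuous real linear map. -/
noncomputable def GammaRep.chargeConjCLM : Spinor n →L[ℝ] Spinor n :=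
  LinearMap.toContinuousLinearMap γ.chargeConjLin

lemma GammaRep.chargeConjCLM_apply (v : Spinor n) : γ.chargeConjCLM v = γ.chargeConj v := rfl

lemma pd_mem_majorana {m : ℕ} {f : (Fin m → ℝ) → Spinor n} {x : Fin m → ℝ}
    (hf : DifferentiableAt ℝ f x) (h : ∀ y, f y ∈ γ.majorana) (ν : Fin m) :
    pd ν f x ∈ γ.majorana := by
  have h1 := pd_clm γ.chargeConjCLM hf ν
  have h2 : (fun y => γ.chargeConjCLM (f y)) = f := funext fun y => (mem_majorana γ).1 (h y)
  rw [h2] at h1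
  exact h1.symm

/-- The Dirac operator `γ^ν ∂_ν` on spinor fields on the universal cover. -/
noncomputable def slash (u : Mink n → Spinor n) : Mink n → Spinor n :=
  fun x => ∑ ν, γ.gam ν *ᵥ pd ν u x

/-- The d'Alembert operator `η^{μν} ∂_μ ∂_ν`. -/
noncomputable def box {F : Type*} [NormedAddCommGroup F] [NormedSpace ℝ F] (f : Mink n → F) :
    Mink n → F :=
  fun x => ∑ ν, eta ν • pd ν (pd ν f) x

lemma contDiff_slash {u : Mink n → Spinor n} (hu : ContDiff ℝ ∞ u) : ContDiff ℝ ∞ (slash γ u) :=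
  ContDiff.sum fun ν _ => contDiff_mulVec _ (contDiff_pd hu ν)

lemma slash_sub {u v : Mink n → Spinor n} (hu : ContDiff ℝ ∞ u) (hv : ContDiff ℝ ∞ v)
    (x : Mink n) : slash γ (fun y => u y - v y) x = slash γ u x - slash γ v x := by
  simp only [slash, pd_fun_sub (hu.differentiable (by simp) x) (hv.differentiable (by simp) x),
    mulVec_sub, Finset.sum_sub_distrib]

lemma slash_smul (c : ℝ) {u : Mink n → Spinor n} (hu : ContDiff ℝ ∞ u)
    (x : Mink n) : slash γ (fun y => c • u y) x = c • slash γ u x := by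
  have : ∀ ν, pd ν (fun y => c • u y) x = c • pd ν u x := fun ν =>
    pd_clm (c • ContinuousLinearMap.id ℝ (Spinor n)) (hu.differentiable (by simp) x) ν
  simp only [slash, this, mulVec_smul, Finset.smul_sum]

lemma pd_slash {u : Mink n → Spinor n} (hu : ContDiff ℝ ∞ u) (μ : Fin (n + 1)) (x : Mink n) :
    pd μ (slash γ u) x = slash γ (pd μ u) x := by
  unfold slash
  rw [pd_fun_sum fun ν _ => (contDiff_mulVec _ (contDiff_pd hu ν)).differentiable (by simp) x]
  refine Finset.sum_congr rfl fun ν _ => ?_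
  rw [pd_mulVec _ ((contDiff_pd hu ν).differentiable (by simp) x), pd_comm hu]

/-- The square of the Dirac operator is the d'Alembert operator. -/
lemma slash_slash {u : Mink n → Spinor n} (hu : ContDiff ℝ ∞ u) (x : Mink n) :
    slash γ (slash γ u) x = box u x := by
  have h0 : slash γ (slash γ u) x = ∑ ν, ∑ μ, γ.gam ν *ᵥ (γ.gam μ *ᵥ pd ν (pd μ u) x) := by
    conv_lhs => unfold slash
    refine Finset.sum_congr rfl fun ν _ => ?_
    rw [← mulVec_sum]
    congr 1
    rw [show (fun x => ∑ ν, γ.gam ν *ᵥ pd ν u x) = slash γ u from rfl, pd_slash γ hu, slash]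
    exact Finset.sum_congr rfl fun μ _ => by rw [pd_comm hu]
  have h1 : slash γ (slash γ u) x = ∑ ν, ∑ μ, γ.gam μ *ᵥ (γ.gam ν *ᵥ pd ν (pd μ u) x) := by
    rw [h0, Finset.sum_comm]
    exact Finset.sum_congr rfl fun ν _ => Finset.sum_congr rfl fun μ _ => by rw [pd_comm hu]
  have h2 : (2 : ℝ) • slash γ (slash γ u) x = (2 : ℝ) • box u x := by
    conv_lhs => rw [two_smul]
    nth_rewrite 1 [h0]
    rw [h1, ← Finset.sum_add_distrib, box, Finset.smul_sum]
    refine Finset.sum_congr rfl fun ν _ => ?_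
    rw [← Finset.sum_add_distrib]
    simp_rw [γ.clifford_apply ν, sub_add_cancel]
    rw [Finset.sum_ite_eq]
    simp [mul_smul]
  exact smul_right_injective _ (two_ne_zero (α := ℝ)) h2

section Field

variable {γ}

lemma contDiff_comp_field {ψ : Field n} (hψ : ContDiff ℝ ∞ ψ) (μ : Fin (n + 1)) :
    ContDiff ℝ ∞ fun x => ψ x μ := contDiff_pi.1 hψ μ

lemma pd_field {ψ : Field n} (hψ : ContDiff ℝ ∞ ψ) (ν μ : Fin (n + 1)) (x : Mink n) :
    pd ν ψ x μ = pd ν (fun y => ψ y μ) x := pd_apply (hψ.differentiable (by simp) x) ν μ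

lemma dirac_apply {ψ : Field n} (hψ : ContDiff ℝ ∞ ψ) (x : Mink n) (μ : Fin (n + 1)) :
    dirac γ ψ x μ = slash γ (fun y => ψ y μ) x := by
  simp only [dirac, slash, pd_field hψ]

lemma contDiff_dirac {ψ : Field n} (hψ : ContDiff ℝ ∞ ψ) : ContDiff ℝ ∞ (dirac γ ψ) := by
  refine contDiff_pi.2 fun μ => ?_
  simp only [dirac_apply hψ]
  exact contDiff_slash γ (contDiff_comp_field hψ μ)

lemma dirac_dirac {ψ : Field n} (hψ : ContDiff ℝ ∞ ψ) (x : Mink n) :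
    dirac γ (dirac γ ψ) x = box ψ x := by
  funext μ
  rw [dirac_apply (contDiff_dirac hψ)]
  simp only [dirac_apply hψ]
  rw [slash_slash γ (contDiff_comp_field hψ μ)]
  simp only [box, Finset.sum_apply, Pi.smul_apply]
  refine Finset.sum_congr rfl fun ν _ => ?_
  rw [pd_field (contDiff_pd hψ ν)]
  simp only [pd_field hψ]

lemma opPtilde_eq_dirac (ψ : Field n) : opPtilde γ ψ = dirac γ ψ := by
  funext x μ
  simp [opPtilde, opP, opT, opKdag, mulVec_neg]

lemma divergence_eq {ψ : Field n} (hψ : ContDiff ℝ ∞ ψ) (x : Mink n) :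
    divergence ψ x = ∑ ν, eta ν • pd ν (fun y => ψ y ν) x := by
  simp only [divergence, pd_field hψ]

lemma contDiff_divergence {ψ : Field n} (hψ : ContDiff ℝ ∞ ψ) : ContDiff ℝ ∞ (divergence ψ) := by
  rw [show divergence ψ = fun x => ∑ ν, eta ν • pd ν (fun y => ψ y ν) x from
    funext (divergence_eq hψ)]
  exact ContDiff.sum fun ν _ => (contDiff_pd (contDiff_comp_field hψ ν) ν).const_smul _

lemma slash_divergence {ψ : Field n} (hψ : ContDiff ℝ ∞ ψ) (x : Mink n) :
    slash γ (divergence ψ) x = divergence (dirac γ ψ) x := by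
  have h0 : ∀ ν, ContDiff ℝ ∞ (pd ν fun y => ψ y ν) :=
    fun ν => contDiff_pd (contDiff_comp_field hψ ν) ν
  rw [divergence_eq (contDiff_dirac hψ), show divergence ψ = _ from funext (divergence_eq hψ)]
  simp only [dirac_apply hψ]
  have h1 : ∀ μ, pd μ (fun y => ∑ ν, eta ν • pd ν (fun z => ψ z ν) y) x =
      ∑ ν, eta ν • pd μ (pd ν fun z => ψ z ν) x := by
    intro μ
    rw [pd_fun_sum fun ν _ => ((h0 ν).const_smul _).differentiable (by simp) x]
    exact Finset.sum_congr rfl fun ν _ =>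
      pd_clm (eta ν • ContinuousLinearMap.id ℝ (Spinor n)) ((h0 ν).differentiable (by simp) x) μ
  conv_lhs => unfold slash
  simp only [h1, mulVec_sum, mulVec_smul_real]
  rw [Finset.sum_comm]
  refine Finset.sum_congr rfl fun ν _ => ?_
  rw [← Finset.smul_sum]
  congr 1
  exact (pd_slash γ (contDiff_comp_field hψ ν) ν x).symm

lemma opP_eq_sum (ψ : Field n) (x : Mink n) :
    opP γ ψ x = ∑ ν, symbolP γ ν (pd ν ψ x) := by
  funext μ
  simp only [opP, symbolP, dirac, divergence, Finset.sum_apply, Finset.sum_sub_distrib, mulVec_sum]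

lemma opP_eq_dirac {ψ : Field n} (h : divergence ψ = 0) : opP γ ψ = dirac γ ψ := by
  funext x μ
  simp [opP, h]

lemma contDiff_opP {ψ : Field n} (hψ : ContDiff ℝ ∞ ψ) : ContDiff ℝ ∞ (opP γ ψ) :=
  contDiff_pi.2 fun μ => (contDiff_comp_field (contDiff_dirac hψ) μ).sub
    (contDiff_mulVec _ (contDiff_divergence hψ))

/-- `K^† P = 0`. -/
lemma divergence_opP {ψ : Field n} (hψ : ContDiff ℝ ∞ ψ) (x : Mink n) :
    divergence (opP γ ψ) x = 0 := by
  have hD := contDiff_divergence hψ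
  rw [divergence_eq (contDiff_opP hψ)]
  have h : ∀ ν, pd ν (fun y => opP γ ψ y ν) x =
      pd ν (fun y => dirac γ ψ y ν) x - γ.low ν *ᵥ pd ν (divergence ψ) x := by
    intro ν
    rw [← pd_mulVec _ (hD.differentiable (by simp) x)]
    exact pd_fun_sub ((contDiff_comp_field (contDiff_dirac hψ) ν).differentiable (by simp) x)
      ((contDiff_mulVec _ hD).differentiable (by simp) x) ν
  simp only [h, smul_sub, Finset.sum_sub_distrib]
  rw [← divergence_eq (contDiff_dirac hψ), ← slash_divergence hψ, slash, sub_eq_zero]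
  refine Finset.sum_congr rfl fun ν _ => ?_
  rw [low_mulVec, smul_smul, eta_mul_eta, one_smul]

end Field

/-! #### Time reflection -/

/-- The reflection `t ↦ -t` of Minkowski space. -/
noncomputable def timeRev (n : ℕ) : Mink n →L[ℝ] Mink n :=
  ContinuousLinearMap.pi fun μ => eta μ • ContinuousLinearMap.proj μ

lemma timeRev_apply (x : Mink n) (μ : Fin (n + 1)) : timeRev n x μ = eta μ * x μ := rfl

lemma timeRev_timeRev (x : Mink n) : timeRev n (timeRev n x) = x := by
  funext μ
  rw [timeRev_apply, timeRev_apply, ← mul_assoc, eta_mul_eta, one_mul]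

lemma timeRev_zero_coord (x : Mink n) : timeRev n x 0 = -x 0 := by simp [timeRev_apply, eta_zero]

lemma timeRev_succ_coord (x : Mink n) (i : Fin n) : timeRev n x i.succ = x i.succ := by
  simp [timeRev_apply, eta_succ]

lemma pd_comp_timeRev {F : Type*} [NormedAddCommGroup F] [NormedSpace ℝ F] {f : Mink n → F}
    {x : Mink n} (hf : DifferentiableAt ℝ f (timeRev n x)) (ν : Fin (n + 1)) :
    pd ν (fun y => f (timeRev n y)) x = eta ν • pd ν f (timeRev n x) := by
  unfold pd
  rw [show (fun y => f (timeRev n y)) = f ∘ timeRev n from rfl,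
    fderiv_comp _ hf (timeRev n).differentiableAt, ContinuousLinearMap.fderiv,
    ContinuousLinearMap.comp_apply, ← map_smul]
  congr 1
  funext μ
  by_cases h : μ = ν
  · subst h; simp [timeRev_apply]
  · simp [timeRev_apply, h]

lemma GammaRep.reverse_gam (a : Fin (n + 1)) : γ.reverse.gam a = eta a • γ.gam a := by
  by_cases h : a = 0
  · simp [GammaRep.reverse, h, eta]
  · simp [GammaRep.reverse, h, eta]

lemma dirac_reverse {ψ : Field n} (hψ : ContDiff ℝ ∞ ψ) (x : Mink n) :
    dirac γ.reverse (fun y => ψ (timeRev n y)) x = dirac γ ψ (timeRev n x) := by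
  funext μ
  simp only [dirac, pd_comp_timeRev (hψ.differentiable (by simp) _), γ.reverse_gam]
  refine Finset.sum_congr rfl fun ν _ => ?_
  rw [Pi.smul_apply, mulVec_smul_real, smul_mulVec, smul_smul, eta_mul_eta, one_smul]

lemma slash_reverse {u : Mink n → Spinor n} (hu : ContDiff ℝ ∞ u) (x : Mink n) :
    slash γ.reverse (fun y => u (timeRev n y)) x = slash γ u (timeRev n x) := by
  simp only [slash, pd_comp_timeRev (hu.differentiable (by simp) _), γ.reverse_gam]
  refine Finset.sum_congr rfl fun ν _ => ?_
  rw [mulVec_smul_real, smul_mulVec, smul_smul, eta_mul_eta, one_smul]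

end Calculus

/-! ### Energy estimate on truncated light cones -/

section Energy

variable {n : ℕ} (γ : GammaRep n)

open Matrix MeasureTheory

/-- The divergence theorem on a box in spacetime, for a field whose fluxes through opposite
spatial faces agree. -/
lemma integral_div_box {E : Type*} [NormedAddCommGroup E] [NormedSpace ℝ E] [CompleteSpace E]
    (f : Fin (n + 1) → Mink n → E) (hf : ∀ ν, ContDiff ℝ ∞ (f ν)) {a b : ℝ} (hab : a ≤ b)
    {lo hi : Fin n → ℝ} (hlohi : lo ≤ hi)
    (hface : ∀ (i : Fin n) (x x' : Mink n), a ≤ x 0 → x i.succ = hi i → x' i.succ = lo i →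
      (∀ j ≠ i.succ, x j = x' j) → f i.succ x = f i.succ x') :
    ∫ x in Set.Icc (Fin.cons a lo : Mink n) (Fin.cons b hi), ∑ ν, pd ν (f ν) x =
      (∫ y in Set.Icc lo hi, f 0 (Fin.cons b y : Mink n)) -
        ∫ y in Set.Icc lo hi, f 0 (Fin.cons a y : Mink n) := by
  have hle : (Fin.cons a lo : Mink n) ≤ Fin.cons b hi := by
    intro μ
    refine Fin.cases ?_ (fun i => ?_) μ
    · simpa using hab
    · simpa using hlohi i
  have key := integral_divergence_of_hasFDerivAt_off_countable' (E := E)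
    (Fin.cons a lo : Mink n) (Fin.cons b hi) hle f (fun i x => fderiv ℝ (f i) x) ∅
    Set.countable_empty (fun i => (hf i).continuous.continuousOn)
    (fun x _ i => ((hf i).differentiable (by simp) x).hasFDerivAt)
    (Continuous.integrableOn_Icc (continuous_finsetSum _ fun i _ =>
      (contDiff_pd (hf i) i).continuous))
  refine key.trans ?_
  rw [Fin.sum_univ_succ, Finset.sum_eq_zero, add_zero]
  · have h1 : ∀ (c : ℝ) (v : Fin n → ℝ), (Fin.cons c v : Mink n) ∘ (0 : Fin (n + 1)).succAbove = v :=
      fun c v => by funext i; simp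
    rw [h1, h1]
    simp only [Fin.insertNth_zero', Fin.cons_zero]
  · intro i _
    rw [sub_eq_zero]
    refine setIntegral_congr_fun measurableSet_Icc fun z hz => ?_
    refine hface i _ _ ?_ (by simp) (by simp) fun j hj => ?_
    · have h0 : (0 : Fin (n + 1)) ≠ i.succ := (Fin.succ_ne_zero i).symm
      obtain ⟨k, hk⟩ := Fin.exists_succAbove_eq h0
      have := hz.1 k
      rw [Function.comp_apply, hk, Fin.cons_zero] at this
      rw [← hk, Fin.insertNth_apply_succAbove]
      exact this
    · obtain ⟨k, rfl⟩ := Fin.exists_succAbove_eq hj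
      rw [Fin.insertNth_apply_succAbove, Fin.insertNth_apply_succAbove]

/-- The Clifford product `∑ aᵢ γ^i v` with a spatial vector. -/
noncomputable def spatialSlash (a : Fin n → ℝ) (v : Spinor n) : Spinor n :=
  ∑ i, a i • γ.gam i.succ *ᵥ v

lemma spatialSlash_spatialSlash (a : Fin n → ℝ) (v : Spinor n) :
    spatialSlash γ a (spatialSlash γ a v) = (∑ i, a i ^ 2) • v := by
  have h0 : spatialSlash γ a (spatialSlash γ a v) =
      ∑ i, ∑ j, (a i * a j) • γ.gam i.succ *ᵥ (γ.gam j.succ *ᵥ v) := by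
    simp only [spatialSlash, mulVec_sum, mulVec_smul_real, Finset.smul_sum, smul_smul]
  have h1 : spatialSlash γ a (spatialSlash γ a v) =
      ∑ i, ∑ j, (a i * a j) • γ.gam j.succ *ᵥ (γ.gam i.succ *ᵥ v) := by
    rw [h0, Finset.sum_comm]
    simp only [mul_comm]
  have h2 : (2 : ℝ) • spatialSlash γ a (spatialSlash γ a v) = (2 : ℝ) • (∑ i, a i ^ 2) • v := by
    conv_lhs => rw [two_smul]
    nth_rewrite 1 [h0]
    rw [h1, ← Finset.sum_add_distrib, Finset.sum_smul, Finset.smul_sum]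
    refine Finset.sum_congr rfl fun i _ => ?_
    rw [← Finset.sum_add_distrib]
    simp_rw [← smul_add, γ.clifford_apply i.succ, sub_add_cancel, Fin.succ_inj]
    rw [Finset.sum_eq_single i]
    · rw [if_pos rfl, eta_succ]; module
    · intro j _ hj; simp [hj.symm]
    · simp
  exact smul_right_injective _ (two_ne_zero (α := ℝ)) h2

lemma ip_spatialSlash (a : Fin n → ℝ) (v w : Spinor n) :
    ip (spatialSlash γ a v) w = ip v (spatialSlash γ a w) := by
  simp only [spatialSlash, ip_sum_left, ip_sum_right, ip_smul_left, ip_smul_right, γ.ip_gam_succ]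

/-- The real inner product of spinors as a bilinear form. -/
noncomputable def ipBilin (N : ℕ) : (Fin N → ℂ) →ₗ[ℝ] (Fin N → ℂ) →ₗ[ℝ] ℝ :=
  LinearMap.mk₂ ℝ ip ip_add_left ip_smul_left ip_add_right ip_smul_right

lemma contDiff_ip {N : ℕ} {H : Type*} [NormedAddCommGroup H] [NormedSpace ℝ H] {k : WithTop ℕ∞}
    {f g : H → Fin N → ℂ} (hf : ContDiff ℝ k f) (hg : ContDiff ℝ k g) :
    ContDiff ℝ k fun y => ip (f y) (g y) :=
  contDiff_bilin (ipBilin N) hf hg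

/-- The Dirac current `v† γ^0 γ^ν w`, up to sign, polarised. -/
noncomputable def current (ν : Fin (n + 1)) (v w : Spinor n) : ℝ :=
  -ip v (γ.gam 0 *ᵥ (γ.gam ν *ᵥ w))

lemma current_comm (ν : Fin (n + 1)) (v w : Spinor n) : current γ ν v w = current γ ν w v := by
  unfold current
  rw [ip_comm w, γ.ip_gam_zero]
  refine Fin.cases ?_ (fun i => ?_) ν
  · rw [γ.ip_gam_zero, γ.sq_apply, eta_zero]; simp
  · rw [γ.ip_gam_succ, γ.anticomm_apply (Fin.succ_ne_zero i), ip_neg_right]; ring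

/-- The Dirac current as a bilinear form. -/
noncomputable def currentBilin (ν : Fin (n + 1)) : Spinor n →ₗ[ℝ] Spinor n →ₗ[ℝ] ℝ :=
  LinearMap.mk₂ ℝ (current γ ν) (fun u v w => by simp only [current, ip_add_left]; ring)
    (fun c v w => by simp only [current, ip_smul_left, smul_eq_mul]; ring)
    (fun u v w => by simp only [current, mulVec_add, ip_add_right]; ring)
    (fun c v w => by simp only [current, mulVec_smul_real, ip_smul_right, smul_eq_mul]; ring)

lemma current_zero (v : Spinor n) : current γ 0 v v = ip v v := by
  rw [current, γ.sq_apply, eta_zero, ip_smul_right]; ring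

/-- The Dirac current is future-directed causal: its contraction with a causal covector is
non-negative. -/
lemma current_causal {a : Fin n → ℝ} (ha : ∑ i, a i ^ 2 ≤ 1) (v : Spinor n) :
    0 ≤ current γ 0 v v + ∑ i, a i * current γ i.succ v v := by
  have h1 : ∑ i, a i * current γ i.succ v v = -ip v (γ.gam 0 *ᵥ spatialSlash γ a v) := by
    simp only [current, spatialSlash, mulVec_sum, mulVec_smul_real, ip_sum_right, ip_smul_right,
      mul_neg, Finset.sum_neg_distrib]
  have h2 := ip_sq_le v (γ.gam 0 *ᵥ spatialSlash γ a v)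
  rw [γ.ip_gam_zero_gam_zero, ip_spatialSlash, spatialSlash_spatialSlash, ip_smul_right] at h2
  have h3 := ip_self_nonneg v
  have h4 : ip v (γ.gam 0 *ᵥ spatialSlash γ a v) ^ 2 ≤ ip v v ^ 2 := by
    refine h2.trans ?_
    nlinarith [mul_nonneg h3 h3]
  rw [h1, current_zero]
  have := (abs_le_of_sq_le_sq h4 h3)
  linarith [(abs_le.1 this).2]

/-- A smooth substitute for the spatial distance from the origin. -/
noncomputable def softRadius (ε : ℝ) (x : Mink n) : ℝ :=
  Real.sqrt (ε ^ 2 + ∑ i : Fin n, x i.succ ^ 2)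

lemma contDiff_softRadius {ε : ℝ} (hε : 0 < ε) : ContDiff ℝ ∞ (softRadius (n := n) ε) := by
  refine ContDiff.sqrt ?_ fun x => ?_
  · exact contDiff_const.add (ContDiff.sum fun i _ => (contDiff_apply ℝ ℝ i.succ).pow 2)
  · have : 0 ≤ ∑ i : Fin n, x i.succ ^ 2 := Finset.sum_nonneg fun i _ => sq_nonneg _
    positivity

lemma abs_le_softRadius (ε : ℝ) (x : Mink n) (i : Fin n) : |x i.succ| ≤ softRadius ε x := by
  rw [← Real.sqrt_sq_eq_abs]
  refine Real.sqrt_le_sqrt ?_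
  have := Finset.single_le_sum (f := fun i : Fin n => x i.succ ^ 2) (fun i _ => sq_nonneg _)
    (Finset.mem_univ i)
  have h2 := sq_nonneg ε
  linarith

lemma pd_coord_sq (ν : Fin (n + 1)) (i : Fin n) (x : Mink n) :
    pd ν (fun y : Mink n => y i.succ ^ 2) x = if ν = i.succ then 2 * x i.succ else 0 := by
  have h : HasFDerivAt (fun y : Mink n => y i.succ ^ 2)
      ((2 * x i.succ ^ (2 - 1)) • (ContinuousLinearMap.proj i.succ : Mink n →L[ℝ] ℝ)) x := by
    have := (hasFDerivAt_apply (𝕜 := ℝ) i.succ x).pow 2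
    simpa using this
  unfold pd
  rw [h.fderiv]
  simp [Pi.single_apply, eq_comm]

lemma pd_softRadius {ε : ℝ} (hε : 0 < ε) (x : Mink n) (ν : Fin (n + 1)) :
    pd ν (softRadius ε) x = if ν = 0 then 0 else x ν / softRadius ε x := by
  have hpos : ε ^ 2 + ∑ i : Fin n, x i.succ ^ 2 ≠ 0 := by
    have : 0 ≤ ∑ i : Fin n, x i.succ ^ 2 := Finset.sum_nonneg fun i _ => sq_nonneg _
    positivity
  have hd : ∀ i : Fin n, DifferentiableAt ℝ (fun y : Mink n => y i.succ ^ 2) x :=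
    fun i => (differentiableAt_apply i.succ x).pow 2
  have hd2 : DifferentiableAt ℝ (fun y : Mink n => ∑ i : Fin n, y i.succ ^ 2) x :=
    DifferentiableAt.fun_sum fun i _ => hd i
  have h1 : pd ν (fun y : Mink n => ε ^ 2 + ∑ i : Fin n, y i.succ ^ 2) x =
      ∑ i : Fin n, if ν = i.succ then 2 * x i.succ else 0 := by
    rw [pd_fun_add (differentiableAt_const _) hd2, pd_const, zero_add,
      pd_fun_sum (fun i _ => hd i)]
    exact Finset.sum_congr rfl fun i _ => pd_coord_sq ν i x
  have h2 : pd ν (softRadius ε) x =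
      (1 / (2 * softRadius ε x)) * pd ν (fun y : Mink n => ε ^ 2 + ∑ i : Fin n, y i.succ ^ 2) x := by
    have := (((differentiableAt_const (ε ^ 2)).add hd2).hasFDerivAt).sqrt hpos
    unfold pd
    rw [show softRadius ε = fun y : Mink n => Real.sqrt (ε ^ 2 + ∑ i : Fin n, y i.succ ^ 2) from rfl]
    erw [this.fderiv]
    rfl
  have hs : softRadius ε x ≠ 0 := (Real.sqrt_ne_zero (by positivity)).2 hpos
  rw [h2, h1]
  refine Fin.cases ?_ (fun j => ?_) ν
  · simp [(Fin.succ_ne_zero _).symm]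
  · rw [if_neg (Fin.succ_ne_zero j)]
    simp only [Fin.succ_inj]
    rw [Finset.sum_ite_eq]
    simp only [Finset.mem_univ, if_true]
    field_simp

/-- A smooth weight that decreases along future-directed causal directions and is positive exactly
inside a (slightly rounded) backward light cone. -/
noncomputable def coneWeight (R ε : ℝ) (x : Mink n) : ℝ :=
  expNegInvGlue (R - x 0 - softRadius ε x)

lemma contDiff_coneWeight (R : ℝ) {ε : ℝ} (hε : 0 < ε) :
    ContDiff ℝ ∞ (coneWeight (n := n) R ε) :=
  expNegInvGlue.contDiff.comp
    ((contDiff_const.sub (contDiff_apply ℝ ℝ 0)).sub (contDiff_softRadius hε))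

lemma coneWeight_nonneg (R ε : ℝ) (x : Mink n) : 0 ≤ coneWeight R ε x := expNegInvGlue.nonneg _

lemma coneWeight_pos {R ε : ℝ} {x : Mink n} (h : x 0 + softRadius ε x < R) :
    0 < coneWeight R ε x := expNegInvGlue.pos_of_pos (by linarith)

lemma coneWeight_eq_zero {R ε : ℝ} {x : Mink n} (h : R ≤ x 0 + softRadius ε x) :
    coneWeight R ε x = 0 := expNegInvGlue.zero_of_nonpos (by linarith)

lemma coneWeight_le_one (R ε : ℝ) (x : Mink n) : coneWeight R ε x ≤ 1 := by
  unfold coneWeight expNegInvGlue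
  split_ifs with h
  · exact zero_le_one
  · rw [Real.exp_le_one_iff, neg_nonpos, inv_nonneg]
    exact (not_le.1 h).le

lemma pd_coneWeight (R : ℝ) {ε : ℝ} (hε : 0 < ε) (x : Mink n) (ν : Fin (n + 1)) :
    pd ν (coneWeight R ε) x = -(deriv expNegInvGlue (R - x 0 - softRadius ε x) *
      if ν = 0 then 1 else x ν / softRadius ε x) := by
  have hs : DifferentiableAt ℝ (softRadius ε) x := (contDiff_softRadius hε).differentiable (by simp) x
  have h0 : DifferentiableAt ℝ (fun y : Mink n => y 0) x := differentiableAt_apply 0 x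
  have h1 : DifferentiableAt ℝ (fun y : Mink n => R - y 0) x := h0.const_sub R
  have hφ : DifferentiableAt ℝ expNegInvGlue (R - x 0 - softRadius ε x) :=
    (expNegInvGlue.contDiff (n := 1)).differentiable (by simp) _
  have h2 : pd ν (coneWeight R ε) x = deriv expNegInvGlue (R - x 0 - softRadius ε x) *
      pd ν (fun y : Mink n => R - y 0 - softRadius ε y) x := by
    have := hφ.hasDerivAt.comp_hasFDerivAt x (h1.sub hs).hasFDerivAt
    unfold pd
    rw [show coneWeight R ε = expNegInvGlue ∘ fun y : Mink n => R - y 0 - softRadius ε y from rfl]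
    erw [this.fderiv]
    rfl
  have h3 : pd ν (fun y : Mink n => y 0) x = if ν = 0 then 1 else 0 := by
    unfold pd
    rw [(hasFDerivAt_apply (𝕜 := ℝ) (0 : Fin (n + 1)) x).fderiv]
    simp [Pi.single_apply, eq_comm]
  rw [h2, pd_fun_sub h1 hs, pd_fun_sub (differentiableAt_const R) h0, pd_const, h3,
    pd_softRadius hε]
  split_ifs <;> ring

/-- The weighted energy on a time slice, restricted to the box `[-ρ, ρ]ⁿ`. -/
noncomputable def coneEnergy (R ε ρ : ℝ) (u : Mink n → Spinor n) (t : ℝ) : ℝ :=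
  ∫ y in Set.Icc (fun _ : Fin n => -ρ) (fun _ => ρ),
    coneWeight R ε (Fin.cons t y : Mink n) * ip (u (Fin.cons t y)) (u (Fin.cons t y))

/-- The energy inside a backward light cone does not increase. The weighted Dirac current is
integrated over a box. The spatial faces do not contribute, since `R - a ≤ ρ` makes the weight
vanish there. Inside the box the current is conserved wherever the weight is positive, and what
remains of the divergence is the contraction of the current with the gradient of the weight, which
is a causal covector and gives a definite sign. -/
lemma coneEnergy_le {u : Mink n → Spinor n} (hu : ContDiff ℝ ∞ u) {R ε a b ρ : ℝ} (hε : 0 < ε)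
    (hab : a ≤ b) (hρ0 : 0 ≤ ρ) (hρ : R - a ≤ ρ)
    (h0 : ∀ x : Mink n, a ≤ x 0 → x 0 + softRadius ε x < R → slash γ u x = 0) :
    coneEnergy R ε ρ u b ≤ coneEnergy R ε ρ u a := by
  have hw := contDiff_coneWeight (n := n) R hε
  have hj : ∀ ν, ContDiff ℝ ∞ fun x => current γ ν (u x) (u x) :=
    fun ν => contDiff_bilin (currentBilin γ ν) hu hu
  have hf : ∀ ν, ContDiff ℝ ∞ fun x => coneWeight R ε x * current γ ν (u x) (u x) :=
    fun ν => hw.mul (hj ν)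
  have hlohi : (fun _ : Fin n => -ρ) ≤ fun _ => ρ := fun i => by dsimp only; linarith
  have key := integral_div_box (fun ν x => coneWeight R ε x * current γ ν (u x) (u x)) hf hab hlohi ?_
  · simp only [current_zero] at key
    have hneg : ∫ x in Set.Icc (Fin.cons a fun _ => -ρ : Mink n) (Fin.cons b fun _ => ρ),
        ∑ ν, pd ν (fun x => coneWeight R ε x * current γ ν (u x) (u x)) x ≤ 0 := by
      refine setIntegral_nonpos measurableSet_Icc fun x hx => ?_
      have hxa : a ≤ x 0 := by simpa using hx.1 0
      have hd : ∀ ν, pd ν (fun x => coneWeight R ε x * current γ ν (u x) (u x)) x =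
          coneWeight R ε x * (2 * current γ ν (u x) (pd ν u x)) +
            pd ν (coneWeight R ε) x * current γ ν (u x) (u x) := by
        intro ν
        have h1 := pd_smul_fun (hw.differentiable (by simp) x) ((hj ν).differentiable (by simp) x) ν
        have h2 := pd_bilin (currentBilin γ ν) (hu.differentiable (by simp) x)
          (hu.differentiable (by simp) x) ν
        simp only [smul_eq_mul] at h1
        rw [h1]
        congr 2
        refine h2.trans ?_
        change current γ ν (pd ν u x) (u x) + current γ ν (u x) (pd ν u x) = _
        rw [current_comm]; ring
      -- conservation of the current inside the cone, where the Dirac equation holds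
      have hdiv : coneWeight R ε x * ∑ ν, current γ ν (u x) (pd ν u x) = 0 := by
        by_cases hx2 : x 0 + softRadius ε x < R
        · have h3 : ∑ ν, current γ ν (u x) (pd ν u x) = -ip (u x) (γ.gam 0 *ᵥ slash γ u x) := by
            simp only [current, slash, mulVec_sum, ip_sum_right, Finset.sum_neg_distrib]
          rw [h3, h0 x hxa hx2]
          simp
        · rw [coneWeight_eq_zero (not_lt.1 hx2), zero_mul]
      have hφ : 0 ≤ deriv expNegInvGlue (R - x 0 - softRadius ε x) :=
        expNegInvGlue.monotone.deriv_nonneg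
      have hsr : 0 < softRadius ε x := by
        refine Real.sqrt_pos.2 ?_
        have : 0 ≤ ∑ i : Fin n, x i.succ ^ 2 := Finset.sum_nonneg fun i _ => sq_nonneg _
        positivity
      -- the spatial gradient of the rounded radius has length at most one
      have hcaus := current_causal γ (a := fun i => x i.succ / softRadius ε x) (by
        simp only [div_pow]
        rw [← Finset.sum_div, div_le_one (by positivity), softRadius, Real.sq_sqrt]
        · linarith [sq_nonneg ε]
        · have : 0 ≤ ∑ i : Fin n, x i.succ ^ 2 := Finset.sum_nonneg fun i _ => sq_nonneg _
          positivity) (u x)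
      have hsum : ∑ ν, pd ν (fun x => coneWeight R ε x * current γ ν (u x) (u x)) x =
          2 * (coneWeight R ε x * ∑ ν, current γ ν (u x) (pd ν u x)) -
            deriv expNegInvGlue (R - x 0 - softRadius ε x) * (current γ 0 (u x) (u x) +
              ∑ i : Fin n, x i.succ / softRadius ε x * current γ i.succ (u x) (u x)) := by
        simp only [hd, pd_coneWeight R hε, Finset.sum_add_distrib]
        rw [sub_eq_add_neg]
        congr 1
        · rw [Finset.mul_sum, Finset.mul_sum]
          exact Finset.sum_congr rfl fun _ _ => by ring
        · rw [Fin.sum_univ_succ, mul_add, neg_add, Finset.mul_sum, ← Finset.sum_neg_distrib]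
          congr 1
          · simp
          · refine Finset.sum_congr rfl fun i _ => ?_
            rw [if_neg (Fin.succ_ne_zero i)]; ring
      rw [hsum, hdiv]
      have := mul_nonneg hφ hcaus
      linarith
    unfold coneEnergy
    linarith
  · -- on the faces `xⁱ = ±ρ` the weight vanishes
    intro i x x' hxa hx hx' hne
    have h00 : x 0 = x' 0 := hne 0 (Fin.succ_ne_zero i).symm
    have h1 := abs_le_softRadius ε x i
    have h2 := abs_le_softRadius ε x' i
    rw [hx, abs_of_nonneg hρ0] at h1
    rw [hx', abs_neg, abs_of_nonneg hρ0] at h2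
    rw [coneWeight_eq_zero (by linarith), coneWeight_eq_zero (by linarith), zero_mul, zero_mul]

/-- A field whose weighted energy vanishes on a time slice vanishes inside the cone there. -/
lemma eq_zero_of_coneEnergy_nonpos {u : Mink n → Spinor n} (hu : ContDiff ℝ ∞ u) {R ε ρ t : ℝ}
    (hε : 0 < ε) (h : coneEnergy R ε ρ u t ≤ 0) {y : Fin n → ℝ} (hy : ∀ i, |y i| < ρ)
    (hyR : t + softRadius ε (Fin.cons t y : Mink n) < R) : u (Fin.cons t y) = 0 := by
  set g : (Fin n → ℝ) → ℝ := fun y =>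
    coneWeight R ε (Fin.cons t y : Mink n) * ip (u (Fin.cons t y)) (u (Fin.cons t y)) with hg
  have hcons : Continuous fun y : Fin n → ℝ => (Fin.cons t y : Mink n) := by
    refine continuous_pi fun μ => ?_
    refine Fin.cases ?_ (fun i => ?_) μ
    · simpa using continuous_const
    · simpa using continuous_apply i
  have hgc : Continuous g := by
    refine ((contDiff_coneWeight R hε).continuous.comp hcons).mul ?_
    have : Continuous fun x => ip (u x) (u x) :=
      (contDiff_ip hu hu).continuous
    exact this.comp hcons
  have hg0 : ∀ y, 0 ≤ g y := fun y => mul_nonneg (coneWeight_nonneg _ _ _) (ip_self_nonneg _)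
  by_contra hne
  have hpos : 0 < g y := by
    refine mul_pos (coneWeight_pos (by simpa using hyR)) ?_
    exact lt_of_le_of_ne (ip_self_nonneg _) fun h => hne (ip_self_eq_zero.1 h.symm)
  have hint : IntegrableOn g (Set.Icc (fun _ : Fin n => -ρ) fun _ => ρ) := hgc.integrableOn_Icc
  have h2 : 0 < ∫ y in Set.Icc (fun _ : Fin n => -ρ) (fun _ => ρ), g y := by
    rw [setIntegral_pos_iff_support_of_nonneg_ae (Filter.Eventually.of_forall hg0) hint]
    have hopen : IsOpen (Function.support g ∩ Set.pi Set.univ fun _ => Set.Ioo (-ρ) ρ) :=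
      hgc.isOpen_support.inter (isOpen_set_pi Set.finite_univ fun _ _ => isOpen_Ioo)
    have hmem : y ∈ Function.support g ∩ Set.pi Set.univ fun _ => Set.Ioo (-ρ) ρ :=
      ⟨hpos.ne', fun i _ => abs_lt.1 (hy i)⟩
    refine lt_of_lt_of_le (hopen.measure_pos volume ⟨y, hmem⟩) (measure_mono ?_)
    refine Set.inter_subset_inter_right _ fun z hz => ?_
    exact ⟨fun i => (hz i trivial).1.le, fun i => (hz i trivial).2.le⟩
  exact absurd h (not_le.2 h2)

end Energy

/-! ### Finite speed of propagation -/

section Propagation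

variable {n : ℕ} (γ : GammaRep n)

open Matrix MeasureTheory

/-- The Euclidean length of the spatial part of a vector. -/
noncomputable def spaceNorm (x : Mink n) : ℝ := Real.sqrt (∑ i : Fin n, x i.succ ^ 2)

lemma spaceNorm_nonneg (x : Mink n) : 0 ≤ spaceNorm x := Real.sqrt_nonneg _

lemma spaceNorm_sq (x : Mink n) : spaceNorm x ^ 2 = ∑ i : Fin n, x i.succ ^ 2 :=
  Real.sq_sqrt (Finset.sum_nonneg fun _ _ => sq_nonneg _)

lemma continuous_spaceNorm : Continuous (spaceNorm (n := n)) := by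
  unfold spaceNorm; fun_prop

lemma abs_le_spaceNorm (x : Mink n) (i : Fin n) : |x i.succ| ≤ spaceNorm x := by
  have := abs_le_softRadius 0 x i
  simpa [softRadius, spaceNorm] using this

lemma spaceNorm_le_softRadius (ε : ℝ) (x : Mink n) : spaceNorm x ≤ softRadius ε x :=
  Real.sqrt_le_sqrt (by linarith [sq_nonneg ε])

lemma spaceNorm_neg (x : Mink n) : spaceNorm (-x) = spaceNorm x := by simp [spaceNorm]

/-- The closed cone of future-directed causal vectors, including zero. -/
def futureCone (n : ℕ) : Set (Mink n) := {v | spaceNorm v ≤ v 0}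

lemma isClosed_futureCone : IsClosed (futureCone n) :=
  isClosed_le continuous_spaceNorm (continuous_apply 0)

lemma norm_le_of_mem_futureCone {v : Mink n} (hv : v ∈ futureCone n) : ‖v‖ ≤ v 0 := by
  have h0 : 0 ≤ v 0 := (spaceNorm_nonneg v).trans hv
  refine (pi_norm_le_iff_of_nonneg h0).2 fun μ => ?_
  rw [Real.norm_eq_abs]
  refine Fin.cases ?_ (fun i => ?_) μ
  · rw [abs_of_nonneg h0]
  · exact (abs_le_spaceNorm v i).trans hv

/-- A spinor field that is small in the distant past vanishes at every point whose past light cone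
avoids its source: the energy inside the cone is bounded by that on ever earlier slices. -/
lemma eq_zero_of_past_cone {u : Mink n → Spinor n} (hu : ContDiff ℝ ∞ u)
    (hpast : ∃ a M : ℝ, ∀ y, y 0 ≤ a → ip (u y) (u y) ≤ M * Real.exp (y 0)) (q : Mink n)
    (h0 : ∀ v ∈ futureCone n, slash γ u (q - v) = 0) : u q = 0 := by
  obtain ⟨a₀, M, hM⟩ := hpast
  -- translate the tip of the cone to the origin
  set w : Mink n → Spinor n := fun y => u (y + q) with hw
  have hwc : ContDiff ℝ ∞ w := hu.comp (contDiff_id.add contDiff_const)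
  have hws : ∀ y, slash γ w y = slash γ u (y + q) := fun y => by
    simp only [slash, hw, pd_comp_add]
  set M' := |M| * Real.exp (q 0) with hM'
  have hdec : ∀ y, y 0 ≤ a₀ - q 0 → ip (w y) (w y) ≤ M' * Real.exp (y 0) := by
    intro y hy
    have h1 := hM (y + q) (by simp only [Pi.add_apply]; linarith)
    rw [Pi.add_apply, Real.exp_add] at h1
    refine h1.trans ?_
    calc M * (Real.exp (y 0) * Real.exp (q 0)) ≤ |M| * (Real.exp (y 0) * Real.exp (q 0)) :=
          mul_le_mul_of_nonneg_right (le_abs_self M) (by positivity)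
      _ = _ := by rw [hM']; ring
  -- the weight vanishes at the tip of the cone, so points just below the tip are treated first
  have hpoint : ∀ δ > 0, w (Fin.cons (-δ) 0) = 0 := by
    intro δ hδ
    have hsr : softRadius (δ / 2) (Fin.cons (-δ) 0 : Mink n) = δ / 2 := by
      simp only [softRadius, Fin.cons_succ, Pi.zero_apply]
      rw [show (δ / 2) ^ 2 + ∑ _i : Fin n, (0 : ℝ) ^ 2 = (δ / 2) ^ 2 by simp]
      exact Real.sqrt_sq (by linarith)
    refine eq_zero_of_coneEnergy_nonpos hwc (R := 0) (ε := δ / 2) (ρ := δ) (by linarith) ?_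
      (fun i => by simpa using hδ) (by rw [hsr]; linarith)
    have hint : ∀ ρ t : ℝ, IntegrableOn (fun y : Fin n → ℝ => coneWeight 0 (δ / 2)
        (Fin.cons t y : Mink n) * ip (w (Fin.cons t y)) (w (Fin.cons t y)))
        (Set.Icc (fun _ => -ρ) fun _ => ρ) := by
      intro ρ t
      have hcons : Continuous fun y : Fin n → ℝ => (Fin.cons t y : Mink n) := by
        refine continuous_pi fun μ => ?_
        refine Fin.cases ?_ (fun i => ?_) μ
        · simpa using continuous_const
        · simpa using continuous_apply i
      exact ((((contDiff_coneWeight 0 (by linarith)).continuous).mul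
        (contDiff_ip hwc hwc).continuous).comp hcons).integrableOn_Icc
    -- on the slice at time `-s` the cone has volume `O(sⁿ)` and the energy density is `O(e⁻ˢ)`
    have hbound : ∀ s : ℝ, δ ≤ s → q 0 - a₀ ≤ s →
        coneEnergy 0 (δ / 2) δ w (-δ) ≤ M' * 2 ^ n * (s ^ n * Real.exp (-s)) := by
      intro s hs hs2
      have hs0 : 0 ≤ s := hδ.le.trans hs
      calc coneEnergy 0 (δ / 2) δ w (-δ) ≤ coneEnergy 0 (δ / 2) s w (-δ) := by
            refine setIntegral_mono_set (hint s (-δ))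
              (Filter.Eventually.of_forall fun y =>
                mul_nonneg (coneWeight_nonneg _ _ _) (ip_self_nonneg _))
              (LE.le.eventuallyLE ?_)
            exact Set.Icc_subset_Icc (fun _ => by dsimp only; linarith) fun _ => hs
        _ ≤ coneEnergy 0 (δ / 2) s w (-s) := by
            refine coneEnergy_le γ hwc (by linarith) (by linarith) hs0 (by linarith) ?_
            intro x _ hx
            rw [hws, show x + q = q - (-x) by abel]
            refine h0 _ ?_
            have := spaceNorm_le_softRadius (δ / 2) x
            rw [futureCone, Set.mem_ofPred_eq, spaceNorm_neg, Pi.neg_apply]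
            linarith
        _ ≤ ‖coneEnergy 0 (δ / 2) s w (-s)‖ := le_abs_self _
        _ ≤ M' * Real.exp (-s) * volume.real (Set.Icc (fun _ : Fin n => -s) fun _ => s) := by
            refine norm_setIntegral_le_of_norm_le_const ?_ ?_
            · rw [Real.volume_Icc_pi]
              exact ENNReal.prod_lt_top fun _ _ => ENNReal.ofReal_lt_top
            · intro y _
              have h1 := hdec (Fin.cons (-s) y) (by rw [Fin.cons_zero]; linarith)
              rw [Fin.cons_zero] at h1
              rw [Real.norm_eq_abs, abs_of_nonneg
                (mul_nonneg (coneWeight_nonneg _ _ _) (ip_self_nonneg _))]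
              refine le_trans (mul_le_of_le_one_left (ip_self_nonneg _) (coneWeight_le_one _ _ _)) h1
        _ = M' * 2 ^ n * (s ^ n * Real.exp (-s)) := by
            rw [measureReal_def, Real.volume_Icc_pi_toReal (fun _ => by dsimp only; linarith)]
            simp only [Finset.prod_const, Finset.card_univ, Fintype.card_fin]
            rw [show s - -s = 2 * s by ring, mul_pow]; ring
    have hlim := (Real.tendsto_pow_mul_exp_neg_atTop_nhds_zero n).const_mul (M' * 2 ^ n)
    rw [mul_zero] at hlim
    refine ge_of_tendsto hlim ?_
    filter_upwards [Filter.eventually_ge_atTop δ, Filter.eventually_ge_atTop (q 0 - a₀)] with s h1 h2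
    exact hbound s h1 h2
  -- the tip itself follows by continuity
  have hq : u q = w (Fin.cons (-0) 0) := by
    have : (Fin.cons (-0) 0 : Mink n) = 0 := by
      funext μ
      refine Fin.cases ?_ (fun i => ?_) μ <;> simp
    rw [this, hw]; simp
  have hcont : Continuous fun δ : ℝ => w (Fin.cons (-δ) 0) := by
    refine hwc.continuous.comp (continuous_pi fun μ => ?_)
    refine Fin.cases ?_ (fun i => ?_) μ
    · simpa using continuous_neg
    · simpa using continuous_const
  rw [hq]
  have h1 : Filter.Tendsto (fun δ : ℝ => w (Fin.cons (-δ) 0)) (nhdsWithin 0 (Set.Ioi 0))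
      (nhds (w (Fin.cons (-0) 0))) := hcont.continuousAt.tendsto.mono_left nhdsWithin_le_nhds
  refine tendsto_nhds_unique h1 (tendsto_const_nhds.congr' ?_)
  filter_upwards [self_mem_nhdsWithin] with δ hδ using (hpoint δ hδ).symm

/-- Uniqueness for the Dirac equation with past-compact data. -/
lemma eq_zero_of_slash_eq_zero {u : Mink n → Spinor n} (hu : ContDiff ℝ ∞ u)
    (hpast : ∃ a : ℝ, ∀ y, y 0 < a → u y = 0) (h0 : ∀ y, slash γ u y = 0) (y : Mink n) :
    u y = 0 := by
  obtain ⟨a, ha⟩ := hpast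
  refine eq_zero_of_past_cone γ hu ⟨a - 1, 0, fun y hy => ?_⟩ y fun _ _ => h0 _
  rw [ha y (by linarith)]; simp

lemma eq_zero_of_slash_eq_zero_future {u : Mink n → Spinor n} (hu : ContDiff ℝ ∞ u)
    (hfut : ∃ a : ℝ, ∀ y, a < y 0 → u y = 0) (h0 : ∀ y, slash γ u y = 0) (y : Mink n) :
    u y = 0 := by
  obtain ⟨a, ha⟩ := hfut
  have := eq_zero_of_slash_eq_zero γ.reverse (hu.comp (timeRev n).contDiff)
    ⟨-a, fun y hy => ha _ (by rw [timeRev_zero_coord]; linarith)⟩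
    (fun y => by
      have := slash_reverse γ hu y
      rw [h0] at this
      exact this) (timeRev n y)
  simpa [timeRev_timeRev] using this

end Propagation

/-! ### The wave equation on Minkowski space by Fourier transform -/

section Wave

open MeasureTheory FourierTransform LineDeriv SchwartzMap

/-- The bound `1 / 4` is the one available for the symbol of the wave operator. -/
lemma hasTemperateGrowth_inv {H : Type*} [NormedAddCommGroup H] [NormedSpace ℝ H] {q : H → ℝ}
    (hq : q.HasTemperateGrowth) (hpos : ∀ x, 1 / 4 ≤ q x) :
    (fun x => (q x)⁻¹).HasTemperateGrowth := by
  set t := {y : ℝ | 1 / 8 < y} with ht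
  have hopen : IsOpen t := isOpen_lt' (1 / 8)
  have hmem : ∀ y ∈ t, y ≠ 0 := fun y hy => (lt_trans (by norm_num) (show 1 / 8 < y from hy)).ne'
  have hrange : Set.range q ⊆ t := by
    rintro - ⟨y, rfl⟩
    exact lt_of_lt_of_le (by norm_num : (1 : ℝ) / 8 < 1 / 4) (hpos y)
  refine Function.HasTemperateGrowth.comp' (g := fun y : ℝ => y⁻¹) hrange hopen.uniqueDiffOn
    (contDiffOn_id.inv hmem) ?_ hq
  intro N
  refine ⟨0, ∑ k ∈ Finset.range (N + 1), (k.factorial : ℝ) * 8 ^ (k + 1), by positivity, ?_⟩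
  intro k hk x hx
  have hx8 : 1 / 8 < x := hx
  have hx0 : 0 < x := lt_trans (by norm_num) hx8
  rw [pow_zero, mul_one, norm_iteratedFDerivWithin_eq_norm_iteratedDerivWithin,
    iteratedDerivWithin_eq_iteratedDeriv hopen.uniqueDiffOn (contDiffAt_inv ℝ hx0.ne') hx,
    iteratedDeriv_eq_iterate, iter_deriv_inv]
  have h1 : ‖(-1 : ℝ) ^ k * k.factorial * x ^ (-1 - (k : ℤ))‖ ≤ k.factorial * 8 ^ (k + 1) := by
    rw [norm_mul, norm_mul, norm_pow, norm_neg, norm_one, one_pow, one_mul, Real.norm_natCast]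
    refine mul_le_mul_of_nonneg_left ?_ (by positivity)
    rw [show -1 - (k : ℤ) = -((k + 1 : ℕ) : ℤ) by push_cast; ring, zpow_neg, zpow_natCast,
      ← inv_pow, norm_pow, Real.norm_eq_abs, abs_of_pos (inv_pos.2 hx0)]
    refine pow_le_pow_left₀ (inv_pos.2 hx0).le ?_ _
    rw [inv_le_comm₀ hx0 (by norm_num)]
    linarith
  refine h1.trans (Finset.single_le_sum (f := fun k : ℕ => (k.factorial : ℝ) * 8 ^ (k + 1))
    (fun _ _ => by positivity) (Finset.mem_range.2 (by omega)))

variable {n : ℕ}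

variable (n) in
/-- Minkowski space with its Euclidean norm, on which the Fourier transform is defined. -/
abbrev EMink : Type := EuclideanSpace ℝ (Fin (n + 1))

variable (n) in
/-- The identification of Minkowski space with Euclidean space. -/
noncomputable def toE : Mink n ≃L[ℝ] EMink n := (EuclideanSpace.equiv (Fin (n + 1)) ℝ).symm

lemma toE_apply (x : Mink n) (μ : Fin (n + 1)) : toE n x μ = x μ := rfl

/-- The symbol of the conjugated wave operator `e^{-t} □ e^t`, which arises from that of `□` by
replacing `∂_t` with `∂_t + 1`. -/
noncomputable def waveSymbol (ξ : EMink n) : ℂ :=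
  ∑ ν, (eta ν : ℂ) * (2 * Real.pi * Complex.I * ξ ν) ^ 2 - 2 * (2 * Real.pi * Complex.I * ξ 0) - 1

/-- The real part of the symbol. -/
noncomputable def waveSymbolRe (ξ : EMink n) : ℝ := -∑ ν, eta ν * (2 * Real.pi * ξ ν) ^ 2 - 1

/-- The imaginary part of the symbol. -/
noncomputable def waveSymbolIm (ξ : EMink n) : ℝ := -(2 * (2 * Real.pi * ξ 0))

lemma waveSymbol_eq (ξ : EMink n) :
    waveSymbol ξ = (waveSymbolRe ξ : ℂ) + (waveSymbolIm ξ : ℂ) * Complex.I := by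
  have h : ∀ ν : Fin (n + 1), (eta ν : ℂ) * (2 * Real.pi * Complex.I * ξ ν) ^ 2 =
      -((eta ν : ℂ) * (2 * Real.pi * ξ ν) ^ 2) := by
    intro ν
    linear_combination (eta ν : ℂ) * (2 * Real.pi * ξ ν) ^ 2 * Complex.I_sq
  simp only [waveSymbol, waveSymbolRe, waveSymbolIm, h, Finset.sum_neg_distrib]
  push_cast
  ring

/-- The symbol stays away from zero: where its real part is small, the frequency `|ξ⁰|` is bounded
below, and so is the imaginary part, which comes from the conjugation with `e^t`. -/
lemma waveSymbol_lower (ξ : EMink n) : 1 / 4 ≤ waveSymbolRe ξ ^ 2 + waveSymbolIm ξ ^ 2 := by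
  unfold waveSymbolRe waveSymbolIm
  rw [Fin.sum_univ_succ, eta_zero]
  simp only [eta_succ, one_mul]
  have hS : 0 ≤ ∑ i : Fin n, (2 * Real.pi * ξ i.succ) ^ 2 := Finset.sum_nonneg fun _ _ => sq_nonneg _
  generalize ∑ i : Fin n, (2 * Real.pi * ξ i.succ) ^ 2 = S at *
  generalize 2 * Real.pi * ξ 0 = a
  have ha := sq_nonneg a
  by_cases h : 1 / 2 ≤ S + 1 - a ^ 2
  · nlinarith
  · nlinarith [sq_nonneg (-(-1 * a ^ 2 + S) - 1)]

/-- The inverse of the symbol. -/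
noncomputable def waveInv (ξ : EMink n) : ℂ :=
  (((waveSymbolRe ξ ^ 2 + waveSymbolIm ξ ^ 2)⁻¹ : ℝ) : ℂ) *
    ((waveSymbolRe ξ : ℂ) + -(waveSymbolIm ξ : ℂ) * Complex.I)

lemma waveSymbol_mul_waveInv (ξ : EMink n) : waveSymbol ξ * waveInv ξ = 1 := by
  have h : (waveSymbolRe ξ ^ 2 + waveSymbolIm ξ ^ 2 : ℝ) ≠ 0 := by
    have := waveSymbol_lower ξ
    intro h0; linarith
  have h2 : ((waveSymbolRe ξ : ℂ) ^ 2 + (waveSymbolIm ξ : ℂ) ^ 2) ≠ 0 := by exact_mod_cast h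
  rw [waveSymbol_eq, waveInv]
  push_cast
  field_simp
  ring_nf
  rw [Complex.I_sq]
  ring

lemma hasTemperateGrowth_coord (ν : Fin (n + 1)) :
    (fun ξ : EMink n => ξ ν).HasTemperateGrowth :=
  (EuclideanSpace.proj ν : EMink n →L[ℝ] ℝ).hasTemperateGrowth

lemma hasTemperateGrowth_waveInv : (waveInv (n := n)).HasTemperateGrowth := by
  have hre : (waveSymbolRe (n := n)).HasTemperateGrowth := by
    have h : ∀ ν : Fin (n + 1), (fun ξ : EMink n => eta ν * (2 * Real.pi * ξ ν) ^ 2).HasTemperateGrowth :=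
      fun ν => (Function.HasTemperateGrowth.const _).mul
        (((Function.HasTemperateGrowth.const (2 * Real.pi)).mul (hasTemperateGrowth_coord ν)).pow 2)
    exact ((Function.HasTemperateGrowth.sum fun ν _ => h ν).neg).sub (.const 1)
  have him : (waveSymbolIm (n := n)).HasTemperateGrowth :=
    ((Function.HasTemperateGrowth.const (2 : ℝ)).mul
      ((Function.HasTemperateGrowth.const (2 * Real.pi)).mul (hasTemperateGrowth_coord 0))).neg
  have hq := hasTemperateGrowth_inv ((hre.pow 2).add (him.pow 2)) (fun ξ => waveSymbol_lower ξ)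
  have hC : ∀ {g : EMink n → ℝ}, g.HasTemperateGrowth → (fun ξ => (g ξ : ℂ)).HasTemperateGrowth :=
    fun hg => Function.HasTemperateGrowth.comp Function.Complex.hasTemperateGrowth_ofReal hg
  exact (hC hq).mul ((hC hre).add (((hC him).neg).mul (.const Complex.I)))

variable {F : Type*} [NormedAddCommGroup F] [NormedSpace ℂ F]

/-- The unit vectors of Minkowski space. -/
noncomputable def eVec (ν : Fin (n + 1)) : EMink n := toE n (Pi.single ν 1)

lemma fourier_lineDeriv_apply (f : 𝓢(EMink n, F)) (ν : Fin (n + 1)) (ξ : EMink n) :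
    𝓕 (∂_{eVec ν} f) ξ = (2 * Real.pi * Complex.I * ξ ν) • 𝓕 f ξ := by
  have hg : (fun x : EMink n => inner ℝ x (eVec ν)).HasTemperateGrowth := by fun_prop
  have hi : inner ℝ ξ (eVec ν) = ξ ν := by
    simp [eVec, PiLp.inner_apply, toE_apply, Pi.single_apply]
  rw [fourier_lineDerivOp_eq, smul_apply, smulLeftCLM_apply_apply hg, hi,
    ← Complex.coe_smul, smul_smul]

variable [CompleteSpace F]

variable (n F) in
/-- The inverse of `e^{-t} □ e^t` on Schwartz functions. -/
noncomputable def waveSolve : 𝓢(EMink n, F) →L[ℂ] 𝓢(EMink n, F) :=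
  fourierMultiplierCLM F (waveInv (n := n))

lemma waveSolve_spec (g : 𝓢(EMink n, F)) :
    ∑ ν : Fin (n + 1), (eta ν : ℂ) • ∂_{eVec ν} (∂_{eVec ν} (waveSolve n F g)) -
      (2 : ℂ) • ∂_{eVec (0 : Fin (n + 1))} (waveSolve n F g) - waveSolve n F g = g := by
  set w := waveSolve n F g with hw
  have hF : 𝓕 w = smulLeftCLM F (waveInv (n := n)) (𝓕 g) := by
    rw [hw, waveSolve, fourierMultiplierCLM_apply, fourier_fourierInv_eq]
  set h := ∑ ν : Fin (n + 1), (eta ν : ℂ) • ∂_{eVec ν} (∂_{eVec ν} w) -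
    (2 : ℂ) • ∂_{eVec (0 : Fin (n + 1))} w - w with hh
  have key : 𝓕 h = 𝓕 g := by
    have h1 : 𝓕 h = ∑ ν : Fin (n + 1), (eta ν : ℂ) • 𝓕 (∂_{eVec ν} (∂_{eVec ν} w)) -
        (2 : ℂ) • 𝓕 (∂_{eVec (0 : Fin (n + 1))} w) - 𝓕 w := by
      have hL : ∀ f : 𝓢(EMink n, F), 𝓕 f = fourierTransformCLM ℂ f := fun f => rfl
      simp only [hL, hh, map_sub, map_sum, map_smul]
    ext ξ
    rw [h1]
    simp only [sub_apply, sum_apply, smul_apply, fourier_lineDeriv_apply, smul_smul]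
    rw [hF, smulLeftCLM_apply_apply hasTemperateGrowth_waveInv, ← Finset.sum_smul, ← sub_smul,
      smul_smul, ← sub_smul, ← sub_one_mul]
    simp only [← sq]
    change (waveSymbol ξ * waveInv ξ) • 𝓕 g ξ = 𝓕 g ξ
    rw [waveSymbol_mul_waveInv, one_smul]
  have e : ∀ f : 𝓢(EMink n, F), 𝓕⁻ (𝓕 f) = f := fun f => fourierInv_fourier_eq f
  rw [← e h, key, e]

end Wave

/-! #### Conjugation with the exponential of time -/

section Wave2

open MeasureTheory FourierTransform LineDeriv SchwartzMap

variable {n : ℕ} {F : Type*} [NormedAddCommGroup F] [NormedSpace ℂ F]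

/-- The function `e^t h` on Minkowski space, for a Schwartz function `h`. -/
noncomputable def expMul (h : 𝓢(EMink n, F)) (x : Mink n) : F := Real.exp (x 0) • h (toE n x)

/-- The operator `∂_ν + δ_{ν0}`, which is `∂_ν` conjugated with `e^t`. -/
noncomputable def shiftDeriv (ν : Fin (n + 1)) (h : 𝓢(EMink n, F)) : 𝓢(EMink n, F) :=
  (if ν = 0 then h else 0) + ∂_{eVec ν} h

lemma contDiff_expMul (h : 𝓢(EMink n, F)) : ContDiff ℝ ∞ (expMul h) :=
  (Real.contDiff_exp.comp (contDiff_apply ℝ ℝ 0)).smul ((h.smooth ⊤).comp (toE n).contDiff)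

lemma pd_exp (ν : Fin (n + 1)) (x : Mink n) :
    pd ν (fun y : Mink n => Real.exp (y 0)) x = if ν = 0 then Real.exp (x 0) else 0 := by
  have h := (hasFDerivAt_apply (𝕜 := ℝ) (0 : Fin (n + 1)) x).exp
  unfold pd
  rw [h.fderiv]
  simp [Pi.single_apply, eq_comm]

lemma pd_expMul (h : 𝓢(EMink n, F)) (ν : Fin (n + 1)) :
    pd ν (expMul h) = expMul (shiftDeriv ν h) := by
  funext x
  have hd : DifferentiableAt ℝ (fun y : Mink n => h (toE n y)) x :=
    ((h.smooth ⊤).comp (toE n).contDiff).differentiable (by simp) x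
  have he : DifferentiableAt ℝ (fun y : Mink n => Real.exp (y 0)) x :=
    (differentiableAt_apply 0 x).exp
  have h1 : pd ν (fun y : Mink n => h (toE n y)) x = (∂_{eVec ν} h) (toE n x) := by
    rw [SchwartzMap.lineDerivOp_apply_eq_fderiv]
    unfold pd
    rw [show (fun y => h (toE n y)) = h ∘ toE n from rfl,
      fderiv_comp _ (h.differentiable _) (toE n).differentiableAt, ContinuousLinearEquiv.fderiv]
    rfl
  have h2 := pd_smul_fun he hd ν
  rw [h1, pd_exp] at h2
  refine h2.trans ?_
  rw [expMul, shiftDeriv, add_apply, smul_add, add_comm]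
  split_ifs <;> simp

/-- For a Schwartz function `g`, the wave equation with source `e^t g` is solved by `e^t` times
`waveSolve g`. -/
lemma box_expMul [CompleteSpace F] (g : 𝓢(EMink n, F)) (x : Mink n) :
    box (expMul (waveSolve n F g)) x = expMul g x := by
  set w := waveSolve n F g with hw
  have hlin : ∀ (ν : Fin (n + 1)) (a b : 𝓢(EMink n, F)), ∂_{eVec ν} (a + b) = ∂_{eVec ν} a + ∂_{eVec ν} b :=
    fun ν a b => lineDerivOp_add (eVec ν) a b
  have h1 : ∀ ν, pd ν (pd ν (expMul w)) x = expMul (shiftDeriv ν (shiftDeriv ν w)) x := by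
    intro ν; rw [pd_expMul, pd_expMul]
  have h2 : ∑ ν : Fin (n + 1), (eta ν : ℂ) • shiftDeriv ν (shiftDeriv ν w) = g := by
    conv_rhs => rw [← waveSolve_spec g, ← hw]
    rw [Fin.sum_univ_succ, Fin.sum_univ_succ]
    have h3 : ∀ i : Fin n, shiftDeriv i.succ (shiftDeriv i.succ w) =
        ∂_{eVec i.succ} (∂_{eVec i.succ} w) := by
      intro i
      simp [shiftDeriv, Fin.succ_ne_zero]
    have h4 : shiftDeriv 0 (shiftDeriv 0 w) = w + (2 : ℂ) • ∂_{eVec (0 : Fin (n + 1))} w +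
        ∂_{eVec (0 : Fin (n + 1))} (∂_{eVec (0 : Fin (n + 1))} w) := by
      simp only [shiftDeriv, if_true, hlin]
      rw [two_smul]; abel
    simp only [h3, h4, eta_zero]
    push_cast
    module
  conv_rhs => rw [← h2]
  simp only [box, h1, expMul, sum_apply, smul_apply, Finset.smul_sum]
  refine Finset.sum_congr rfl fun ν _ => ?_
  rw [Complex.coe_smul, smul_comm]

/-- The source `e^{-t} f` as a Schwartz function. -/
noncomputable def expSource {f : Mink n → F} (hf : ContDiff ℝ ∞ f) (hc : HasCompactSupport f) :
    𝓢(EMink n, F) :=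
  have hc' : HasCompactSupport fun z : EMink n => Real.exp (-(z 0)) • f ((toE n).symm z) :=
    (hc.comp_homeomorph (toE n).symm.toHomeomorph).smul_left
  have hcoord : ContDiff ℝ ∞ fun z : EMink n => Real.exp (-(z 0)) :=
    Real.contDiff_exp.comp (EuclideanSpace.proj (0 : Fin (n + 1)) : EMink n →L[ℝ] ℝ).contDiff.neg
  hc'.toSchwartzMap (hcoord.smul (hf.comp (toE n).symm.contDiff))

lemma expSource_apply {f : Mink n → F} (hf : ContDiff ℝ ∞ f) (hc : HasCompactSupport f)
    (z : EMink n) : expSource hf hc z = Real.exp (-(z 0)) • f ((toE n).symm z) := rfl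

lemma expMul_expSource {f : Mink n → F} (hf : ContDiff ℝ ∞ f) (hc : HasCompactSupport f)
    (x : Mink n) : expMul (expSource hf hc) x = f x := by
  rw [expMul, expSource_apply, toE_apply, smul_smul, ← Real.exp_add, add_neg_cancel, Real.exp_zero,
    one_smul, ContinuousLinearEquiv.symm_apply_apply]

end Wave2

/-! ### Retarded solutions on Minkowski space -/

section MinkGreen

open MeasureTheory LineDeriv SchwartzMap Matrix

variable {n : ℕ} (γ : GammaRep n)

/-- The values of a field at a point. -/
abbrev FieldValue (n : ℕ) : Type := Fin (n + 1) → Spinor n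

/-- Multiplication of all components by a matrix, as a continuous linear map. -/
noncomputable def fieldMulVecCLM (A : SpinMatrix n) : FieldValue n →L[ℂ] FieldValue n :=
  LinearMap.toContinuousLinearMap
    (LinearMap.pi fun μ => A.mulVecLin ∘ₗ LinearMap.proj μ)

lemma fieldMulVecCLM_apply (A : SpinMatrix n) (v : FieldValue n) (μ : Fin (n + 1)) :
    fieldMulVecCLM A v μ = A *ᵥ v μ := rfl

lemma dirac_eq_sum_clm (ψ : Field n) (x : Mink n) :
    dirac γ ψ x = ∑ ν, fieldMulVecCLM (γ.gam ν) (pd ν ψ x) := by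
  funext μ
  simp [dirac, fieldMulVecCLM_apply]

/-- The retarded solution of the Dirac equation for a compactly supported source: the Dirac operator
squares to `□`, so it is applied to the solution of the wave equation. -/
noncomputable def minkGreen {f : Field n} (hf : ContDiff ℝ ∞ f) (hc : HasCompactSupport f) :
    Field n :=
  dirac γ (expMul (waveSolve n (FieldValue n) (expSource hf hc)))

variable {f : Field n} (hf : ContDiff ℝ ∞ f) (hc : HasCompactSupport f)

lemma contDiff_minkGreen : ContDiff ℝ ∞ (minkGreen γ hf hc) :=
  contDiff_dirac (contDiff_expMul _)

lemma dirac_minkGreen : dirac γ (minkGreen γ hf hc) = f := by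
  funext x
  rw [minkGreen, dirac_dirac (contDiff_expMul _), box_expMul, expMul_expSource]

lemma ip_self_le_norm {N : ℕ} (v : Fin N → ℂ) : ip v v ≤ N * ‖v‖ ^ 2 := by
  rw [ip_self_eq_sum]
  refine (Finset.sum_le_sum fun s _ => pow_le_pow_left₀ (norm_nonneg _) (norm_le_pi_norm v s) 2).trans ?_
  simp

/-- The solution decays exponentially in the past. -/
lemma minkGreen_past (μ : Fin (n + 1)) :
    ∃ a M : ℝ, ∀ y, y 0 ≤ a →
      ip (minkGreen γ hf hc y μ) (minkGreen γ hf hc y μ) ≤ M * Real.exp (y 0) := by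
  set w := waveSolve n (FieldValue n) (expSource hf hc) with hw
  set h : 𝓢(EMink n, FieldValue n) :=
    ∑ ν, postcompCLM (fieldMulVecCLM (γ.gam ν)) (shiftDeriv ν w) with hh
  have h1 : ∀ y, minkGreen γ hf hc y = Real.exp (y 0) • h (toE n y) := by
    intro y
    rw [minkGreen, ← hw, dirac_eq_sum_clm]
    simp only [pd_expMul, expMul, hh, _root_.sum_apply, postcompCLM_apply, Finset.smul_sum]
    refine Finset.sum_congr rfl fun ν _ => ?_
    exact map_smul ((fieldMulVecCLM (γ.gam ν)).restrictScalars ℝ) _ _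
  set B := SchwartzMap.seminorm ℝ 0 0 h with hB
  have h2 : ∀ z, ‖h z‖ ≤ B := fun z => norm_le_seminorm ℝ h z
  refine ⟨0, spinDim n * B ^ 2, fun y hy => ?_⟩
  have h3 : minkGreen γ hf hc y μ = Real.exp (y 0) • h (toE n y) μ := by rw [h1]; rfl
  rw [h3, ip_smul_left, ip_smul_right]
  have h4 : ip (h (toE n y) μ) (h (toE n y) μ) ≤ spinDim n * B ^ 2 := by
    refine (ip_self_le_norm _).trans ?_
    refine mul_le_mul_of_nonneg_left ?_ (by positivity)
    exact pow_le_pow_left₀ (norm_nonneg _) ((norm_le_pi_norm _ μ).trans (h2 _)) 2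
  have h5 : Real.exp (y 0) ≤ 1 := Real.exp_le_one_iff.2 hy
  have h6 := Real.exp_pos (y 0)
  have h7 := ip_self_nonneg (h (toE n y) μ)
  calc Real.exp (y 0) * (Real.exp (y 0) * ip (h (toE n y) μ) (h (toE n y) μ))
      ≤ Real.exp (y 0) * (1 * (spinDim n * B ^ 2)) := by gcongr
    _ = _ := by ring

/-- The solution vanishes at points whose past cone avoids the source. -/
lemma minkGreen_eq_zero (q : Mink n) (h0 : ∀ v ∈ futureCone n, f (q - v) = 0) :
    minkGreen γ hf hc q = 0 := by
  funext μ
  have hC := contDiff_minkGreen γ hf hc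
  refine eq_zero_of_past_cone γ (contDiff_comp_field hC μ) (minkGreen_past γ hf hc μ) q ?_
  intro v hv
  rw [← dirac_apply hC, dirac_minkGreen, h0 v hv]; rfl

end MinkGreen

/-! ### Global solutions of the Dirac equation -/

section Global

open SchwartzMap LineDeriv

variable {n : ℕ} (γ : GammaRep n)

/-- Exponential smallness in the distant past; it holds for the solutions constructed by Fourier
transform and for fields that vanish at early times. -/
def PastSmall (ψ : Field n) : Prop :=
  ∃ a M : ℝ, ∀ μ y, y 0 ≤ a → ip (ψ y μ) (ψ y μ) ≤ M * Real.exp (y 0)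

lemma pastSmall_minkGreen {f : Field n} (hf : ContDiff ℝ ∞ f) (hc : HasCompactSupport f) :
    PastSmall (minkGreen γ hf hc) := by
  choose a M h using minkGreen_past γ hf hc
  obtain ⟨a', ha'⟩ := (Set.finite_range a).bddBelow
  obtain ⟨M', hM'⟩ := (Set.finite_range M).bddAbove
  refine ⟨a', M', fun μ y hy => (h μ y (hy.trans (ha' ⟨μ, rfl⟩))).trans ?_⟩
  exact mul_le_mul_of_nonneg_right (hM' ⟨μ, rfl⟩) (Real.exp_pos _).le

lemma pastSmall_of_eq_zero {ψ : Field n} {a : ℝ} (h : ∀ y, y 0 < a → ψ y = 0) : PastSmall ψ :=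
  ⟨a - 1, 0, fun μ y hy => by rw [h y (by linarith)]; simp⟩

lemma PastSmall.sub {ψ φ : Field n} (hψ : PastSmall ψ) (hφ : PastSmall φ) : PastSmall (ψ - φ) := by
  obtain ⟨a, M, h⟩ := hψ
  obtain ⟨a', M', h'⟩ := hφ
  refine ⟨min a a', 2 * M + 2 * M', fun μ y hy => ?_⟩
  have h1 := h μ y (hy.trans (min_le_left _ _))
  have h2 := h' μ y (hy.trans (min_le_right _ _))
  have h3 := ip_self_nonneg (ψ y μ + φ y μ)
  rw [ip_add_left, ip_add_right, ip_add_right] at h3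
  rw [Pi.sub_apply, Pi.sub_apply, ip_sub_left, ip_sub_right, ip_sub_right]
  linarith

lemma dirac_sub {ψ φ : Field n} (hψ : ContDiff ℝ ∞ ψ) (hφ : ContDiff ℝ ∞ φ) (x : Mink n) :
    dirac γ (ψ - φ) x = dirac γ ψ x - dirac γ φ x := by
  funext μ
  have hs : ContDiff ℝ ∞ (ψ - φ) := hψ.sub hφ
  rw [dirac_apply hs, Pi.sub_apply, dirac_apply hψ, dirac_apply hφ]
  exact slash_sub γ (contDiff_comp_field hψ μ) (contDiff_comp_field hφ μ) x

/-- Two fields with the same source in the past cone of a point agree at that point. -/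
lemma eq_of_dirac_eq_past {ψ φ : Field n} (hψ : ContDiff ℝ ∞ ψ) (hφ : ContDiff ℝ ∞ φ)
    (hψp : PastSmall ψ) (hφp : PastSmall φ) (q : Mink n)
    (h : ∀ v ∈ futureCone n, dirac γ ψ (q - v) = dirac γ φ (q - v)) : ψ q = φ q := by
  rw [← sub_eq_zero]
  funext μ
  obtain ⟨a, M, ham⟩ := hψp.sub hφp
  have hs : ContDiff ℝ ∞ (ψ - φ) := hψ.sub hφ
  refine eq_zero_of_past_cone γ (contDiff_comp_field hs μ) ⟨a, M, ham μ⟩ q fun v hv => ?_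
  rw [← dirac_apply hs, dirac_sub γ hψ hφ, h v hv, sub_self]; rfl

/-- A smooth cutoff function that equals one on the ball of radius `r + 1`. -/
noncomputable def cutoff (n : ℕ) (r : ℕ) : ContDiffBump (0 : Mink n) :=
  ⟨r + 1, r + 2, by positivity, by linarith⟩

lemma cutoff_eq_one {r : ℕ} {x : Mink n} (hx : ‖x‖ ≤ r) : cutoff n r x = 1 :=
  (cutoff n r).one_of_mem_closedBall (by
    rw [mem_closedBall_zero_iff]
    exact hx.trans (by simp [cutoff]))

lemma contDiff_cutoff_smul {f : Field n} (hf : ContDiff ℝ ∞ f) (r : ℕ) :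
    ContDiff ℝ ∞ fun x => cutoff n r x • f x :=
  (cutoff n r).contDiff.smul hf

lemma hasCompactSupport_cutoff_smul (f : Field n) (r : ℕ) :
    HasCompactSupport fun x => cutoff n r x • f x :=
  (cutoff n r).hasCompactSupport.smul_right

/-- The solution for the source cut off at radius `r`. -/
noncomputable def localGreen {f : Field n} (hf : ContDiff ℝ ∞ f) (r : ℕ) : Field n :=
  minkGreen γ (contDiff_cutoff_smul hf r) (hasCompactSupport_cutoff_smul f r)

lemma cutoff_smul_past {f : Field n} {a : ℝ} (ha : ∀ y, y 0 < a → f y = 0) {r : ℕ} {q : Mink n}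
    (hq : 2 * ‖q‖ + |a| ≤ r) {v : Mink n} (hv : v ∈ futureCone n) :
    cutoff n r (q - v) • f (q - v) = f (q - v) := by
  by_cases h : (q - v) 0 < a
  · rw [ha _ h, smul_zero]
  · have h1 : v 0 ≤ ‖q‖ + |a| := by
      have h2 := (le_abs_self (q 0)).trans (norm_le_pi_norm q 0)
      have h3 := neg_abs_le a
      rw [Pi.sub_apply] at h
      linarith
    rw [cutoff_eq_one, one_smul]
    have := (norm_sub_le q v).trans (add_le_add_right (norm_le_of_mem_futureCone hv) ‖q‖)
    linarith

/-- Near a point only the part of the source in the past cone matters, and for a source vanishing at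
early times this part lies in a bounded region; the radius of the cutoff is then immaterial. -/
lemma eq_localGreen {f ψ : Field n} (hf : ContDiff ℝ ∞ f) {a : ℝ} (ha : ∀ y, y 0 < a → f y = 0)
    (hψ : ContDiff ℝ ∞ ψ) (hψp : PastSmall ψ) {r : ℕ} {q : Mink n} (hq : 2 * ‖q‖ + |a| ≤ r)
    (h : ∀ v ∈ futureCone n, dirac γ ψ (q - v) = f (q - v)) : ψ q = localGreen γ hf r q := by
  refine eq_of_dirac_eq_past γ hψ (contDiff_minkGreen γ _ _) hψp (pastSmall_minkGreen γ _ _) q ?_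
  intro v hv
  rw [h v hv, dirac_minkGreen, cutoff_smul_past ha hq hv]

/-- Existence of retarded solutions of the Dirac equation for past-compact sources. -/
lemma exists_retarded {f : Field n} (hf : ContDiff ℝ ∞ f) {a : ℝ} (ha : ∀ y, y 0 < a → f y = 0) :
    ∃ ψ : Field n, ContDiff ℝ ∞ ψ ∧ dirac γ ψ = f ∧
      ∀ q, (∀ v ∈ futureCone n, f (q - v) = 0) → ψ q = 0 := by
  -- the cutoff radius depends on the point, but near each point one radius serves for all
  set N : Mink n → ℕ := fun q => ⌈2 * ‖q‖ + |a|⌉₊ with hN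
  set ψ : Field n := fun q => localGreen γ hf (N q) q with hψ
  have hloc : ∀ q : Mink n, ψ =ᶠ[nhds q] localGreen γ hf ⌈2 * (‖q‖ + 1) + |a|⌉₊ := by
    intro q
    filter_upwards [Metric.ball_mem_nhds q one_pos] with y hy
    have hy2 : 2 * ‖y‖ + |a| ≤ (⌈2 * (‖q‖ + 1) + |a|⌉₊ : ℝ) := by
      refine le_trans ?_ (Nat.le_ceil _)
      have h1 : ‖y - q‖ < 1 := mem_ball_iff_norm.1 hy
      have h2 := norm_add_le (y - q) q
      rw [sub_add_cancel] at h2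
      linarith
    refine eq_localGreen γ hf ha (contDiff_minkGreen γ _ _) (pastSmall_minkGreen γ _ _) hy2 ?_
    intro v hv
    rw [dirac_minkGreen, cutoff_smul_past ha (Nat.le_ceil _) hv]
  refine ⟨ψ, ?_, ?_, ?_⟩
  · rw [contDiff_iff_contDiffAt]
    intro q
    exact (contDiff_minkGreen γ _ _).contDiffAt.congr_of_eventuallyEq (hloc q)
  · funext q
    have h1 : dirac γ ψ q = dirac γ (localGreen γ hf ⌈2 * (‖q‖ + 1) + |a|⌉₊) q := by
      funext μ
      simp only [dirac, pd_eq_of_eventuallyEq (hloc q)]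
    rw [h1, localGreen, dirac_minkGreen, cutoff_eq_one, one_smul]
    refine le_trans ?_ (Nat.le_ceil _)
    linarith [norm_nonneg q, abs_nonneg a]
  · intro q hq
    refine minkGreen_eq_zero γ _ _ q fun v hv => ?_
    rw [hq v hv, smul_zero]

/-! #### Continuity of the solution in its source -/

lemma norm_iteratedFDeriv_comp_clm_le {D E F : Type*} [NormedAddCommGroup D] [NormedSpace ℝ D]
    [NormedAddCommGroup E] [NormedSpace ℝ E] [NormedAddCommGroup F] [NormedSpace ℝ F]
    (L : D →L[ℝ] E) {f : E → F} (hf : ContDiff ℝ ∞ f) (j : ℕ) (x : D) :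
    ‖iteratedFDeriv ℝ j (f ∘ L) x‖ ≤ ‖iteratedFDeriv ℝ j f (L x)‖ * ‖L‖ ^ j := by
  rw [L.iteratedFDeriv_comp_right hf x (i := j) (WithTop.coe_le_coe.2 le_top)]
  refine (ContinuousMultilinearMap.norm_compContinuousLinearMap_le _ _).trans ?_
  simp

/-- Schwartz seminorms of the source are controlled by derivatives of `f`. -/
lemma seminorm_expSource_le (r k l : ℕ) :
    ∃ C : ℝ, 0 ≤ C ∧ ∀ (f : Field n) (hf : ContDiff ℝ ∞ f) (b : ℝ),
      (∀ j ≤ l, ∀ x, ‖iteratedFDeriv ℝ j f x‖ ≤ b) →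
      SchwartzMap.seminorm ℂ k l
        (expSource (contDiff_cutoff_smul hf r) (hasCompactSupport_cutoff_smul f r)) ≤ C * b := by
  set A : Mink n →L[ℝ] EMink n := (toE n : Mink n →L[ℝ] EMink n)
  set A' : EMink n →L[ℝ] Mink n := ((toE n).symm : EMink n →L[ℝ] Mink n) with hA'
  have hcs : HasCompactSupport fun z : EMink n => Real.exp (-(z 0)) * cutoff n r ((toE n).symm z) :=
    ((cutoff n r).hasCompactSupport.comp_homeomorph (toE n).symm.toHomeomorph).mul_left
  have hexp : ContDiff ℝ ∞ fun z : EMink n => Real.exp (-(z 0)) :=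
    Real.contDiff_exp.comp (EuclideanSpace.proj (0 : Fin (n + 1)) : EMink n →L[ℝ] ℝ).contDiff.neg
  have hcut : ContDiff ℝ ∞ fun z : EMink n => cutoff n r ((toE n).symm z) :=
    (cutoff n r).contDiff.comp (toE n).symm.contDiff
  set θ : 𝓢(EMink n, ℝ) := hcs.toSchwartzMap (hexp.mul hcut) with hθ
  have hθa : ∀ z, θ z = Real.exp (-(z 0)) * cutoff n r ((toE n).symm z) := fun z => rfl
  refine ⟨∑ i ∈ Finset.range (l + 1), (l.choose i : ℝ) * SchwartzMap.seminorm ℝ k i θ *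
    ‖A'‖ ^ (l - i), by positivity, fun f hf b hb => ?_⟩
  have hb0 : 0 ≤ b := (norm_nonneg _).trans (hb 0 (Nat.zero_le _) 0)
  refine seminorm_le_bound ℂ k l _ (by positivity) fun z => ?_
  have heq : ((expSource (contDiff_cutoff_smul hf r) (hasCompactSupport_cutoff_smul f r) :
      𝓢(EMink n, FieldValue n)) : EMink n → FieldValue n) = fun z => θ z • (f ∘ A') z := by
    funext z
    rw [expSource_apply, hθa, smul_smul]; rfl
  rw [heq]
  have hle : ((l : ℕ) : WithTop ℕ∞) ≤ ∞ := WithTop.coe_le_coe.2 le_top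
  have h1 := norm_iteratedFDeriv_smul_le (N := ∞) (θ.smooth ⊤) (hf.comp A'.contDiff) z hle
  calc ‖z‖ ^ k * ‖iteratedFDeriv ℝ l (fun z => θ z • (f ∘ A') z) z‖
      ≤ ‖z‖ ^ k * ∑ i ∈ Finset.range (l + 1), (l.choose i : ℝ) * ‖iteratedFDeriv ℝ i θ z‖ *
          ‖iteratedFDeriv ℝ (l - i) (f ∘ A') z‖ := by gcongr
    _ = ∑ i ∈ Finset.range (l + 1), (l.choose i : ℝ) * (‖z‖ ^ k * ‖iteratedFDeriv ℝ i θ z‖) *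
          ‖iteratedFDeriv ℝ (l - i) (f ∘ A') z‖ := by
        rw [Finset.mul_sum]; exact Finset.sum_congr rfl fun _ _ => by ring
    _ ≤ ∑ i ∈ Finset.range (l + 1), (l.choose i : ℝ) * SchwartzMap.seminorm ℝ k i θ *
          (b * ‖A'‖ ^ (l - i)) := by
        refine Finset.sum_le_sum fun i _ => ?_
        gcongr
        · exact le_seminorm ℝ k i θ z
        · refine (norm_iteratedFDeriv_comp_clm_le A' hf _ z).trans ?_
          gcongr
          exact hb _ (Nat.sub_le _ _) _
    _ = _ := by
        rw [Finset.sum_mul]; exact Finset.sum_congr rfl fun _ _ => by ring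

/-- The solution operator on the ball of radius `s` as a continuous operator on Schwartz functions:
the unbounded factor `e^t` is cut off outside the ball before the Dirac operator is applied. -/
noncomputable def localSolve (s : ℕ) : 𝓢(EMink n, FieldValue n) →L[ℂ] 𝓢(EMink n, FieldValue n) :=
  ∑ ν : Fin (n + 1), (postcompCLM (fieldMulVecCLM (γ.gam ν))) ∘L
    (lineDerivOpCLM ℂ 𝓢(EMink n, FieldValue n) (eVec ν)) ∘L
    (smulLeftCLM (FieldValue n)
      (fun z : EMink n => ((Real.exp (z 0) * cutoff n s ((toE n).symm z) : ℝ) : ℂ))) ∘L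
    (waveSolve n (FieldValue n))

lemma hasTemperateGrowth_expCutoff (s : ℕ) :
    (fun z : EMink n => ((Real.exp (z 0) * cutoff n s ((toE n).symm z) : ℝ) : ℂ)).HasTemperateGrowth := by
  refine HasCompactSupport.hasTemperateGrowth ?_ ?_
  · have h := ((cutoff n s).hasCompactSupport.comp_homeomorph (toE n).symm.toHomeomorph).mul_left
      (f := fun z : EMink n => Real.exp (z 0))
    exact h.comp_left (g := fun t : ℝ => (t : ℂ)) Complex.ofReal_zero
  · refine Complex.ofRealCLM.contDiff.comp (ContDiff.mul ?_ ?_)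
    · exact Real.contDiff_exp.comp (EuclideanSpace.proj (0 : Fin (n + 1)) : EMink n →L[ℝ] ℝ).contDiff
    · exact (cutoff n s).contDiff.comp (toE n).symm.contDiff

lemma minkGreen_eq_localSolve {f : Field n} (hf : ContDiff ℝ ∞ f) (hc : HasCompactSupport f)
    {s : ℕ} {x : Mink n} (hx : ‖x‖ < s) :
    minkGreen γ hf hc x = localSolve γ s (expSource hf hc) (toE n x) := by
  set w := waveSolve n (FieldValue n) (expSource hf hc) with hw
  set v : 𝓢(EMink n, FieldValue n) := smulLeftCLM (FieldValue n)
    (fun z : EMink n => ((Real.exp (z 0) * cutoff n s ((toE n).symm z) : ℝ) : ℂ)) w with hv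
  have h1 : expMul w =ᶠ[nhds x] fun y => v (toE n y) := by
    have hball : {y : Mink n | ‖y‖ < s} ∈ nhds x :=
      (isOpen_lt continuous_norm continuous_const).mem_nhds hx
    filter_upwards [hball] with y hy
    have hy' : ‖y‖ ≤ s := le_of_lt hy
    rw [hv, smulLeftCLM_apply_apply (hasTemperateGrowth_expCutoff s), expMul, toE_apply,
      ContinuousLinearEquiv.symm_apply_apply, cutoff_eq_one hy', mul_one, Complex.coe_smul]
  have h2 : ∀ ν, pd ν (expMul w) x = (∂_{eVec ν} v) (toE n x) := by
    intro ν
    rw [pd_eq_of_eventuallyEq h1, SchwartzMap.lineDerivOp_apply_eq_fderiv]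
    unfold pd
    rw [show (fun y => v (toE n y)) = v ∘ toE n from rfl,
      fderiv_comp _ (v.differentiable _) (toE n).differentiableAt, ContinuousLinearEquiv.fderiv]
    rfl
  rw [minkGreen, ← hw, dirac_eq_sum_clm]
  simp only [h2, localSolve, _root_.sum_apply, ContinuousLinearMap.comp_apply,
    postcompCLM_apply]
  rfl

lemma exists_seminorm_le {E F : Type*} [NormedAddCommGroup E] [NormedSpace ℝ E]
    [NormedAddCommGroup F] [NormedSpace ℂ F] (U : 𝓢(E, F) →L[ℂ] 𝓢(E, F)) (j : ℕ) :
    ∃ (S : Finset (ℕ × ℕ)) (C : ℝ), 0 ≤ C ∧ ∀ (h : 𝓢(E, F)) (B : ℝ), 0 ≤ B →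
      (∀ p ∈ S, SchwartzMap.seminorm ℂ p.1 p.2 h ≤ B) → SchwartzMap.seminorm ℂ 0 j (U h) ≤ C * B := by
  have hq : Continuous ((SchwartzMap.seminorm ℂ 0 j).comp (U : 𝓢(E, F) →ₗ[ℂ] 𝓢(E, F))) :=
    ((schwartz_withSeminorms ℂ E F).continuous_seminorm (0, j)).comp U.continuous
  obtain ⟨S, C, _, hC⟩ := Seminorm.bound_of_continuous (schwartz_withSeminorms ℂ E F) _ hq
  refine ⟨S, C, C.2, fun h B hB hS => (hC h).trans ?_⟩
  exact mul_le_mul_of_nonneg_left (Seminorm.finset_sup_apply_le hB hS) C.2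

lemma exists_seminorm_localSolve_le (s r j : ℕ) :
    ∃ (l : ℕ) (C : ℝ), 0 ≤ C ∧ ∀ (f : Field n) (hf : ContDiff ℝ ∞ f) (b : ℝ),
      (∀ i ≤ l, ∀ x, ‖iteratedFDeriv ℝ i f x‖ ≤ b) → SchwartzMap.seminorm ℂ 0 j (localSolve γ s
        (expSource (contDiff_cutoff_smul hf r) (hasCompactSupport_cutoff_smul f r))) ≤ C * b := by
  obtain ⟨S, C, hC0, hC⟩ := exists_seminorm_le (localSolve γ s) j
  choose B hB0 hB using fun p : ℕ × ℕ => seminorm_expSource_le (n := n) r p.1 p.2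
  have hsum : 0 ≤ ∑ p ∈ S, B p := Finset.sum_nonneg fun p _ => hB0 p
  refine ⟨S.sup Prod.snd, C * ∑ p ∈ S, B p, mul_nonneg hC0 hsum, fun f hf b hb => ?_⟩
  have hb0 : 0 ≤ b := (norm_nonneg _).trans (hb 0 (Nat.zero_le _) 0)
  rw [mul_assoc]
  refine hC _ _ (mul_nonneg hsum hb0) fun p hp => ?_
  refine (hB p f hf b fun i hi => hb i (hi.trans (Finset.le_sup (f := Prod.snd) hp))).trans ?_
  exact mul_le_mul_of_nonneg_right (Finset.single_le_sum (f := B) (fun p _ => hB0 p) hp) hb0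

/-- Derivatives of a retarded solution over a compact set are controlled by finitely many
derivatives of its source. -/
lemma exists_bound_retarded (a : ℝ) {L : Set (Mink n)} (hL : IsCompact L) (j : ℕ) :
    ∃ (l : ℕ) (c : ℝ), 0 ≤ c ∧ ∀ (f ψ : Field n) (b : ℝ), ContDiff ℝ ∞ f → ContDiff ℝ ∞ ψ →
      dirac γ ψ = f → (∀ y, y 0 < a → f y = 0) → (∀ y, y 0 < a → ψ y = 0) →
      (∀ i ≤ l, ∀ x, ‖iteratedFDeriv ℝ i f x‖ ≤ b) →
      ∀ x ∈ L, ‖iteratedFDeriv ℝ j ψ x‖ ≤ c * b := by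
  obtain ⟨R, hR⟩ := hL.isBounded.exists_norm_le
  obtain ⟨s, hs⟩ := exists_nat_gt R
  obtain ⟨r, hr⟩ := exists_nat_ge (2 * (s : ℝ) + |a|)
  obtain ⟨l, C, hC0, hC⟩ := exists_seminorm_localSolve_le γ s r j
  set A : Mink n →L[ℝ] EMink n := (toE n : Mink n →L[ℝ] EMink n) with hA
  refine ⟨l, C * ‖A‖ ^ j, by positivity, ?_⟩
  intro f ψ b hf hψ hdψ hfa hψa hb x hx
  have hxs : ‖x‖ < s := (hR x hx).trans_lt hs
  set h := localSolve γ s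
    (expSource (contDiff_cutoff_smul hf r) (hasCompactSupport_cutoff_smul f r)) with hh
  have heq : ψ =ᶠ[nhds x] h ∘ A := by
    have hball : {y : Mink n | ‖y‖ < s} ∈ nhds x :=
      (isOpen_lt continuous_norm continuous_const).mem_nhds hxs
    filter_upwards [hball] with y hy
    have hy' : ‖y‖ < s := hy
    have h1 := eq_localGreen γ hf hfa hψ (pastSmall_of_eq_zero hψa) (r := r) (q := y)
      (by linarith) (fun v _ => by rw [hdψ])
    rw [h1, localGreen, minkGreen_eq_localSolve γ _ _ hy']
    rfl
  have h2 : iteratedFDeriv ℝ j ψ x = iteratedFDeriv ℝ j (h ∘ A) x := (heq.iteratedFDeriv ℝ j).eq_of_nhds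
  have h3 := norm_iteratedFDeriv_comp_clm_le A (h.smooth ⊤) j x
  have h4 := (norm_iteratedFDeriv_le_seminorm ℂ h j (A x)).trans (hC f hf b hb)
  rw [h2]
  calc ‖iteratedFDeriv ℝ j (h ∘ A) x‖ ≤ ‖iteratedFDeriv ℝ j h (A x)‖ * ‖A‖ ^ j := h3
    _ ≤ (C * b) * ‖A‖ ^ j := mul_le_mul_of_nonneg_right h4 (by positivity)
    _ = _ := by ring

end Global

/-! ### Spin structures and their signs -/

section Schur

/-- On a nonzero space which carries `2 m` anticommuting involutions the dimension is at least
`2 ^ m`: each pair of involutions splits the space into two isomorphic eigenspaces of the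
involution `i e e'`, which are invariant under the remaining ones. -/
lemma two_pow_le_finrank_of_anticommute {V : Type*} [AddCommGroup V] [Module ℂ V]
    [FiniteDimensional ℂ V] (e : ℕ → V →ₗ[ℂ] V) (m : ℕ)
    (hsq : ∀ a < 2 * m, ∀ v, e a (e a v) = v)
    (hanti : ∀ a < 2 * m, ∀ b < 2 * m, a ≠ b → ∀ v, e a (e b v) = -e b (e a v))
    (W : Submodule ℂ V) (hW : W ≠ ⊥) (hinv : ∀ a < 2 * m, ∀ v ∈ W, e a v ∈ W) :
    2 ^ m ≤ Module.finrank ℂ W := by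
  induction m generalizing W with
  | zero =>
    rw [pow_zero, Nat.one_le_iff_ne_zero]
    intro h
    exact hW (Submodule.finrank_eq_zero.mp h)
  | succ m ih =>
    set p := e (2 * m) with hp
    set q := e (2 * m + 1) with hq
    have hpp : ∀ v, p (p v) = v := hsq _ (by omega)
    have hqq : ∀ v, q (q v) = v := hsq _ (by omega)
    have hpq : ∀ v, q (p v) = -p (q v) := hanti _ (by omega) _ (by omega) (by omega)
    have hpW : ∀ v ∈ W, p v ∈ W := hinv _ (by omega)
    have hqW : ∀ v ∈ W, q v ∈ W := hinv _ (by omega)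
    set J : V →ₗ[ℂ] V := Complex.I • (p ∘ₗ q) with hJ
    have hJv : ∀ v, J v = Complex.I • p (q v) := fun v => rfl
    have hJJ : ∀ v, J (J v) = v := by
      intro v
      rw [hJv, hJv, map_smul, map_smul, hpq, smul_smul, Complex.I_mul_I, map_neg, hqq, hpp]
      simp
    have hJp : ∀ v, J (p v) = -p (J v) := by
      intro v
      rw [hJv, hJv, hpq, map_smul, map_neg, smul_neg]
    have hJa : ∀ a < 2 * m, ∀ v, J (e a v) = e a (J v) := by
      intro a ha v
      rw [hJv, hJv, map_smul, hanti (2 * m + 1) (by omega) a (by omega) (by omega), map_neg,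
        hanti (2 * m) (by omega) a (by omega) (by omega), neg_neg]
    have hJW : ∀ v ∈ W, J v ∈ W := fun v hv => W.smul_mem _ (hpW _ (hqW _ hv))
    -- the `+1` eigenspace of `J` in `W`, which `p` maps to the `-1` eigenspace
    let W' : Submodule ℂ V := W ⊓ LinearMap.ker (J - LinearMap.id)
    have hmem : ∀ v, v ∈ W' ↔ v ∈ W ∧ J v = v := by
      intro v
      simp [W', LinearMap.mem_ker, sub_eq_zero]
    have hW' : W' ≠ ⊥ := by
      obtain ⟨w, hw, hw0⟩ := W.exists_mem_ne_zero_of_ne_bot hW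
      rw [Submodule.ne_bot_iff]
      by_cases h : w + J w = 0
      · have h' : J w = -w := (neg_eq_of_add_eq_zero_right h).symm
        refine ⟨p w, (hmem _).mpr ⟨hpW _ hw, ?_⟩, fun h0 => hw0 ?_⟩
        · rw [hJp, h', map_neg, neg_neg]
        · rw [← hpp w, h0, map_zero]
      · exact ⟨w + J w, (hmem _).mpr ⟨W.add_mem hw (hJW _ hw), by rw [map_add, hJJ, add_comm]⟩, h⟩
    have h1 := ih (fun a ha => hsq a (by omega))
      (fun a ha b hb => hanti a (by omega) b (by omega)) W' hW' (fun a ha v hv => by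
        rw [hmem] at hv ⊢
        exact ⟨hinv a (by omega) v hv.1, by rw [hJa a ha, hv.2]⟩)
    have hinj : Function.Injective p := fun v w h => by rw [← hpp v, h, hpp]
    have h2 : Module.finrank ℂ (W'.map p) = Module.finrank ℂ W' :=
      (Submodule.equivMapOfInjective p hinj W').finrank_eq.symm
    have hdisj : W' ⊓ W'.map p = ⊥ := by
      rw [eq_bot_iff]
      rintro v ⟨hv, hv'⟩
      obtain ⟨w, hw, rfl⟩ := hv'
      have hw2 := ((hmem _).mp hw).2
      have hv2 := ((hmem _).mp hv).2
      rw [hJp, hw2] at hv2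
      have : (2 : ℂ) • p w = 0 := by
        rw [two_smul]; nth_rewrite 1 [← hv2]; simp
      simpa using this
    have h3 := Submodule.finrank_sup_add_finrank_inf_eq W' (W'.map p)
    rw [hdisj, finrank_bot, add_zero, h2] at h3
    have h4 : W' ⊔ W'.map p ≤ W := by
      refine sup_le inf_le_left ?_
      rintro _ ⟨v, hv, rfl⟩
      exact hpW _ ((hmem _).mp hv).1
    have h5 := Submodule.finrank_mono h4
    rw [pow_succ]; omega

variable {n : ℕ} (γ : GammaRep n)

open Matrix

/-- Schur's lemma for the gamma matrices: an eigenspace of `S` is invariant under them, and by the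
dimension count it is the whole space. -/
lemma exists_eq_smul_one_of_commute (S : SpinMatrix n)
    (hS : ∀ a, γ.gam a * S = S * γ.gam a) : ∃ c : ℂ, S = c • (1 : SpinMatrix n) := by
  have : NeZero (spinDim n) := ⟨by unfold spinDim; positivity⟩
  obtain ⟨c, hc⟩ := Module.End.exists_eigenvalue (Matrix.toLin' S)
  refine ⟨c, ?_⟩
  -- `γ⁰` squares to `-1` and is replaced by `i γ⁰`
  let e : ℕ → Spinor n →ₗ[ℂ] Spinor n := fun a =>
    (if a = 0 then Complex.I else 1) • Matrix.toLin' (γ.gam (Fin.ofNat (n + 1) a))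
  have he : ∀ a v, e a v = (if a = 0 then Complex.I else 1) •
      (γ.gam (Fin.ofNat (n + 1) a)).mulVec v := fun a v => by
    simp only [e, LinearMap.smul_apply, Matrix.toLin'_apply]
  have hle : 2 * ((n + 1) / 2) ≤ n + 1 := Nat.mul_div_le _ _
  have hval : ∀ a < 2 * ((n + 1) / 2), ((Fin.ofNat (n + 1) a : Fin (n + 1)) : ℕ) = a := by
    intro a ha
    simp only [Fin.ofNat]
    exact Nat.mod_eq_of_lt (by omega)
  have key := two_pow_le_finrank_of_anticommute e ((n + 1) / 2) ?_ ?_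
    (Module.End.eigenspace (Matrix.toLin' S) c) hc ?_
  · have htop : Module.End.eigenspace (Matrix.toLin' S) c = ⊤ := by
      apply Submodule.eq_top_of_finrank_eq
      refine le_antisymm (Submodule.finrank_le _) ?_
      rw [Module.finrank_fin_fun]
      exact key
    apply Matrix.toLin'.injective
    ext1 i
    ext1
    have : Pi.single i (1 : ℂ) ∈ Module.End.eigenspace (Matrix.toLin' S) c := htop ▸ trivial
    rw [Module.End.mem_eigenspace_iff] at this
    simpa using this
  · intro a ha v
    have hsq := γ.sq_apply (Fin.ofNat (n + 1) a) v
    have h0 : Fin.ofNat (n + 1) a = 0 ↔ a = 0 := by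
      rw [Fin.ext_iff, hval a ha]; rfl
    rw [he, he, mulVec_smul, smul_smul, hsq]
    by_cases h : a = 0
    · simp only [h, if_true, Complex.I_mul_I]
      simp [eta]
    · have : eta (Fin.ofNat (n + 1) a) = 1 := by
        rw [eta, if_neg (fun hh => h (h0.mp hh))]
      rw [this]; simp [h]
  · intro a ha b hb hab v
    have hne : Fin.ofNat (n + 1) a ≠ Fin.ofNat (n + 1) b := by
      rw [Ne, Fin.ext_iff, hval a ha, hval b hb]; exact hab
    have hh := γ.anticomm_apply hne v
    rw [he, he, he, he, mulVec_smul, mulVec_smul, smul_smul, smul_smul, hh, smul_neg, mul_comm]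
  · intro a ha v hv
    rw [Module.End.mem_eigenspace_iff] at hv ⊢
    rw [Matrix.toLin'_apply] at hv ⊢
    rw [he, mulVec_smul, mulVec_mulVec, ← hS, ← mulVec_mulVec, hv, mulVec_smul, smul_comm]

/-- The kernel of the covering is `{±1}`: an element over the identity is a scalar `c` by Schur's
lemma, and the invariance of `C` forces `c ^ 2 = 1`. -/
lemma eq_one_or_eq_neg_one_of_mem_spinGroup
    {g : Matrix.GeneralLinearGroup (Fin (spinDim n)) ℂ ×
      Matrix.GeneralLinearGroup (Fin (n + 1)) ℝ} (hg : g ∈ spinGroup γ) (h1 : g.2 = 1) :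
    g.1.1 = 1 ∨ g.1.1 = -1 := by
  have : NeZero (spinDim n) := ⟨by unfold spinDim; positivity⟩
  obtain ⟨-, h2, h3, -⟩ := hg
  obtain ⟨c, hc⟩ := exists_eq_smul_one_of_commute γ g.1.1 (fun a => by
    rw [h2 a, h1]
    simp [Matrix.one_apply, Finset.sum_ite_eq])
  rw [hc] at h3 ⊢
  have hC : γ.C ≠ 0 := by
    intro h
    have := γ.C_unitary
    rw [h] at this
    simp at this
  have h4 : (c * c - 1) • γ.C = 0 := by
    rw [sub_smul, one_smul, sub_eq_zero]
    simpa [smul_smul] using h3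
  have h5 : c * c = 1 := by
    rcases smul_eq_zero.mp h4 with h | h
    · exact sub_eq_zero.mp h
    · exact absurd h hC
  rcases mul_self_eq_one_iff.mp h5 with rfl | rfl
  · left; simp
  · right; simp

end Schur

section SpinStructures

variable {n : ℕ} {γ : GammaRep n}

variable (γ) in
/-- The kernel `{±1}` of the covering of the restricted Lorentz group by the spin group. -/
noncomputable def signElt (ε : ℤˣ) : spinGroup γ :=
  ⟨(Units.map (Int.castRingHom (SpinMatrix n)).toMonoidHom ε, 1), by
    refine ⟨one_mem _, fun a => ?_, ?_, fun χ => ?_⟩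
    · rcases Int.units_eq_one_or ε with rfl | rfl <;>
      simp [Matrix.one_apply, Finset.sum_ite_eq]
    · rcases Int.units_eq_one_or ε with rfl | rfl <;> simp
    · rcases Int.units_eq_one_or ε with rfl | rfl <;>
      simp [GammaRep.chargeConj, Matrix.neg_mulVec, Matrix.mulVec_neg]⟩

lemma signElt_val (ε : ℤˣ) : (signElt γ ε).1.1.1 = ((ε : ℤ) : SpinMatrix n) := rfl

lemma signElt_mul (ε δ : ℤˣ) : signElt γ (ε * δ) = signElt γ ε * signElt γ δ := by
  apply Subtype.ext
  simp [signElt]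

lemma signElt_one : signElt γ 1 = 1 := by
  apply Subtype.ext
  simp [signElt]

lemma signElt_injective : Function.Injective (signElt γ) := by
  have : NeZero (spinDim n) := ⟨by unfold spinDim; positivity⟩
  intro ε δ h
  have h1 : ((ε : ℤ) : SpinMatrix n) = ((δ : ℤ) : SpinMatrix n) := by
    rw [← signElt_val, ← signElt_val, h]
  have h2 := congrArg Complex.re (congrFun (congrFun h1 0) 0)
  rcases Int.units_eq_one_or ε with rfl | rfl <;> rcases Int.units_eq_one_or δ with rfl | rfl
  · rfl
  · norm_num at h2
  · norm_num at h2
  · rfl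

lemma exists_signElt_eq {s : spinGroup γ} (hs : s.1.2 = 1) : ∃ ε, s = signElt γ ε := by
  rcases eq_one_or_eq_neg_one_of_mem_spinGroup γ s.2 hs with h | h
  · exact ⟨1, Subtype.ext (Prod.ext (Units.ext (by rw [h, signElt_val]; simp)) hs)⟩
  · exact ⟨-1, Subtype.ext (Prod.ext (Units.ext (by rw [h, signElt_val]; simp)) hs)⟩

/-- A continuous equivariant map over the frame bundle acts on the fibres by a constant sign. -/
lemma exists_sign_of_equivariant {F : Mink n × spinGroup γ → Mink n × spinGroup γ}
    (hF : Continuous F) (hequiv : ∀ x s g, (F (x, s * g)).2 = (F (x, s)).2 * g)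
    (hcov : ∀ x s, (F (x, s)).2.1.2 = s.1.2) :
    ∃ ε, ∀ x s, (F (x, s)).2 = signElt γ ε * s := by
  let f : Mink n → SpinMatrix n := fun x => (F (x, 1)).2.1.1.1
  have hf : Continuous f :=
    Units.continuous_val.comp (continuous_fst.comp (continuous_subtype_val.comp
      (continuous_snd.comp (hF.comp (continuous_id.prodMk continuous_const)))))
  have hrange : Set.MapsTo f Set.univ
      (Set.range fun ε : ℤˣ => (signElt γ ε).1.1.1) := by
    intro x _
    obtain ⟨ε, hε⟩ := exists_signElt_eq (s := (F (x, 1)).2) (by rw [hcov]; rfl)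
    exact ⟨ε, by simp only [f, hε]⟩
  have : Finite (Set.range fun ε : ℤˣ => (signElt γ ε).1.1.1) := Set.finite_range _
  obtain ⟨y, ⟨ε, rfl⟩, hy⟩ := isPreconnected_univ.eqOn_const_of_mapsTo (Set.toFinite _).isDiscrete
    hf.continuousOn hrange
    (Set.range_nonempty _)
  refine ⟨ε, fun x s => ?_⟩
  have h1 : (F (x, 1)).2 = signElt γ ε := by
    refine Subtype.ext (Prod.ext (Units.ext (hy (Set.mem_univ x))) ?_)
    rw [hcov]; rfl
  rw [← one_mul s, hequiv, h1, one_mul]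

lemma deck_zero (x : Mink n) : deck 0 x = x := by
  funext μ
  refine Fin.cases ?_ (fun i => ?_) μ <;> simp [deck]

lemma deck_add (k l : Fin n → ℤ) (x : Mink n) : deck (k + l) x = deck k (deck l x) := by
  funext μ
  refine Fin.cases ?_ (fun i => ?_) μ
  · simp [deck]
  · simp [deck]; ring

lemma continuous_deck (k : Fin n → ℤ) : Continuous (deck k) := by
  unfold deck
  fun_prop

namespace SpinStructure

lemma exists_sign (σ : SpinStructure γ) (k : Fin n → ℤ) :
    ∃ ε, ∀ x s, σ.lift k (x, s) = (deck k x, signElt γ ε * s) := by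
  obtain ⟨ε, hε⟩ := exists_sign_of_equivariant (σ.continuous k)
    (fun x s g => by rw [σ.equivariant]) (fun x s => (σ.covers k x s).2)
  exact ⟨ε, fun x s => Prod.ext (σ.covers k x s).1 (hε x s)⟩

/-- The sign by which the deck transformation `k` acts on the spin frames. -/
noncomputable def sign (σ : SpinStructure γ) (k : Fin n → ℤ) : ℤˣ := (σ.exists_sign k).choose

lemma lift_eq (σ : SpinStructure γ) (k : Fin n → ℤ) (x : Mink n) (s : spinGroup γ) :
    σ.lift k (x, s) = (deck k x, signElt γ (σ.sign k) * s) :=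
  (σ.exists_sign k).choose_spec x s

lemma sign_eq {σ : SpinStructure γ} {k : Fin n → ℤ} {ε : ℤˣ}
    (h : (σ.lift k (0, 1)).2 = signElt γ ε) : σ.sign k = ε := by
  rw [lift_eq, mul_one] at h
  exact signElt_injective h

lemma sign_zero (σ : SpinStructure γ) : σ.sign 0 = 1 :=
  sign_eq (by rw [σ.lift_zero, signElt_one])

lemma sign_add (σ : SpinStructure γ) (k l : Fin n → ℤ) :
    σ.sign (k + l) = σ.sign k * σ.sign l :=
  sign_eq (by rw [σ.lift_add, lift_eq σ l, lift_eq, mul_one, signElt_mul])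

/-- The signs as a character of the deck group. -/
noncomputable def signHom (σ : SpinStructure γ) : (Fin n → ℤ) →+ Additive ℤˣ where
  toFun k := Additive.ofMul (σ.sign k)
  map_zero' := by rw [sign_zero]; rfl
  map_add' k l := by rw [sign_add]; rfl

lemma sign_ext {σ σ' : SpinStructure γ}
    (h : ∀ i, σ.sign (Pi.single i 1) = σ'.sign (Pi.single i 1)) (k : Fin n → ℤ) :
    σ.sign k = σ'.sign k := by
  have : σ.signHom = σ'.signHom := by
    refine AddMonoidHom.functions_ext' _ _ _ fun i => AddMonoidHom.ext_int ?_
    simpa [signHom] using h i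
  exact congrArg Additive.toMul (DFunLike.congr_fun this k)

/-- The spin structure with prescribed signs along the generating circles. -/
noncomputable def ofSigns (γ : GammaRep n) (ε : Fin n → ℤˣ) : SpinStructure γ where
  lift k p := (deck k p.1, signElt γ (∏ i, ε i ^ k i) * p.2)
  lift_zero p := by
    refine Prod.ext (deck_zero p.1) ?_
    simp [signElt_one]
  lift_add k l p := by
    refine Prod.ext (deck_add k l p.1) ?_
    simp [zpow_add, Finset.prod_mul_distrib, signElt_mul, mul_assoc]
  continuous k :=
    ((continuous_deck k).comp continuous_fst).prodMk (continuous_const.mul continuous_snd)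
  equivariant k x s g := by simp [mul_assoc]
  covers k x s := ⟨rfl, by simp [signElt]⟩

lemma sign_ofSigns (ε : Fin n → ℤˣ) (i : Fin n) :
    (ofSigns γ ε).sign (Pi.single i 1) = ε i := by
  refine sign_eq ?_
  have : ∏ j, ε j ^ (Pi.single i (1 : ℤ) : Fin n → ℤ) j = ε i := by
    rw [Finset.prod_eq_single i]
    · simp
    · intro j _ hj; simp [hj]
    · simp
  simp [ofSigns, this]

lemma sign_trivial (k : Fin n → ℤ) : (SpinStructure.trivial γ).sign k = 1 :=
  sign_eq (by rw [signElt_one]; rfl)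

/-- An isomorphism is a global sign in the fibres, and such a sign is central. -/
lemma isIso_iff {σ σ' : SpinStructure γ} :
    σ.IsIso σ' ↔ ∀ i, σ.sign (Pi.single i 1) = σ'.sign (Pi.single i 1) := by
  constructor
  · rintro ⟨Φ, h1, h2, h3⟩ i
    obtain ⟨δ, hδ⟩ := exists_sign_of_equivariant Φ.continuous
      (fun x s g => by rw [h1]) (fun x s => (h2 x s).2)
    have hΦ : ∀ x s, Φ (x, s) = (x, signElt γ δ * s) := fun x s =>
      Prod.ext (h2 x s).1 (hδ x s)
    have h := congrArg Prod.snd (h3 (Pi.single i 1) (0, 1))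
    rw [lift_eq, hΦ, hΦ, lift_eq] at h
    simp only [mul_one, ← signElt_mul] at h
    have := signElt_injective h
    rw [mul_comm] at this
    exact mul_right_cancel this
  · intro h
    refine ⟨Homeomorph.refl _, fun _ _ _ => rfl, fun _ _ => ⟨rfl, rfl⟩, fun k p => ?_⟩
    obtain ⟨x, s⟩ := p
    simp only [Homeomorph.refl_apply, id, lift_eq, sign_ext h k]

variable (γ) in
/-- Spin structures up to isomorphism are classified by their signs along the circles. -/
noncomputable def quotEquivSigns : Quot (IsIso (γ := γ)) ≃ (Fin n → ℤˣ) :=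
  Equiv.ofBijective
    (Quot.lift (fun σ i => σ.sign (Pi.single i 1)) fun _ _ h => funext (isIso_iff.mp h)) <| by
    constructor
    · rintro ⟨σ⟩ ⟨σ'⟩ h
      exact Quot.sound (isIso_iff.mpr (congrFun h))
    · intro ε
      exact ⟨Quot.mk _ (ofSigns γ ε), funext (sign_ofSigns ε)⟩

lemma card_nontrivial (γ : GammaRep n) :
    Nat.card {q : Quot (IsIso (γ := γ)) // q ≠ Quot.mk _ (SpinStructure.trivial γ)} =
      2 ^ n - 1 := by
  classical
  have e : {q : Quot (IsIso (γ := γ)) // q ≠ Quot.mk _ (SpinStructure.trivial γ)} ≃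
      {ε : Fin n → ℤˣ // ε ≠ quotEquivSigns γ (Quot.mk _ (SpinStructure.trivial γ))} :=
    (quotEquivSigns γ).subtypeEquiv fun q => by simp
  rw [Nat.card_congr e, Nat.card_eq_fintype_card, Fintype.card_subtype_compl]
  simp

/-- The sign of a deck transformation as a real number. -/
noncomputable def sgn (σ : SpinStructure γ) (k : Fin n → ℤ) : ℝ := ((σ.sign k : ℤ) : ℝ)

lemma sgn_eq (σ : SpinStructure γ) (k : Fin n → ℤ) : σ.sgn k = 1 ∨ σ.sgn k = -1 := by
  unfold sgn
  rcases Int.units_eq_one_or (σ.sign k) with h | h <;> simp [h]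

lemma sgn_mul_self (σ : SpinStructure γ) (k : Fin n → ℤ) : σ.sgn k * σ.sgn k = 1 := by
  rcases σ.sgn_eq k with h | h <;> simp [h]

lemma sgn_zero (σ : SpinStructure γ) : σ.sgn 0 = 1 := by simp [sgn, sign_zero]

lemma sgn_add (σ : SpinStructure γ) (k l : Fin n → ℤ) : σ.sgn (k + l) = σ.sgn k * σ.sgn l := by
  simp [sgn, sign_add]

lemma sgn_trivial (k : Fin n → ℤ) : (SpinStructure.trivial γ).sgn k = 1 := by
  simp [sgn, sign_trivial]

lemma transition_mulVec (σ : SpinStructure γ) (k : Fin n → ℤ) (x : Mink n) (v : Spinor n) :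
    (σ.transition k x).mulVec v = σ.sgn k • v := by
  have : σ.transition k x = ((σ.sign k : ℤ) : SpinMatrix n) := by
    rw [transition, lift_eq, mul_one, signElt_val]
  rw [this, sgn]
  rcases Int.units_eq_one_or (σ.sign k) with h | h <;> simp [h, Matrix.neg_mulVec]

lemma exists_sgn_eq_neg_one {σ : SpinStructure γ}
    (h : ¬ σ.IsIso (SpinStructure.trivial γ)) : ∃ i, σ.sgn (Pi.single i 1) = -1 := by
  rw [isIso_iff] at h
  push Not at h
  obtain ⟨i, hi⟩ := h
  rw [sign_trivial] at hi
  refine ⟨i, ?_⟩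
  rcases Int.units_eq_one_or (σ.sign (Pi.single i 1)) with h | h
  · exact absurd h hi
  · simp [sgn, h]

end SpinStructure

end SpinStructures

/-! ### Causal structure and supports -/

section Causal

variable {n : ℕ}

instance factTwoPiPos : Fact (0 < 2 * Real.pi) := ⟨Real.two_pi_pos⟩

lemma proj_sub (x y : Mink n) : proj (x - y) = proj x - proj y := by
  refine Prod.ext rfl (funext fun i => ?_)
  simp [proj]

lemma proj_fst (x : Mink n) : (proj x).1 = x 0 := rfl

lemma continuous_proj : Continuous (proj (n := n)) :=
  (continuous_apply 0).prodMk (continuous_pi fun i =>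
    (AddCircle.continuous_mk' _).comp (continuous_apply i.succ))

lemma proj_surjective : Function.Surjective (proj (n := n)) := by
  rintro ⟨t, φ⟩
  choose y hy using fun i => QuotientAddGroup.mk_surjective (φ i)
  exact ⟨Fin.cons t y, Prod.ext rfl (funext hy)⟩

lemma isOpenMap_proj : IsOpenMap (proj (n := n)) := by
  have h1 : IsOpenMap (fun p : ℝ × (Fin n → ℝ) =>
      (p.1, fun i => (p.2 i : AddCircle (2 * Real.pi)))) :=
    IsOpenMap.id.prodMap (IsOpenMap.piMap
      (fun _ => QuotientAddGroup.isOpenMap_coe) (by simp))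
  have h2 : IsOpenMap (fun x : Mink n => (x 0, fun i : Fin n => x i.succ)) :=
    (Fin.consEquivL ℝ (fun _ : Fin (n + 1) => ℝ)).symm.toHomeomorph.isOpenMap
  exact h1.comp h2

/-- Straight lines with causal direction project to causal curves. -/
lemma causalLE_proj_add (x : Mink n) {v : Mink n} (hv : v ∈ futureCone n) :
    CausalLE (proj x) (proj (x + v)) := by
  by_cases h0 : v 0 = 0
  · have : v = 0 := by
      have := norm_le_of_mem_futureCone hv
      rw [h0] at this
      exact norm_le_zero_iff.mp this
    left; rw [this, add_zero]
  · right
    have hd : ∀ t : ℝ, HasDerivAt (fun t : ℝ => x + t • v) v t := fun t => by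
      simpa using ((hasDerivAt_id t).smul_const v).const_add x
    refine ⟨fun t => x + t • v, by fun_prop, fun t _ => ?_, by simp, by simp⟩
    rw [(hd t).deriv]
    have h1 : 0 ≤ v 0 := (spaceNorm_nonneg v).trans hv
    refine ⟨lt_of_le_of_ne h1 (Ne.symm h0), ?_⟩
    rw [Fin.sum_univ_succ]
    simp only [eta_zero, eta_succ, one_mul]
    rw [← spaceNorm_sq]
    have h2 : spaceNorm v ≤ v 0 := hv
    nlinarith [spaceNorm_nonneg v]

lemma CausalLE.fst_le {p q : Spacetime n} (h : CausalLE p q) : p.1 ≤ q.1 := by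
  rcases h with rfl | ⟨c, hc, hd, rfl, rfl⟩
  · exact le_rfl
  · rw [proj_fst, proj_fst]
    have hc0 : ∀ t, HasDerivAt (fun s => c s 0) (deriv c t 0) t := fun t =>
      hasDerivAt_pi.mp (hc.differentiable (by simp) t).hasDerivAt 0
    have hmono : MonotoneOn (fun s => c s 0) (Set.Icc 0 1) := by
      refine monotoneOn_of_deriv_nonneg (convex_Icc 0 1)
        (fun t _ => (hc0 t).continuousAt.continuousWithinAt)
        (fun t _ => (hc0 t).differentiableAt.differentiableWithinAt) fun t ht => ?_
      rw [(hc0 t).deriv]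
      exact (hd t (interior_subset ht)).1.le
    exact hmono (Set.left_mem_Icc.mpr zero_le_one) (Set.right_mem_Icc.mpr zero_le_one) zero_le_one

lemma mem_Jplus_slab {I : Set ℝ} {a : ℝ} (ha : a ∈ I) {q : Spacetime n} (hq : a ≤ q.1) :
    q ∈ Jplus (I ×ˢ (Set.univ : Set (Fin n → AddCircle (2 * Real.pi)))) := by
  obtain ⟨x, rfl⟩ := proj_surjective q
  set v : Mink n := Fin.cons (x 0 - a) 0 with hv
  have hvc : v ∈ futureCone n := by
    change spaceNorm v ≤ v 0
    have : spaceNorm v = 0 := by simp [spaceNorm, hv]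
    rw [this]
    simpa [hv, proj_fst] using hq
  refine ⟨proj (x - v), ⟨?_, trivial⟩, by simpa using causalLE_proj_add (x - v) hvc⟩
  simpa [proj_fst, hv] using ha

lemma mem_Jminus_slab {I : Set ℝ} {a : ℝ} (ha : a ∈ I) {q : Spacetime n} (hq : q.1 ≤ a) :
    q ∈ Jminus (I ×ˢ (Set.univ : Set (Fin n → AddCircle (2 * Real.pi)))) := by
  obtain ⟨x, rfl⟩ := proj_surjective q
  set v : Mink n := Fin.cons (a - x 0) 0 with hv
  have hvc : v ∈ futureCone n := by
    change spaceNorm v ≤ v 0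
    have : spaceNorm v = 0 := by simp [spaceNorm, hv]
    rw [this]
    simpa [hv, proj_fst] using hq
  refine ⟨proj (x + v), ⟨?_, trivial⟩, causalLE_proj_add x hvc⟩
  simpa [proj_fst, hv] using ha

/-- The set of points from which a closed set `K`, bounded on one side in time, is reached by
straight causal lines is closed; here `s = 1` for the future of `K` and `s = -1` for its past. -/
lemma isClosed_proj_image_cone {K : Set (Spacetime n)} (hK : IsClosed K) {s a : ℝ}
    (hs : s = 1 ∨ s = -1) (ha : ∀ p ∈ K, a ≤ s * p.1) :
    IsClosed (proj '' {q : Mink n | ∃ v ∈ futureCone n, proj (q - s • v) ∈ K}) := by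
  set A := {q : Mink n | ∃ v ∈ futureCone n, proj (q - s • v) ∈ K} with hA
  have hss : s * s = 1 := by rcases hs with rfl | rfl <;> norm_num
  -- the causal vectors stay bounded because `K` is bounded in time, so they subconverge
  have hAc : IsClosed A := by
    refine IsSeqClosed.isClosed fun q q₀ hq hlim => ?_
    choose v hv hvK using hq
    have hb : ∃ R, ∀ j, v j ∈ Metric.closedBall (0 : Mink n) R := by
      obtain ⟨R, hR⟩ := (Metric.isBounded_range_of_tendsto q hlim).exists_norm_le
      refine ⟨R + |a|, fun j => ?_⟩
      rw [mem_closedBall_zero_iff]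
      have h1 := norm_le_of_mem_futureCone (hv j)
      have h2 := ha _ (hvK j)
      rw [proj_fst, Pi.sub_apply, Pi.smul_apply, smul_eq_mul, mul_sub, ← mul_assoc, hss,
        one_mul] at h2
      have h3 : s * q j 0 ≤ R := by
        have h4 := (norm_le_pi_norm (q j) 0).trans (hR _ ⟨j, rfl⟩)
        rw [Real.norm_eq_abs, abs_le] at h4
        rcases hs with rfl | rfl <;> linarith
      have := neg_abs_le a
      linarith
    obtain ⟨R, hR⟩ := hb
    obtain ⟨w, -, φ, hφ, hw⟩ := tendsto_subseq_of_bounded Metric.isBounded_closedBall hR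
    refine ⟨w, isClosed_futureCone.mem_of_tendsto hw (Filter.Eventually.of_forall fun j => hv _),
      ?_⟩
    refine hK.mem_of_tendsto ((continuous_proj.tendsto _).comp
      ((hlim.comp hφ.tendsto_atTop).sub (hw.const_smul s)))
      (Filter.Eventually.of_forall fun j => hvK _)
  -- `A` is invariant under the deck group and `proj` is open
  have hcompl : (proj '' A)ᶜ = proj '' Aᶜ := by
    ext p
    obtain ⟨x, rfl⟩ := proj_surjective p
    have hsat : ∀ y : Mink n, proj y = proj x → (y ∈ A ↔ x ∈ A) := by
      intro y hy
      simp only [hA, Set.mem_ofPred_eq, proj_sub, hy]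
    constructor
    · intro h
      exact ⟨x, fun hx => h ⟨x, hx, rfl⟩, rfl⟩
    · rintro ⟨y, hy, hyx⟩ ⟨z, hz, hzx⟩
      exact hy ((hsat y hyx).mpr ((hsat z hzx).mp hz))
  rw [← isOpen_compl_iff, hcompl]
  exact isOpenMap_proj _ hAc.isOpen_compl

lemma supp_subset_of_cone {f ψ : Field n} {s a : ℝ} (hs : s = 1 ∨ s = -1)
    (ha : ∀ x, f x ≠ 0 → a ≤ s * x 0)
    (h : ∀ q, (∀ v ∈ futureCone n, f (q - s • v) = 0) → ψ q = 0) :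
    supp ψ ⊆ proj '' {q : Mink n | ∃ v ∈ futureCone n, proj (q - s • v) ∈ supp f} := by
  have hK : ∀ p ∈ supp f, a ≤ s * p.1 := by
    refine fun p hp => closure_minimal (t := {p : Spacetime n | a ≤ s * p.1}) ?_
      (isClosed_le continuous_const (continuous_const.mul continuous_fst)) hp
    rintro _ ⟨x, hx, rfl⟩
    exact ha x hx
  refine closure_minimal ?_ (isClosed_proj_image_cone isClosed_closure hs hK)
  rintro _ ⟨q, hq, rfl⟩
  refine ⟨q, ?_, rfl⟩
  by_contra hcon
  refine hq (h q fun v hv => ?_)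
  by_contra hf
  exact hcon ⟨v, hv, subset_closure ⟨_, hf, rfl⟩⟩

lemma supp_subset_Jplus {f ψ : Field n} {a : ℝ} (ha : ∀ x, f x ≠ 0 → a ≤ x 0)
    (h : ∀ q, (∀ v ∈ futureCone n, f (q - v) = 0) → ψ q = 0) : supp ψ ⊆ Jplus (supp f) := by
  refine (supp_subset_of_cone (s := 1) (a := a) (Or.inl rfl) (by simpa using ha)
    (by simpa using h)).trans ?_
  rintro _ ⟨q, ⟨v, hv, hq⟩, rfl⟩
  rw [one_smul] at hq
  exact ⟨_, hq, by simpa using causalLE_proj_add (q - v) hv⟩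

lemma supp_subset_Jminus {f ψ : Field n} {b : ℝ} (hb : ∀ x, f x ≠ 0 → x 0 ≤ b)
    (h : ∀ q, (∀ v ∈ futureCone n, f (q + v) = 0) → ψ q = 0) : supp ψ ⊆ Jminus (supp f) := by
  refine (supp_subset_of_cone (s := -1) (a := -b) (Or.inr rfl) (by simpa using hb)
    (by simpa using h)).trans ?_
  rintro _ ⟨q, ⟨v, hv, hq⟩, rfl⟩
  rw [neg_smul, one_smul, sub_neg_eq_add] at hq
  exact ⟨_, hq, causalLE_proj_add q hv⟩

lemma exists_time_bounds {f : Field n} (h : IsCompact (supp f)) :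
    ∃ a b, ∀ x, f x ≠ 0 → a ≤ x 0 ∧ x 0 ≤ b := by
  obtain ⟨a, ha⟩ := (h.image continuous_fst).bddBelow
  obtain ⟨b, hb⟩ := (h.image continuous_fst).bddAbove
  exact ⟨a, b, fun x hx =>
    have hm : proj x ∈ supp f := subset_closure ⟨x, hx, rfl⟩
    ⟨ha ⟨_, hm, rfl⟩, hb ⟨_, hm, rfl⟩⟩⟩

lemma isCompact_supp {f : Field n} {a b : ℝ} (h : ∀ x, f x ≠ 0 → a ≤ x 0 ∧ x 0 ≤ b) :
    IsCompact (supp f) := by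
  have hc : IsCompact (Set.Icc a b ×ˢ (Set.univ : Set (Fin n → AddCircle (2 * Real.pi)))) :=
    isCompact_Icc.prod isCompact_univ
  refine hc.of_isClosed_subset isClosed_closure (closure_minimal ?_ hc.isClosed)
  rintro _ ⟨x, hx, rfl⟩
  exact ⟨h x hx, trivial⟩

/-- The field vanishes at early times (`s = 1`), or at late times (`s = -1`). -/
def OneSided (s : ℝ) (ψ : Field n) : Prop := ∃ a, ∀ y, s * y 0 < a → ψ y = 0

lemma OneSided.sub {s : ℝ} {ψ φ : Field n} (h : OneSided s ψ) (h' : OneSided s φ) :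
    OneSided s (ψ - φ) := by
  obtain ⟨a, h⟩ := h
  obtain ⟨b, h'⟩ := h'
  exact ⟨min a b, fun y hy => by
    rw [Pi.sub_apply, h y (hy.trans_le (min_le_left _ _)), h' y (hy.trans_le (min_le_right _ _)),
      sub_zero]⟩

lemma OneSided.add {s : ℝ} {ψ φ : Field n} (h : OneSided s ψ) (h' : OneSided s φ) :
    OneSided s (ψ + φ) := by
  obtain ⟨a, h⟩ := h
  obtain ⟨b, h'⟩ := h'
  exact ⟨min a b, fun y hy => by
    rw [Pi.add_apply, h y (hy.trans_le (min_le_left _ _)), h' y (hy.trans_le (min_le_right _ _)),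
      add_zero]⟩

lemma OneSided.smul {s : ℝ} {ψ : Field n} (h : OneSided s ψ) (c : ℝ) : OneSided s (c • ψ) := by
  obtain ⟨a, h⟩ := h
  exact ⟨a, fun y hy => by rw [Pi.smul_apply, h y hy, smul_zero]⟩

lemma OneSided.comp_deck {s : ℝ} {ψ : Field n} (h : OneSided s ψ) (k : Fin n → ℤ) :
    OneSided s (fun x => ψ (deck k x)) := by
  obtain ⟨a, h⟩ := h
  exact ⟨a, fun y hy => h _ (by simpa [deck] using hy)⟩

lemma oneSided_of_isCompact_supp {s : ℝ} {ψ : Field n} (hs : s = 1 ∨ s = -1)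
    (h : IsCompact (supp ψ)) : OneSided s ψ := by
  obtain ⟨a, b, hab⟩ := exists_time_bounds h
  rcases hs with rfl | rfl
  · refine ⟨a, fun y hy => ?_⟩
    by_contra h0
    linarith [(hab y h0).1]
  · refine ⟨-b, fun y hy => ?_⟩
    by_contra h0
    linarith [(hab y h0).2]

end Causal

/-! ### Green's operators -/

section Green

variable {n : ℕ} {γ : GammaRep n} {σ : SpinStructure γ}

/-- Sections are the smooth Majorana fields on the universal cover that are periodic up to the signs
of the spin structure. -/
lemma mem_sections_iff {ψ : Field n} : ψ ∈ sections σ ↔ ContDiff ℝ ∞ ψ ∧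
    (∀ x μ, ψ x μ ∈ γ.majorana) ∧ ∀ k x, ψ (deck k x) = σ.sgn k • ψ x := by
  refine and_congr_right fun _ => and_congr_right fun _ => ?_
  simp only [SpinStructure.transition_mulVec, funext_iff, Pi.smul_apply]

lemma contDiff_deck (k : Fin n → ℤ) : ContDiff ℝ ∞ (deck k) := contDiff_id.add contDiff_const

lemma pd_comp_deck {F : Type*} [NormedAddCommGroup F] [NormedSpace ℝ F] (f : Mink n → F)
    (k : Fin n → ℤ) (x : Mink n) (ν : Fin (n + 1)) :
    pd ν (fun y => f (deck k y)) x = pd ν f (deck k x) := pd_comp_add f _ x ν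

lemma dirac_comp_deck (ψ : Field n) (k : Fin n → ℤ) :
    dirac γ (fun x => ψ (deck k x)) = fun x => dirac γ ψ (deck k x) := by
  funext x μ
  simp only [dirac, pd_comp_deck]

lemma dirac_add' {ψ φ : Field n} (hψ : ContDiff ℝ ∞ ψ) (hφ : ContDiff ℝ ∞ φ) :
    dirac γ (ψ + φ) = dirac γ ψ + dirac γ φ := by
  funext x μ
  simp [dirac, pd_add hψ hφ, Matrix.mulVec_add, Finset.sum_add_distrib]

lemma dirac_smul' {ψ : Field n} (hψ : ContDiff ℝ ∞ ψ) (c : ℝ) :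
    dirac γ (c • ψ) = c • dirac γ ψ := by
  funext x μ
  simp [dirac, pd_smul hψ, Matrix.mulVec_smul, Finset.smul_sum]

/-- The field with charge conjugate components. -/
noncomputable def conjField (γ : GammaRep n) (ψ : Field n) : Field n :=
  fun x μ => γ.chargeConj (ψ x μ)

lemma contDiff_conjField {ψ : Field n} (hψ : ContDiff ℝ ∞ ψ) : ContDiff ℝ ∞ (conjField γ ψ) :=
  contDiff_pi.2 fun μ => γ.chargeConjCLM.contDiff.comp (contDiff_comp_field hψ μ)

lemma dirac_conjField {ψ : Field n} (hψ : ContDiff ℝ ∞ ψ) :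
    dirac γ (conjField γ ψ) = conjField γ (dirac γ ψ) := by
  funext x μ
  rw [dirac_apply (contDiff_conjField hψ), conjField, dirac_apply hψ]
  have h1 : ∀ ν, pd ν (fun y => conjField γ ψ y μ) x = γ.chargeConj (pd ν (fun y => ψ y μ) x) :=
    fun ν => pd_clm γ.chargeConjCLM ((contDiff_comp_field hψ μ).differentiable (by simp) x) ν
  have h2 : ∀ w : Fin (n + 1) → Spinor n, γ.chargeConj (∑ ν, w ν) = ∑ ν, γ.chargeConj (w ν) :=
    fun w => map_sum γ.chargeConjCLM w _
  simp only [slash, h1, h2, γ.chargeConj_gam]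

lemma OneSided.conjField {s : ℝ} {ψ : Field n} (h : OneSided s ψ) :
    OneSided s (conjField γ ψ) := by
  obtain ⟨a, h⟩ := h
  refine ⟨a, fun y hy => ?_⟩
  funext μ
  rw [RaritaSchwinger.conjField, h y hy]
  exact map_zero γ.chargeConjCLM

lemma eq_of_dirac_eq_of_oneSided {s : ℝ} (hs : s = 1 ∨ s = -1) {ψ φ : Field n}
    (hψ : ContDiff ℝ ∞ ψ) (hφ : ContDiff ℝ ∞ φ) (hψs : OneSided s ψ) (hφs : OneSided s φ)
    (h : dirac γ ψ = dirac γ φ) : ψ = φ := by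
  rw [← sub_eq_zero]
  have hd : ContDiff ℝ ∞ (ψ - φ) := hψ.sub hφ
  obtain ⟨a, ha⟩ := hψs.sub hφs
  have h0 : ∀ μ y, slash γ (fun y => (ψ - φ) y μ) y = 0 := fun μ y => by
    rw [← dirac_apply hd, dirac_sub γ hψ hφ, h, sub_self]; rfl
  funext y μ
  rcases hs with rfl | rfl
  · exact eq_zero_of_slash_eq_zero γ (contDiff_comp_field hd μ)
      ⟨a, fun y hy => congrFun (ha y (by simpa using hy)) μ⟩ (h0 μ) y
  · exact eq_zero_of_slash_eq_zero_future γ (contDiff_comp_field hd μ)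
      ⟨-a, fun y hy => congrFun (ha y (by linarith)) μ⟩ (h0 μ) y

/-- A solution of the Dirac equation that vanishes on one side inherits from its source the
Majorana condition and the behaviour under deck transformations. -/
lemma mem_sections_of_dirac_eq {s : ℝ} (hs : s = 1 ∨ s = -1) {f ψ : Field n} (hf : f ∈ sections σ)
    (hψ : ContDiff ℝ ∞ ψ) (h : dirac γ ψ = f) (hψs : OneSided s ψ) : ψ ∈ sections σ := by
  rw [mem_sections_iff] at hf ⊢
  obtain ⟨hf1, hf2, hf3⟩ := hf
  refine ⟨hψ, fun x μ => ?_, fun k x => ?_⟩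
  · rw [mem_majorana]
    have : conjField γ ψ = ψ := by
      refine eq_of_dirac_eq_of_oneSided (γ := γ) hs (contDiff_conjField hψ) hψ hψs.conjField hψs ?_
      rw [dirac_conjField hψ, h]
      funext x μ
      exact (mem_majorana γ).mp (hf2 x μ)
    exact congrFun (congrFun this x) μ
  · have : (fun x => ψ (deck k x)) = σ.sgn k • ψ := by
      refine eq_of_dirac_eq_of_oneSided (γ := γ) hs (hψ.comp (contDiff_deck k))
        (contDiff_const.smul hψ) (hψs.comp_deck k) (hψs.smul _) ?_
      rw [dirac_comp_deck, h, dirac_smul' hψ, h]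
      exact funext (hf3 k)
    exact congrFun this x

/-- Unique one-sided solvability of the Dirac equation with estimates yields Green's operators.
Linearity and the left inverse property come from uniqueness. -/
lemma exists_isGreen {s : ℝ} (hs : s = 1 ∨ s = -1) (J : Set (Spacetime n) → Set (Spacetime n))
    (hJ : ∀ (K : Set (Spacetime n)) a, (∀ p ∈ K, a ≤ s * p.1) → ∀ p ∈ J K, a ≤ s * p.1)
    (hJmono : ∀ K L : Set (Spacetime n), K ⊆ L → J K ⊆ J L)
    (hex : ∀ f ∈ sections₀ σ, ∃ ψ : Field n, ContDiff ℝ ∞ ψ ∧ dirac γ ψ = f ∧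
      supp ψ ⊆ J (supp f))
    (hest : ∀ (a : ℝ) (L : Set (Mink n)), IsCompact L → ∀ j : ℕ, ∃ (l : ℕ) (c : ℝ), 0 ≤ c ∧
      ∀ (f ψ : Field n) (b : ℝ), ContDiff ℝ ∞ f → ContDiff ℝ ∞ ψ → dirac γ ψ = f →
      (∀ y, s * y 0 < a → f y = 0) → (∀ y, s * y 0 < a → ψ y = 0) →
      (∀ i ≤ l, ∀ x, ‖iteratedFDeriv ℝ i f x‖ ≤ b) →
      ∀ x ∈ L, ‖iteratedFDeriv ℝ j ψ x‖ ≤ c * b) :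
    ∃ G : sections₀ σ →ₗ[ℝ] sections σ, IsGreen J G := by
  have hbd : ∀ K : Set (Spacetime n), IsCompact K → ∃ a, ∀ p ∈ K, a ≤ s * p.1 := by
    intro K hK
    obtain ⟨a, ha⟩ := (hK.image (continuous_const.mul continuous_fst :
      Continuous fun p : Spacetime n => s * p.1)).bddBelow
    exact ⟨a, fun p hp => ha ⟨p, hp, rfl⟩⟩
  have hvan : ∀ (φ : Field n) (a : ℝ), (∀ p ∈ supp φ, a ≤ s * p.1) →
      ∀ y, s * y 0 < a → φ y = 0 := by
    intro φ a h y hy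
    by_contra h0
    exact absurd (h (proj y) (subset_closure ⟨y, h0, rfl⟩)) (not_le.mpr hy)
  choose! g hg1 hg2 hg3 using hex
  have hside : ∀ f ∈ sections₀ σ, OneSided s (g f) := by
    intro f hf
    obtain ⟨a, ha⟩ := hbd _ hf.2
    exact ⟨a, hvan _ a fun p hp => hJ _ a ha p (hg3 f hf hp)⟩
  have huniq : ∀ f ∈ sections₀ σ, ∀ ψ : Field n, ContDiff ℝ ∞ ψ → OneSided s ψ →
      dirac γ ψ = f → g f = ψ := fun f hf ψ hψ hψs h =>
    eq_of_dirac_eq_of_oneSided (γ := γ) hs (hg1 f hf) hψ (hside f hf) hψs ((hg2 f hf).trans h.symm)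
  let G : sections₀ σ →ₗ[ℝ] sections σ :=
    { toFun := fun f => ⟨g f.1, mem_sections_of_dirac_eq hs f.2.1 (hg1 _ f.2) (hg2 _ f.2)
        (hside _ f.2)⟩
      map_add' := fun f h => Subtype.ext <| by
        refine huniq _ (f + h).2 _ ((hg1 _ f.2).add (hg1 _ h.2))
          ((hside _ f.2).add (hside _ h.2)) ?_
        have h1 := dirac_add' (γ := γ) (hg1 _ f.2) (hg1 _ h.2)
        rw [hg2 _ f.2, hg2 _ h.2] at h1
        exact h1
      map_smul' := fun c f => Subtype.ext <| by
        refine huniq _ (c • f).2 _ (contDiff_const.smul (hg1 _ f.2)) ((hside _ f.2).smul c) ?_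
        have h1 := dirac_smul' (γ := γ) (hg1 _ f.2) c
        rw [hg2 _ f.2] at h1
        exact h1 }
  have hG : ∀ f, (G f).1 = g f.1 := fun _ => rfl
  refine ⟨G, ?_, fun f => ?_, fun f h hh => ?_, fun f => hg3 _ f.2⟩
  · intro K L m hK hL
    obtain ⟨a, ha⟩ := hbd K hK
    choose l c hc0 hc using fun j => hest a L hL j
    refine ⟨(Finset.range (m + 1)).sup l, ∑ j ∈ Finset.range (m + 1), c j, ?_⟩
    intro f b hfK hfb j hj x hx
    have hjm : j ∈ Finset.range (m + 1) := Finset.mem_range.mpr (by omega)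
    have hb : 0 ≤ b := (norm_nonneg _).trans (hfb 0 (Nat.zero_le _) 0)
    have h1 := hc j f.1 (g f.1) b f.2.1.1 (hg1 _ f.2) (hg2 _ f.2)
      (hvan _ a fun p hp => ha p (hfK hp))
      (hvan _ a fun p hp => hJ K a ha p (hJmono _ _ hfK (hg3 _ f.2 hp)))
      (fun i hi => hfb i (hi.trans (Finset.le_sup hjm))) x hx
    rw [hG]
    exact h1.trans (mul_le_mul_of_nonneg_right
      (Finset.single_le_sum (fun i _ => hc0 i) hjm) hb)
  · rw [hG, opPtilde_eq_dirac, hg2 _ f.2]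
  · rw [hG]
    exact huniq _ h.2 _ f.2.1.1 (oneSided_of_isCompact_supp hs f.2.2) (by
      rw [hh, opPtilde_eq_dirac])

lemma Jplus_mono {K L : Set (Spacetime n)} (h : K ⊆ L) : Jplus K ⊆ Jplus L :=
  fun _ ⟨p, hp, hpq⟩ => ⟨p, h hp, hpq⟩

lemma Jminus_mono {K L : Set (Spacetime n)} (h : K ⊆ L) : Jminus K ⊆ Jminus L :=
  fun _ ⟨p, hp, hpq⟩ => ⟨p, h hp, hpq⟩

lemma le_of_mem_Jplus (K : Set (Spacetime n)) (a : ℝ) (h : ∀ p ∈ K, a ≤ 1 * p.1) :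
    ∀ p ∈ Jplus K, a ≤ 1 * p.1 := by
  rintro p ⟨q, hq, hqp⟩
  have := h q hq
  have := hqp.fst_le
  linarith

lemma le_of_mem_Jminus (K : Set (Spacetime n)) (a : ℝ) (h : ∀ p ∈ K, a ≤ -1 * p.1) :
    ∀ p ∈ Jminus K, a ≤ -1 * p.1 := by
  rintro p ⟨q, hq, hqp⟩
  have := h q hq
  have := hqp.fst_le
  linarith

lemma exists_isGreen_plus (σ : SpinStructure γ) :
    ∃ G : sections₀ σ →ₗ[ℝ] sections σ, IsGreen Jplus G := by
  refine exists_isGreen (s := 1) (Or.inl rfl) Jplus le_of_mem_Jplus (fun _ _ => Jplus_mono) ?_ ?_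
  · intro f hf
    obtain ⟨a, b, hab⟩ := exists_time_bounds hf.2
    obtain ⟨ψ, h1, h2, h3⟩ := exists_retarded γ hf.1.1 (a := a) fun y hy => by
      by_contra h0
      linarith [(hab y h0).1]
    exact ⟨ψ, h1, h2, supp_subset_Jplus (fun x hx => (hab x hx).1) h3⟩
  · intro a L hL j
    simpa only [one_mul] using exists_bound_retarded γ a hL j

lemma norm_timeRev_le : ‖timeRev n‖ ≤ 1 := by
  refine (timeRev n).opNorm_le_bound zero_le_one fun x => ?_
  rw [one_mul, pi_norm_le_iff_of_nonneg (norm_nonneg _)]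
  intro μ
  rw [timeRev_apply, norm_mul]
  have : ‖(eta μ : ℝ)‖ = 1 := by unfold eta; split_ifs <;> simp
  rw [this, one_mul]
  exact norm_le_pi_norm x μ

lemma norm_iteratedFDeriv_comp_timeRev_le {f : Field n} (hf : ContDiff ℝ ∞ f) (j : ℕ)
    (x : Mink n) :
    ‖iteratedFDeriv ℝ j (fun y => f (timeRev n y)) x‖ ≤ ‖iteratedFDeriv ℝ j f (timeRev n x)‖ :=
  (norm_iteratedFDeriv_comp_clm_le (timeRev n) hf j x).trans
    (mul_le_of_le_one_right (norm_nonneg _) (pow_le_one₀ (norm_nonneg _) norm_timeRev_le))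

lemma timeRev_mem_futureCone_neg {v : Mink n} (hv : v ∈ futureCone n) :
    -timeRev n v ∈ futureCone n := by
  change spaceNorm _ ≤ _
  rw [spaceNorm_neg, Pi.neg_apply, timeRev_zero_coord, neg_neg]
  have : spaceNorm (timeRev n v) = spaceNorm v := by simp [spaceNorm, timeRev_succ_coord]
  rw [this]; exact hv

lemma exists_isGreen_minus (σ : SpinStructure γ) :
    ∃ G : sections₀ σ →ₗ[ℝ] sections σ, IsGreen Jminus G := by
  have hR : ContDiff ℝ ∞ (timeRev n) := (timeRev n).contDiff
  refine exists_isGreen (s := -1) (Or.inr rfl) Jminus le_of_mem_Jminus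
    (fun _ _ => Jminus_mono) ?_ ?_
  · intro f hf
    obtain ⟨a, b, hab⟩ := exists_time_bounds hf.2
    obtain ⟨ψ, h1, h2, h3⟩ := exists_retarded γ.reverse (f := fun y => f (timeRev n y))
      (hf.1.1.comp hR) (a := -b) fun y hy => by
        by_contra h0
        have := (hab _ h0).2
        rw [timeRev_zero_coord] at this
        linarith
    refine ⟨fun y => ψ (timeRev n y), h1.comp hR, ?_, supp_subset_Jminus
      (fun x hx => (hab x hx).2) fun q hq => h3 _ fun v hv => ?_⟩
    · funext x
      have h4 := dirac_reverse (γ := γ) (h1.comp hR) (timeRev n x)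
      simp only [Function.comp_def, timeRev_timeRev] at h4
      rw [← h4, show (fun y => ψ y) = ψ from rfl, h2]
      simp only [timeRev_timeRev]
    · have := hq _ (timeRev_mem_futureCone_neg hv)
      rwa [map_sub, timeRev_timeRev, sub_eq_add_neg]
  · intro a L hL j
    obtain ⟨l, c, hc0, hc⟩ := exists_bound_retarded γ.reverse a
      (hL.image (timeRev n).continuous) j
    refine ⟨l, c, hc0, fun f ψ b hf hψ hd hfa hψa hb x hx => ?_⟩
    have h1 := hc (fun y => f (timeRev n y)) (fun y => ψ (timeRev n y)) b (hf.comp hR)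
      (hψ.comp hR) (by funext x; rw [dirac_reverse γ hψ, hd])
      (fun y hy => hfa _ (by rw [timeRev_zero_coord]; linarith))
      (fun y hy => hψa _ (by rw [timeRev_zero_coord]; linarith))
      (fun i hi x => (norm_iteratedFDeriv_comp_timeRev_le hf i x).trans (hb i hi _))
      (timeRev n x) ⟨x, hx, rfl⟩
    refine le_trans ?_ h1
    have h2 := norm_iteratedFDeriv_comp_timeRev_le (hψ.comp hR) j x
    simp only [Function.comp_def, timeRev_timeRev] at h2
    exact h2

section Properties

variable {Gp Gm : sections₀ σ →ₗ[ℝ] sections σ}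

lemma IsGreen.dirac_eq {J : Set (Spacetime n) → Set (Spacetime n)}
    {G : sections₀ σ →ₗ[ℝ] sections σ} (h : IsGreen J G) (f : sections₀ σ) :
    dirac γ (G f).1 = f.1 := by
  rw [← opPtilde_eq_dirac, h.right_inv]

lemma IsGreen.oneSided_plus (h : IsGreen Jplus Gp) (f : sections₀ σ) :
    ∃ a, ∀ y : Mink n, y 0 < a → (Gp f).1 y = 0 := by
  obtain ⟨a, b, hab⟩ := exists_time_bounds f.2.2
  refine ⟨a, fun y hy => ?_⟩
  by_contra h0
  have h1 : proj y ∈ Jplus (supp f.1) := h.support f (subset_closure ⟨y, h0, rfl⟩)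
  have h2 := le_of_mem_Jplus _ a (fun p hp => ?_) _ h1
  · rw [one_mul, proj_fst] at h2; linarith
  · refine closure_minimal (t := {p : Spacetime n | a ≤ 1 * p.1}) ?_
      (isClosed_le continuous_const (continuous_const.mul continuous_fst)) hp
    rintro _ ⟨x, hx, rfl⟩
    change a ≤ 1 * x 0
    rw [one_mul]; exact (hab x hx).1

lemma IsGreen.oneSided_minus (h : IsGreen Jminus Gm) (f : sections₀ σ) :
    ∃ b, ∀ y : Mink n, b < y 0 → (Gm f).1 y = 0 := by
  obtain ⟨a, b, hab⟩ := exists_time_bounds f.2.2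
  refine ⟨b, fun y hy => ?_⟩
  by_contra h0
  have h1 : proj y ∈ Jminus (supp f.1) := h.support f (subset_closure ⟨y, h0, rfl⟩)
  have h2 := le_of_mem_Jminus _ (-b) (fun p hp => ?_) _ h1
  · rw [proj_fst] at h2; linarith
  · refine closure_minimal (t := {p : Spacetime n | -b ≤ -1 * p.1}) ?_
      (isClosed_le continuous_const (continuous_const.mul continuous_fst)) hp
    rintro _ ⟨x, hx, rfl⟩
    change -b ≤ -1 * x 0
    linarith [(hab x hx).2]

end Properties

end Green

/-! ### Conservation of the charge and the form on observables -/

section Flux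

open MeasureTheory

variable {n : ℕ} (γ : GammaRep n)

/-- The charge density as a bilinear map. -/
noncomputable def densityBilin :
    (Fin (n + 1) → Spinor n) →ₗ[ℝ] (Fin (n + 1) → Spinor n) →ₗ[ℝ] ℝ :=
  LinearMap.mk₂ ℝ (density γ)
    (fun u v w => by
      simp only [density, Pi.add_apply, ip_add_left, gammaTrace_add, mul_add,
        Finset.sum_add_distrib]
      ring)
    (fun c v w => by
      simp only [density, Pi.smul_apply, ip_smul_left, gammaTrace_smul, smul_eq_mul, mul_sub,
        Finset.mul_sum]
      congr 1
      · exact Finset.sum_congr rfl fun _ _ => by ring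
      · ring)
    (fun u v w => by
      simp only [density, Pi.add_apply, ip_add_right, gammaTrace_add, mul_add,
        Finset.sum_add_distrib]
      ring)
    (fun c v w => by
      simp only [density, Pi.smul_apply, ip_smul_right, gammaTrace_smul, smul_eq_mul, mul_sub,
        Finset.mul_sum]
      congr 1
      · exact Finset.sum_congr rfl fun _ _ => by ring
      · ring)

lemma densityBilin_apply (v w : Fin (n + 1) → Spinor n) : densityBilin γ v w = density γ v w := rfl

/-- The symbol of the Rarita-Schwinger operator as a linear map. -/
noncomputable def symbolPLin (ν : Fin (n + 1)) :
    (Fin (n + 1) → Spinor n) →ₗ[ℝ] (Fin (n + 1) → Spinor n) where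
  toFun := symbolP γ ν
  map_add' v w := by
    funext μ
    simp only [symbolP, Pi.add_apply, Matrix.mulVec_add, smul_add]
    abel
  map_smul' c v := by
    funext μ
    simp only [symbolP, Pi.smul_apply, Matrix.mulVec_smul, smul_sub, smul_comm c, RingHom.id_apply]

/-- The current `⟨Γ^ν v, w⟩` as a bilinear map. -/
noncomputable def fluxBilin (ν : Fin (n + 1)) :
    (Fin (n + 1) → Spinor n) →ₗ[ℝ] (Fin (n + 1) → Spinor n) →ₗ[ℝ] ℝ :=
  (formVBilin γ).comp (symbolPLin γ ν)

lemma fluxBilin_apply (ν : Fin (n + 1)) (v w : Fin (n + 1) → Spinor n) :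
    fluxBilin γ ν v w = formV γ (symbolP γ ν v) w := rfl

/-- The charge of a pair of fields: the integral of the charge density over the slice at time `t`. -/
noncomputable def sliceCharge (t : ℝ) (u χ : Field n) : ℝ :=
  ∫ y in Set.Icc (0 : Fin n → ℝ) (fun _ => 2 * Real.pi),
    density γ (u (Fin.cons t y)) (χ (Fin.cons t y))

variable {γ}

lemma sliceCharge_comm (t : ℝ) (u χ : Field n) : sliceCharge γ t u χ = sliceCharge γ t χ u := by
  unfold sliceCharge
  simp only [density_comm γ (u _)]

lemma contDiff_cons (t : ℝ) : ContDiff ℝ ∞ fun y : Fin n → ℝ => (Fin.cons t y : Mink n) := by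
  refine contDiff_pi.2 fun μ => ?_
  refine Fin.cases ?_ (fun i => ?_) μ
  · simpa using contDiff_const
  · simpa using contDiff_apply ℝ ℝ i

lemma integrableOn_density {u χ : Field n} (hu : Continuous u) (hχ : Continuous χ) (t : ℝ) :
    IntegrableOn (fun y : Fin n → ℝ => density γ (u (Fin.cons t y)) (χ (Fin.cons t y)))
      (Set.Icc 0 (fun _ => 2 * Real.pi)) := by
  have hc := (contDiff_cons (n := n) t).continuous
  have h : Continuous fun y : Fin n → ℝ => density γ (u (Fin.cons t y)) (χ (Fin.cons t y)) :=
    ((LinearMap.toContinuousBilinearMap (densityBilin γ)).continuous.comp (hu.comp hc)).clm_apply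
      (hχ.comp hc)
  exact h.continuousOn.integrableOn_compact isCompact_Icc

lemma sliceCharge_add_left {u v χ : Field n} (hu : Continuous u) (hv : Continuous v)
    (hχ : Continuous χ) (t : ℝ) :
    sliceCharge γ t (u + v) χ = sliceCharge γ t u χ + sliceCharge γ t v χ := by
  unfold sliceCharge
  rw [← integral_add (integrableOn_density hu hχ t) (integrableOn_density hv hχ t)]
  simp only [Pi.add_apply, ← densityBilin_apply, map_add, LinearMap.add_apply]

lemma sliceCharge_smul_left (c : ℝ) (u χ : Field n) (t : ℝ) :
    sliceCharge γ t (c • u) χ = c * sliceCharge γ t u χ := by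
  unfold sliceCharge
  rw [← integral_const_mul]
  simp only [Pi.smul_apply, ← densityBilin_apply, map_smul, LinearMap.smul_apply, smul_eq_mul]

/-- The integral over the fundamental domain of a function supported in a time interval. -/
lemma integral_fundDomain_eq {F : Mink n → ℝ} {a b : ℝ}
    (h : ∀ x, F x ≠ 0 → a ≤ x 0 ∧ x 0 < b) :
    ∫ x in fundDomain n, F x =
      ∫ x in Set.Icc (Fin.cons a (0 : Fin n → ℝ) : Mink n) (Fin.cons b fun _ => 2 * Real.pi), F x := by
  have hset : fundDomain n ∩ {x | x 0 ∈ Set.Ico a b} =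
      Set.univ.pi fun μ => Set.Ico ((Fin.cons a (0 : Fin n → ℝ) : Mink n) μ)
        ((Fin.cons b fun _ => 2 * Real.pi : Mink n) μ) := by
    ext x
    simp only [fundDomain, Set.mem_inter_iff, Set.mem_ofPred_eq, Set.mem_univ_pi]
    rw [Fin.forall_fin_succ]
    simp only [Fin.cons_zero, Fin.cons_succ, Pi.zero_apply]
    tauto
  have hae := Measure.univ_pi_Ico_ae_eq_Icc (μ := fun _ : Fin (n + 1) => (volume : Measure ℝ))
    (f := (Fin.cons a (0 : Fin n → ℝ) : Mink n)) (g := (Fin.cons b fun _ => 2 * Real.pi : Mink n))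
  rw [← hset, ← volume_pi] at hae
  rw [← setIntegral_congr_set hae]
  refine setIntegral_eq_of_subset_of_forall_sdiff_eq_zero ?_ Set.inter_subset_left ?_
  · have : fundDomain n = ⋂ i : Fin n, (fun x : Mink n => x i.succ) ⁻¹' Set.Ico 0 (2 * Real.pi) := by
      ext x; simp [fundDomain]
    rw [this]
    exact MeasurableSet.iInter fun i => measurable_pi_apply i.succ measurableSet_Ico
  · rintro x ⟨hx, hx'⟩
    by_contra h0
    exact hx' ⟨hx, h x h0⟩

lemma opP_eq_of_eventuallyEq {ψ φ : Field n} {x : Mink n} (h : ψ =ᶠ[nhds x] φ) :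
    opP γ ψ x = opP γ φ x := by
  rw [opP_eq_sum, opP_eq_sum]
  simp only [pd_eq_of_eventuallyEq h]

lemma opP_eq_zero_of_past {ψ : Field n} {a : ℝ} (h : ∀ y, y 0 < a → ψ y = 0) (x : Mink n)
    (hx : x 0 < a) : opP γ ψ x = 0 := by
  have : ψ =ᶠ[nhds x] (0 : Field n) := by
    filter_upwards [(isOpen_lt (continuous_apply 0) continuous_const).mem_nhds hx] with y hy
    exact h y hy
  rw [opP_eq_of_eventuallyEq this, opP_zero]; rfl

lemma opP_eq_of_future {ψ φ : Field n} {b : ℝ} (h : ∀ y, b < y 0 → ψ y = φ y) (x : Mink n)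
    (hx : b < x 0) : opP γ ψ x = opP γ φ x := by
  refine opP_eq_of_eventuallyEq ?_
  filter_upwards [(isOpen_lt continuous_const (continuous_apply 0)).mem_nhds hx] with y hy
  exact h y hy

variable {σ : SpinStructure γ}

lemma eq_deck_of_faces {i : Fin n} {x x' : Mink n} (hi : x i.succ = 2 * Real.pi)
    (hi' : x' i.succ = 0) (h : ∀ j ≠ i.succ, x j = x' j) : x = deck (Pi.single i 1) x' := by
  funext μ
  by_cases hμ : μ = i.succ
  · subst hμ
    simp [deck, hi, hi']
  · rw [h μ hμ]
    revert hμ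
    refine Fin.cases ?_ (fun j => ?_) μ
    · intro _; simp [deck]
    · intro hj
      have : j ≠ i := fun h => hj (by rw [h])
      simp [deck, this]

/-- Green's identity on a time interval: the pairing of `P u` with a solution `χ` is the difference of
the charges at its two ends. -/
lemma integral_opP_eq_flux (hn : 2 ≤ n) {u χ : Field n} (hu : u ∈ sections σ) (hχ : χ ∈ sections σ)
    (hP : opP γ χ = 0) {a b : ℝ} (hab : a ≤ b) :
    ∫ x in Set.Icc (Fin.cons a (0 : Fin n → ℝ) : Mink n) (Fin.cons b fun _ => 2 * Real.pi),
      formV γ (opP γ u x) (χ x) = sliceCharge γ b u χ - sliceCharge γ a u χ := by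
  rw [mem_sections_iff] at hu hχ
  have hf : ∀ ν, ContDiff ℝ ∞ fun x => fluxBilin γ ν (u x) (χ x) :=
    fun ν => contDiff_bilin (fluxBilin γ ν) hu.1 hχ.1
  have key := integral_div_box (fun ν x => fluxBilin γ ν (u x) (χ x)) hf hab
    (lo := 0) (hi := fun _ => 2 * Real.pi) (fun i => Real.two_pi_pos.le) ?_
  · have h0 : ∀ t (y : Fin n → ℝ), fluxBilin γ 0 (u (Fin.cons t y)) (χ (Fin.cons t y)) =
        density γ (u (Fin.cons t y)) (χ (Fin.cons t y)) := fun t y => by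
      rw [fluxBilin_apply, formV_symbolP_zero γ hn (hu.2.1 _)]
    simp only [h0] at key
    unfold sliceCharge
    rw [← key]
    congr 1
    funext x
    have h1 : ∀ ν, pd ν (fun x => fluxBilin γ ν (u x) (χ x)) x =
        formVBilin γ (symbolP γ ν (pd ν u x)) (χ x) -
          formVBilin γ (u x) (symbolP γ ν (pd ν χ x)) := by
      intro ν
      rw [pd_bilin (fluxBilin γ ν) (hu.1.differentiable (by simp) x)
        (hχ.1.differentiable (by simp) x), formVBilin_apply γ (u x),
        formV_symbolP_right γ hn, sub_neg_eq_add]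
      rfl
    simp only [h1, Finset.sum_sub_distrib]
    rw [← map_sum, ← opP_eq_sum, hP, Pi.zero_apply, map_zero, sub_zero, opP_eq_sum,
      ← formVBilin_apply, map_sum, LinearMap.sum_apply]
  · -- opposite spatial faces are identified up to a sign, which cancels in the bilinear current
    intro i x x' _ hi hi' hj
    have := eq_deck_of_faces hi hi' hj
    rw [this, hu.2.2, hχ.2.2, map_smul, map_smul, LinearMap.smul_apply, smul_smul,
      σ.sgn_mul_self, one_smul]

/-- The charge of a pair of solutions is conserved. -/
lemma sliceCharge_eq (hn : 2 ≤ n) {u χ : Field n} (hu : u ∈ sections σ) (hχ : χ ∈ sections σ)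
    (hPu : opP γ u = 0) (hP : opP γ χ = 0) (a b : ℝ) :
    sliceCharge γ a u χ = sliceCharge γ b u χ := by
  wlog hab : a ≤ b generalizing a b
  · exact (this b a (le_of_not_ge hab)).symm
  have := integral_opP_eq_flux hn hu hχ hP hab
  have h0 : ∀ w : Fin (n + 1) → Spinor n, formV γ 0 w = 0 := fun w => by
    rw [← formVBilin_apply, map_zero, LinearMap.zero_apply]
  simp only [hPu, Pi.zero_apply, h0, integral_zero] at this
  linarith

/-- If `ψp` is the part of a solution `ψ` that propagates to the future, then the pairing of
`P ψp` with a solution is the charge of `ψ`. -/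
lemma pairing_opP_eq (hn : 2 ≤ n) {ψp ψ χ : Field n} (hψp : ψp ∈ sections σ) (hψ : ψ ∈ sections σ)
    (hχ : χ ∈ sections σ) (hPψ : opP γ ψ = 0) (hP : opP γ χ = 0) {a b : ℝ}
    (ha : ∀ y, y 0 < a → ψp y = 0) (hb : ∀ y, b < y 0 → ψp y = ψ y) (t : ℝ) :
    pairing γ (opP γ ψp) χ = sliceCharge γ t ψ χ := by
  set a' := min a b - 1 with ha'
  set b' := max a b + 1 with hb'
  have h1 : a' < a := by have := min_le_left a b; linarith
  have h2 : b < b' := by have := le_max_right a b; linarith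
  have hab : a' ≤ b' := by have := le_max_left a b; linarith
  have h0 : ∀ w : Fin (n + 1) → Spinor n, formV γ 0 w = 0 := fun w => by
    rw [← formVBilin_apply, map_zero, LinearMap.zero_apply]
  rw [pairing, integral_fundDomain_eq (a := a') (b := b'),
    integral_opP_eq_flux hn hψp hχ hP hab, ← sliceCharge_eq hn hψ hχ hPψ hP b' t]
  · have e1 : sliceCharge γ a' ψp χ = 0 := by
      unfold sliceCharge
      have : ∀ y : Fin n → ℝ, density γ (ψp (Fin.cons a' y)) (χ (Fin.cons a' y)) = 0 := fun y => by
        rw [ha _ (by simpa using h1), ← densityBilin_apply, map_zero, LinearMap.zero_apply]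
      simp [this]
    have e2 : sliceCharge γ b' ψp χ = sliceCharge γ b' ψ χ := by
      unfold sliceCharge
      have : ∀ y : Fin n → ℝ, ψp (Fin.cons b' y) = ψ (Fin.cons b' y) :=
        fun y => hb _ (by simpa using h2)
      simp only [this]
    rw [e1, e2, sub_zero]
  · intro x hx
    constructor
    · by_contra hlt
      exact hx (by rw [opP_eq_zero_of_past ha x (by linarith), h0])
    · by_contra hlt
      exact hx (by rw [opP_eq_of_future hb x (by linarith), hPψ]; exact h0 _)

end Flux

section Tau

variable {n : ℕ} {γ : GammaRep n} {σ : SpinStructure γ}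

lemma divergence_comp_past {ψ : Field n} {s a : ℝ} (h : ∀ y, s * y 0 < a → ψ y = 0) (x : Mink n)
    (hx : s * x 0 < a) : divergence ψ x = 0 := by
  have : ψ =ᶠ[nhds x] (0 : Field n) := by
    filter_upwards [(isOpen_lt (continuous_const.mul (continuous_apply 0))
      continuous_const).mem_nhds hx] with y hy
    exact h y hy
  unfold divergence
  simp only [pd_eq_of_eventuallyEq this, pd_zero]
  simp

/-- A one-sided solution of the Dirac equation with divergence-free source is divergence-free. -/
lemma divergence_eq_zero_of_oneSided {s : ℝ} (hs : s = 1 ∨ s = -1) {f ψ : Field n}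
    (hψ : ContDiff ℝ ∞ ψ) (hψs : OneSided s ψ) (h : dirac γ ψ = f) (hf : divergence f = 0) :
    divergence ψ = 0 := by
  obtain ⟨a, ha⟩ := hψs
  have hd := divergence_comp_past ha
  have h0 : ∀ y, slash γ (divergence ψ) y = 0 := fun y => by
    rw [slash_divergence hψ, h, hf]; rfl
  funext y
  rcases hs with rfl | rfl
  · exact eq_zero_of_slash_eq_zero γ (contDiff_divergence hψ)
      ⟨a, fun y hy => hd y (by simpa using hy)⟩ h0 y
  · exact eq_zero_of_slash_eq_zero_future γ (contDiff_divergence hψ)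
      ⟨-a, fun y hy => hd y (by linarith)⟩ h0 y

lemma divergence_of_mem_kerKdag {f : Field n} (hf : f ∈ kerKdag σ) : divergence f = 0 := by
  funext x
  have := congrFun hf.2 x
  exact neg_eq_zero.mp this

lemma IsGreen.oneSided {G : sections₀ σ →ₗ[ℝ] sections σ}
    (h : IsGreen Jplus G ∨ IsGreen Jminus G) (f : sections₀ σ) :
    ∃ s : ℝ, (s = 1 ∨ s = -1) ∧ OneSided s (G f).1 := by
  rcases h with h | h
  · obtain ⟨a, ha⟩ := h.oneSided_plus f
    exact ⟨1, Or.inl rfl, a, fun y hy => ha y (by linarith)⟩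
  · obtain ⟨a, ha⟩ := h.oneSided_minus f
    exact ⟨-1, Or.inr rfl, -a, fun y hy => ha y (by linarith)⟩

lemma IsGreen.divergence_eq {G : sections₀ σ →ₗ[ℝ] sections σ}
    (h : IsGreen Jplus G ∨ IsGreen Jminus G) (f : kerKdag σ) :
    divergence (G ⟨f.1, f.2.1⟩).1 = 0 := by
  obtain ⟨s, hs, hG⟩ := IsGreen.oneSided h ⟨f.1, f.2.1⟩
  refine divergence_eq_zero_of_oneSided (γ := γ) hs (G _).2.1 hG (f := f.1) ?_
    (divergence_of_mem_kerKdag f.2)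
  rcases h with h | h <;> exact h.dirac_eq _

lemma IsGreen.opP_eq {G : sections₀ σ →ₗ[ℝ] sections σ}
    (h : IsGreen Jplus G ∨ IsGreen Jminus G) (f : kerKdag σ) :
    opP γ (G ⟨f.1, f.2.1⟩).1 = f.1 := by
  rw [opP_eq_dirac (IsGreen.divergence_eq h f)]
  rcases h with h | h <;> exact h.dirac_eq _

lemma IsGreen.unique {G G' : sections₀ σ →ₗ[ℝ] sections σ}
    (h : (IsGreen Jplus G ∧ IsGreen Jplus G') ∨ (IsGreen Jminus G ∧ IsGreen Jminus G'))
    (f : sections₀ σ) : (G f).1 = (G' f).1 := by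
  rcases h with ⟨h, h'⟩ | ⟨h, h'⟩
  · obtain ⟨a, ha⟩ := h.oneSided_plus f
    obtain ⟨b, hb⟩ := h'.oneSided_plus f
    exact eq_of_dirac_eq_of_oneSided (γ := γ) (s := 1) (Or.inl rfl) (G f).2.1 (G' f).2.1
      ⟨a, fun y hy => ha y (by linarith)⟩ ⟨b, fun y hy => hb y (by linarith)⟩
      ((h.dirac_eq f).trans (h'.dirac_eq f).symm)
  · obtain ⟨a, ha⟩ := h.oneSided_minus f
    obtain ⟨b, hb⟩ := h'.oneSided_minus f
    exact eq_of_dirac_eq_of_oneSided (γ := γ) (s := -1) (Or.inr rfl) (G f).2.1 (G' f).2.1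
      ⟨-a, fun y hy => ha y (by linarith)⟩ ⟨-b, fun y hy => hb y (by linarith)⟩
      ((h.dirac_eq f).trans (h'.dirac_eq f).symm)

variable (σ) in
/-- The retarded Green's operator. -/
noncomputable def greenPlus : sections₀ σ →ₗ[ℝ] sections σ := (exists_isGreen_plus σ).choose

variable (σ) in
/-- The advanced Green's operator. -/
noncomputable def greenMinus : sections₀ σ →ₗ[ℝ] sections σ := (exists_isGreen_minus σ).choose

lemma isGreen_greenPlus : IsGreen Jplus (greenPlus σ) := (exists_isGreen_plus σ).choose_spec

lemma isGreen_greenMinus : IsGreen Jminus (greenMinus σ) := (exists_isGreen_minus σ).choose_spec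

variable (σ) in
/-- The solution `(G₊ - G₋) f` generated by a divergence-free source. -/
noncomputable def causalProp : kerKdag σ →ₗ[ℝ] sections σ :=
  (greenPlus σ - greenMinus σ).comp
    (Submodule.inclusion (fun _ hf => hf.1 : kerKdag σ ≤ sections₀ σ))

lemma causalProp_apply (f : kerKdag σ) : (causalProp σ f).1 =
    (greenPlus σ ⟨f.1, f.2.1⟩).1 - (greenMinus σ ⟨f.1, f.2.1⟩).1 := rfl

lemma divergence_sub {ψ φ : Field n} (hψ : ContDiff ℝ ∞ ψ) (hφ : ContDiff ℝ ∞ φ) :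
    divergence (ψ - φ) = divergence ψ - divergence φ := by
  have h1 : ψ - φ = ψ + (-1 : ℝ) • φ := by rw [neg_one_smul, sub_eq_add_neg]
  have h2 : ContDiff ℝ ∞ ((-1 : ℝ) • φ) := contDiff_const.smul hφ
  rw [h1, divergence_add hψ h2, divergence_smul hφ, neg_one_smul,
    sub_eq_add_neg]

lemma opP_sub {ψ φ : Field n} (hψ : ContDiff ℝ ∞ ψ) (hφ : ContDiff ℝ ∞ φ) :
    opP γ (ψ - φ) = opP γ ψ - opP γ φ := by
  have h1 : ψ - φ = ψ + (-1 : ℝ) • φ := by rw [neg_one_smul, sub_eq_add_neg]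
  have h2 : ContDiff ℝ ∞ ((-1 : ℝ) • φ) := contDiff_const.smul hφ
  rw [h1, opP_add γ hψ h2, opP_smul γ hφ, neg_one_smul, sub_eq_add_neg]

lemma divergence_causalProp (f : kerKdag σ) : divergence (causalProp σ f).1 = 0 := by
  rw [causalProp_apply, divergence_sub (greenPlus σ _).2.1 (greenMinus σ _).2.1,
    IsGreen.divergence_eq (Or.inl isGreen_greenPlus),
    IsGreen.divergence_eq (Or.inr isGreen_greenMinus), sub_zero]

lemma opP_causalProp (f : kerKdag σ) : opP γ (causalProp σ f).1 = 0 := by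
  rw [causalProp_apply, opP_sub (greenPlus σ _).2.1 (greenMinus σ _).2.1,
    IsGreen.opP_eq (Or.inl isGreen_greenPlus),
    IsGreen.opP_eq (Or.inr isGreen_greenMinus), sub_self]

lemma dirac_causalProp (f : kerKdag σ) : dirac γ (causalProp σ f).1 = 0 := by
  rw [← opP_eq_dirac (divergence_causalProp f), opP_causalProp]

/-- The source `f` arises by cutting off the solution that it generates: `f = P ψp` for a field
`ψp` that vanishes at early times and agrees with the solution at late times. -/
lemma exists_future_part (f : kerKdag σ) : ∃ ψp ∈ sections σ, opP γ ψp = f.1 ∧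
    (∃ a, ∀ y : Mink n, y 0 < a → ψp y = 0) ∧
    ∃ b, ∀ y : Mink n, b < y 0 → ψp y = (causalProp σ f).1 y := by
  refine ⟨_, (greenPlus σ ⟨f.1, f.2.1⟩).2, IsGreen.opP_eq (Or.inl isGreen_greenPlus) f,
    isGreen_greenPlus.oneSided_plus _, ?_⟩
  obtain ⟨b, hb⟩ := isGreen_greenMinus.oneSided_minus ⟨f.1, f.2.1⟩
  exact ⟨b, fun y hy => by rw [causalProp_apply, Pi.sub_apply, hb y hy, sub_zero]⟩

/-- The pairing of a source with a generated solution is the charge of the two generated solutions. -/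
lemma pairing_causalProp (hn : 2 ≤ n) (f h : kerKdag σ) (t : ℝ) :
    pairing γ f.1 (causalProp σ h).1 = sliceCharge γ t (causalProp σ f).1 (causalProp σ h).1 := by
  obtain ⟨ψp, hψp, hP, ⟨a, ha⟩, b, hb⟩ := exists_future_part f
  rw [← hP]
  exact pairing_opP_eq hn hψp (causalProp σ f).2 (causalProp σ h).2 (opP_causalProp f)
    (opP_causalProp h) ha hb t

lemma pairing_rangeP (hn : 2 ≤ n) {f : kerKdag σ} (hf : f ∈ rangeP σ) (h : kerKdag σ) :
    pairing γ f.1 (causalProp σ h).1 = 0 := by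
  obtain ⟨k, hk, hfk⟩ := hf
  obtain ⟨a, b, hab⟩ := exists_time_bounds hk.2
  rw [hfk, pairing_opP_eq hn hk.1 (zero_mem (sections σ)) (causalProp σ h).2 (opP_zero γ)
    (opP_causalProp h) (a := a) (b := b) ?_ ?_ 0]
  · simp only [sliceCharge, ← densityBilin_apply, Pi.zero_apply, map_zero, LinearMap.zero_apply]
    simp
  · intro y hy
    by_contra h0
    linarith [(hab y h0).1]
  · intro y hy
    by_contra h0
    linarith [(hab y h0).2]

variable (σ) in
/-- The charge of pairs of solutions as a bilinear form on sources. -/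
noncomputable def chargeForm : kerKdag σ →ₗ[ℝ] kerKdag σ →ₗ[ℝ] ℝ :=
  have hc : ∀ f : kerKdag σ, Continuous (causalProp σ f).1 := fun f =>
    (causalProp σ f).2.1.continuous
  LinearMap.mk₂ ℝ (fun f h => sliceCharge γ 0 (causalProp σ f).1 (causalProp σ h).1)
    (fun f g h => by
      rw [map_add]; exact sliceCharge_add_left (hc f) (hc g) (hc h) 0)
    (fun c f h => by
      rw [map_smul]; exact sliceCharge_smul_left c _ _ 0)
    (fun f g h => by
      rw [map_add]
      simp only [sliceCharge_comm 0 (causalProp σ f).1]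
      exact sliceCharge_add_left (hc g) (hc h) (hc f) 0)
    (fun c f h => by
      rw [map_smul]
      simp only [sliceCharge_comm 0 (causalProp σ f).1]
      exact sliceCharge_smul_left c _ _ 0)

lemma chargeForm_apply (f h : kerKdag σ) : chargeForm σ f h =
    sliceCharge γ 0 (causalProp σ f).1 (causalProp σ h).1 := rfl

lemma chargeForm_comm (f h : kerKdag σ) : chargeForm σ f h = chargeForm σ h f := by
  rw [chargeForm_apply, chargeForm_apply, sliceCharge_comm]

/-- The form `τ` is the charge of the generated solutions. -/
lemma isTau_iff (hn : 2 ≤ n) (τ : Obs σ →ₗ[ℝ] Obs σ →ₗ[ℝ] ℝ) :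
    IsTau σ τ ↔ ∀ f h : kerKdag σ,
      τ ((rangeP σ).mkQ f) ((rangeP σ).mkQ h) = chargeForm σ f h := by
  constructor
  · rintro ⟨Gp, Gm, hp, hm, h⟩ f g
    rw [h, chargeForm_apply, ← pairing_causalProp hn, causalProp_apply,
      IsGreen.unique (Or.inl ⟨hp, isGreen_greenPlus⟩),
      IsGreen.unique (Or.inr ⟨hm, isGreen_greenMinus⟩)]
  · intro h
    refine ⟨greenPlus σ, greenMinus σ, isGreen_greenPlus, isGreen_greenMinus, fun f g => ?_⟩
    rw [h, chargeForm_apply, ← pairing_causalProp hn, causalProp_apply]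

theorem existsUnique_isTau (hn : 2 ≤ n) (σ : SpinStructure γ) :
    ∃! τ : Obs σ →ₗ[ℝ] Obs σ →ₗ[ℝ] ℝ, IsTau σ τ := by
  have hker : ∀ f ∈ rangeP σ, ∀ h, chargeForm σ f h = 0 := fun f hf h => by
    rw [chargeForm_apply, ← pairing_causalProp hn, pairing_rangeP hn hf]
  let τ₁ : Obs σ →ₗ[ℝ] kerKdag σ →ₗ[ℝ] ℝ := (rangeP σ).liftQ (chargeForm σ)
    fun f hf => LinearMap.mem_ker.mpr (LinearMap.ext fun h => hker f hf h)
  have hτ₁ : ∀ f h, τ₁ ((rangeP σ).mkQ f) h = chargeForm σ f h := fun _ _ => rfl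
  let τ : Obs σ →ₗ[ℝ] Obs σ →ₗ[ℝ] ℝ := ((rangeP σ).liftQ τ₁.flip fun h hh => by
    refine LinearMap.mem_ker.mpr (LinearMap.ext fun e => ?_)
    obtain ⟨f, rfl⟩ := (rangeP σ).mkQ_surjective e
    rw [LinearMap.flip_apply, hτ₁, chargeForm_comm, hker h hh]; rfl).flip
  have hτ : ∀ f h : kerKdag σ,
      τ ((rangeP σ).mkQ f) ((rangeP σ).mkQ h) = chargeForm σ f h := fun _ _ => rfl
  refine ⟨τ, (isTau_iff hn τ).mpr hτ, fun τ' hτ' => ?_⟩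
  replace hτ' := (isTau_iff hn τ').mp hτ'
  refine LinearMap.ext fun e => LinearMap.ext fun e' => ?_
  obtain ⟨f, rfl⟩ := (rangeP σ).mkQ_surjective e
  obtain ⟨h, rfl⟩ := (rangeP σ).mkQ_surjective e'
  rw [hτ', hτ]

/-- Symmetry of `τ` is automatic, so only positivity of the charge is at stake. -/
lemma isPositiveType_iff (hn : 2 ≤ n) (σ : SpinStructure γ) :
    IsPositiveType σ ↔ ∀ f : kerKdag σ, f ∉ rangeP σ →
      0 < sliceCharge γ 0 (causalProp σ f).1 (causalProp σ f).1 := by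
  have hne : ∀ f : kerKdag σ, (rangeP σ).mkQ f ≠ 0 ↔ f ∉ rangeP σ := fun f => by
    rw [Ne, Submodule.mkQ_apply, Submodule.Quotient.mk_eq_zero]
  constructor
  · rintro ⟨τ, hτ, -, hpos⟩ f hf
    have := hpos _ ((hne f).mpr hf)
    rwa [(isTau_iff hn τ).mp hτ] at this
  · intro h
    obtain ⟨τ, hτ, -⟩ := existsUnique_isTau hn σ
    have hτ' := (isTau_iff hn τ).mp hτ
    refine ⟨τ, hτ, fun e e' => ?_, fun e he => ?_⟩
    · obtain ⟨f, rfl⟩ := (rangeP σ).mkQ_surjective e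
      obtain ⟨g, rfl⟩ := (rangeP σ).mkQ_surjective e'
      rw [hτ', hτ', chargeForm_comm]
    · obtain ⟨f, rfl⟩ := (rangeP σ).mkQ_surjective e
      rw [hτ']
      exact h f ((hne f).mp he)

end Tau

/-! ### Solutions of spacelike compact support and constant solutions -/

section Solutions

open MeasureTheory

variable {n : ℕ} {γ : GammaRep n} {σ : SpinStructure γ}

/-- The field cut off smoothly between the times `0` and `1` so as to vanish before. -/
noncomputable def cutLate (ψ : Field n) : Field n := fun x => Real.smoothTransition (x 0) • ψ x

lemma cutLate_past (ψ : Field n) {y : Mink n} (hy : y 0 ≤ 0) : cutLate ψ y = 0 := by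
  rw [cutLate, Real.smoothTransition.zero_of_nonpos hy, zero_smul]

lemma cutLate_future (ψ : Field n) {y : Mink n} (hy : 1 ≤ y 0) : cutLate ψ y = ψ y := by
  rw [cutLate, Real.smoothTransition.one_of_one_le hy, one_smul]

lemma cutLate_mem {ψ : Field n} (hψ : ψ ∈ sections σ) : cutLate ψ ∈ sections σ := by
  rw [mem_sections_iff] at hψ ⊢
  refine ⟨(Real.smoothTransition.contDiff.comp (contDiff_apply ℝ ℝ 0)).smul hψ.1,
    fun x μ => Submodule.smul_mem _ _ (hψ.2.1 x μ), fun k x => ?_⟩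
  rw [cutLate, cutLate, hψ.2.2, smul_comm]
  simp [deck]

lemma opP_mem {ψ : Field n} (hψ : ψ ∈ sections σ) : opP γ ψ ∈ sections σ := by
  rw [mem_sections_iff] at hψ ⊢
  refine ⟨contDiff_opP hψ.1, fun x μ => ?_, fun k x => ?_⟩
  · have h : ∀ ν ρ, pd ν ψ x ρ ∈ γ.majorana := fun ν ρ => by
      rw [pd_field hψ.1]
      exact pd_mem_majorana γ ((contDiff_comp_field hψ.1 ρ).differentiable (by simp) x)
        (fun y => hψ.2.1 y ρ) ν
    rw [opP_eq_sum, Finset.sum_apply]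
    exact Submodule.sum_mem _ fun ν _ => Submodule.sub_mem _ (γ.gam_mem_majorana ν (h ν μ))
      (γ.low_mem_majorana μ (Submodule.smul_mem _ _ (h ν ν)))
  · have h1 : opP γ (fun y => ψ (deck k y)) x = opP γ ψ (deck k x) := by
      rw [opP_eq_sum, opP_eq_sum]
      simp only [pd_comp_deck]
    have h2 : (fun y => ψ (deck k y)) = σ.sgn k • ψ := funext (hψ.2.2 k)
    rw [← h1, h2, opP_smul γ hψ.1]; rfl

lemma opP_cutLate_bounds {ψ : Field n} (hP : opP γ ψ = 0) (x : Mink n)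
    (hx : opP γ (cutLate ψ) x ≠ 0) : 0 ≤ x 0 ∧ x 0 ≤ 1 := by
  constructor
  · by_contra h
    exact hx (opP_eq_zero_of_past (a := 0) (fun y hy => cutLate_past ψ hy.le) x (not_le.mp h))
  · by_contra h
    refine hx ?_
    rw [opP_eq_of_future (b := 1) (fun y hy => cutLate_future ψ hy.le) x (not_le.mp h), hP]; rfl

/-- The source `P (θ ψ)` that generates a given solution `ψ`. -/
noncomputable def sourceOf {ψ : Field n} (hψ : ψ ∈ sections σ) (hP : opP γ ψ = 0) : kerKdag σ :=
  ⟨opP γ (cutLate ψ), ⟨opP_mem (cutLate_mem hψ), isCompact_supp (opP_cutLate_bounds hP)⟩, by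
    funext x
    rw [opKdag, divergence_opP (cutLate_mem hψ).1]
    exact neg_zero⟩

/-- The norm of the source is the charge of the solution it was made from. The generated solution
need not be `ψ` itself, but its charges with all solutions are those of `ψ`. -/
lemma chargeForm_sourceOf (hn : 2 ≤ n) {ψ : Field n} (hψ : ψ ∈ sections σ) (hP : opP γ ψ = 0) :
    chargeForm σ (sourceOf hψ hP) (sourceOf hψ hP) = sliceCharge γ 0 ψ ψ := by
  set f := sourceOf hψ hP with hf
  have hcut : ∀ χ : Field n, χ ∈ sections σ → opP γ χ = 0 →
      pairing γ f.1 χ = sliceCharge γ 0 ψ χ := fun χ hχ hPχ =>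
    pairing_opP_eq hn (cutLate_mem hψ) hψ hχ hP hPχ (a := 0) (b := 1)
      (fun y hy => cutLate_past ψ hy.le) (fun y hy => cutLate_future ψ hy.le) 0
  obtain ⟨ψp, hψp, hPp, ⟨a, ha⟩, b, hb⟩ := exists_future_part f
  rw [chargeForm_apply, ← pairing_causalProp hn, hcut _ (causalProp σ f).2 (opP_causalProp f),
    sliceCharge_comm, ← pairing_opP_eq hn hψp (causalProp σ f).2 hψ (opP_causalProp f) hP ha hb 0,
    hPp, hcut _ hψ hP]

lemma supp_subset_closed {ψ : Field n} {S : Set (Spacetime n)} (hS : IsClosed S)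
    (h : ∀ x, ψ x ≠ 0 → proj x ∈ S) : supp ψ ⊆ S := by
  refine closure_minimal ?_ hS
  rintro _ ⟨x, hx, rfl⟩
  exact h x hx

lemma Jplus_union_Jminus_slab {I : Set ℝ} {a : ℝ} (ha : a ∈ I) (S : Set (Spacetime n)) :
    S ⊆ Jplus (I ×ˢ (Set.univ : Set (Fin n → AddCircle (2 * Real.pi)))) ∪ Jminus (I ×ˢ Set.univ) := by
  intro q _
  rcases le_total a q.1 with h | h
  · exact Or.inl (mem_Jplus_slab ha h)
  · exact Or.inr (mem_Jminus_slab ha h)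

lemma isSol_of_opP_eq_zero {ψ : Field n} (hψ : ψ ∈ sections σ) (hP : opP γ ψ = 0) : IsSol σ ψ :=
  ⟨hψ, ⟨Set.Icc 0 1 ×ˢ Set.univ, isCompact_Icc.prod isCompact_univ,
    Jplus_union_Jminus_slab (Set.left_mem_Icc.mpr zero_le_one) _⟩, hP⟩

/-- The pairing of two solutions is their charge, for any splitting of the first one. -/
lemma isSolPairing_sliceCharge (hn : 2 ≤ n) {ψ χ : Field n} (hψ : ψ ∈ sections σ)
    (hχ : χ ∈ sections σ) (hP : opP γ ψ = 0) (hPχ : opP γ χ = 0) :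
    IsSolPairing σ ψ χ (sliceCharge γ 0 ψ χ) := by
  refine ⟨⟨cutLate ψ, ψ - cutLate ψ, hψ, cutLate_mem hψ, sub_mem hψ (cutLate_mem hψ), by simp,
    Set.Icc 0 1 ×ˢ Set.univ, isCompact_Icc.prod isCompact_univ,
    Jplus_union_Jminus_slab (Set.left_mem_Icc.mpr zero_le_one) _, ?_, ?_⟩, ?_⟩
  · refine (supp_subset_closed (S := {p | 0 ≤ p.1})
      (isClosed_le continuous_const continuous_fst) fun x hx => ?_).trans
      fun q hq => mem_Jplus_slab (Set.left_mem_Icc.mpr zero_le_one) hq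
    by_contra h
    exact hx (cutLate_past ψ (not_le.mp h).le)
  · refine (supp_subset_closed (S := {p | p.1 ≤ 1})
      (isClosed_le continuous_fst continuous_const) fun x hx => ?_).trans
      fun q hq => mem_Jminus_slab (Set.right_mem_Icc.mpr zero_le_one) hq
    by_contra h
    exact hx (by rw [Pi.sub_apply, cutLate_future ψ (not_le.mp h).le, sub_self])
  · rintro ψp ψm ⟨-, hp, hm, hsum, C, hC, -, hpC, hmC⟩
    obtain ⟨a, ha⟩ := (hC.image continuous_fst).bddBelow
    obtain ⟨b, hb⟩ := (hC.image continuous_fst).bddAbove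
    refine pairing_opP_eq hn hp hψ hχ hP hPχ (a := a) (b := b) (fun y hy => ?_)
      (fun y hy => ?_) 0
    · by_contra h0
      have := le_of_mem_Jplus C a (fun p hp => by rw [one_mul]; exact ha ⟨p, hp, rfl⟩) _
        (hpC (subset_closure ⟨y, h0, rfl⟩))
      rw [one_mul, proj_fst] at this
      linarith
    · have hm0 : ψm y = 0 := by
        by_contra h0
        have := le_of_mem_Jminus C (-b)
          (fun p hp => by have : p.1 ≤ b := hb ⟨p, hp, rfl⟩; linarith) _
          (hmC (subset_closure ⟨y, h0, rfl⟩))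
        rw [proj_fst] at this
        linarith
      rw [hsum, Pi.add_apply, hm0, add_zero]

lemma const_mem_sections {ψ : Fin (n + 1) → Spinor n} (hψ : ∀ μ, ψ μ ∈ γ.majorana) :
    (fun _ => ψ : Field n) ∈ sections (SpinStructure.trivial γ) := by
  rw [mem_sections_iff]
  refine ⟨contDiff_const, fun _ => hψ, fun k x => ?_⟩
  rw [SpinStructure.sgn_trivial, one_smul]

lemma opP_const (ψ : Fin (n + 1) → Spinor n) : opP γ (fun _ => ψ : Field n) = 0 := by
  funext x
  rw [opP_eq_sum]
  refine Finset.sum_eq_zero fun ν _ => ?_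
  have : pd ν (fun _ => ψ : Field n) x = 0 := by simp [pd]
  rw [this]
  exact map_zero (symbolPLin γ ν)

lemma sliceCharge_const (t : ℝ) (ψ : Fin (n + 1) → Spinor n) :
    sliceCharge γ t (fun _ => ψ) (fun _ => ψ) = (2 * Real.pi) ^ n * density γ ψ ψ := by
  unfold sliceCharge
  rw [setIntegral_const, Measure.real, Real.volume_Icc_pi_toReal (a := 0) (fun i => Real.two_pi_pos.le)]
  simp

lemma isSolPairing_const (hn : 2 ≤ n) {ψ : Fin (n + 1) → Spinor n} (hψ : ∀ μ, ψ μ ∈ γ.majorana) :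
    IsSolPairing (SpinStructure.trivial γ) (fun _ => ψ) (fun _ => ψ)
      ((2 * Real.pi) ^ n * density γ ψ ψ) := by
  rw [← sliceCharge_const (γ := γ) 0]
  exact isSolPairing_sliceCharge hn (const_mem_sections hψ) (const_mem_sections hψ) (opP_const ψ)
    (opP_const ψ)

lemma ip_self_pos {N : ℕ} {v : Fin N → ℂ} (hv : v ≠ 0) : 0 < ip v v :=
  lt_of_le_of_ne (ip_self_nonneg v) fun h => hv (ip_self_eq_zero.mp h.symm)

lemma inv_dim_pos (hn : 2 ≤ n) : 0 < (((n + 1 : ℕ) : ℝ) - 2)⁻¹ := by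
  have : (2 : ℝ) ≤ n := by exact_mod_cast hn
  refine inv_pos.mpr ?_
  push_cast
  linarith

/-- A gamma-traceless spatial polarisation has positive charge. -/
lemma exists_positive_const (hn : 2 ≤ n) (γ : GammaRep n) : ∃ ψ : Fin (n + 1) → Spinor n,
    (∀ μ, ψ μ ∈ γ.majorana) ∧ ψ 0 = 0 ∧ gammaTrace γ ψ = 0 ∧ 0 < density γ ψ ψ := by
  obtain ⟨χ, hχ, hχ0⟩ := γ.exists_majorana_ne_zero
  let i : Fin (n + 1) := Fin.succ ⟨0, by omega⟩
  let j : Fin (n + 1) := Fin.succ ⟨1, by omega⟩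
  have hij : i ≠ j := by simp [i, j]
  have hi0 : i ≠ 0 := Fin.succ_ne_zero _
  have hj0 : j ≠ 0 := Fin.succ_ne_zero _
  let ψ : Fin (n + 1) → Spinor n :=
    Pi.single i χ + Pi.single j ((γ.gam i).mulVec ((γ.gam j).mulVec χ))
  have hsum : ∀ F : Fin (n + 1) → Spinor n → ℝ, (∀ μ, F μ 0 = 0) → ∑ μ, F μ (ψ μ) =
      F i χ + F j ((γ.gam i).mulVec ((γ.gam j).mulVec χ)) := by
    intro F hF
    rw [← Finset.sum_subset (Finset.subset_univ {i, j}), Finset.sum_pair hij]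
    · simp [ψ, hij, hij.symm]
    · intro μ _ hμ
      simp only [Finset.mem_insert, Finset.mem_singleton, not_or] at hμ
      simp [ψ, hμ.1, hμ.2, hF]
  have htr : gammaTrace γ ψ = 0 := by
    have : gammaTrace γ ψ = (γ.gam i).mulVec χ +
        (γ.gam j).mulVec ((γ.gam i).mulVec ((γ.gam j).mulVec χ)) := by
      unfold gammaTrace
      rw [← Finset.sum_subset (Finset.subset_univ {i, j}), Finset.sum_pair hij]
      · simp [ψ, hij, hij.symm]
      · intro μ _ hμ
        simp only [Finset.mem_insert, Finset.mem_singleton, not_or] at hμ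
        simp [ψ, hμ.1, hμ.2]
    have hj : eta j = 1 := eta_succ _
    rw [this, γ.anticomm_apply hij.symm, γ.sq_apply, hj, one_smul, add_neg_cancel]
  refine ⟨ψ, fun μ => ?_, by simp [ψ, hi0.symm, hj0.symm], htr, ?_⟩
  · refine Submodule.add_mem _ ?_ ?_
    · by_cases h : μ = i
      · subst h; simpa using hχ
      · simp [h]
    · by_cases h : μ = j
      · subst h
        simpa using γ.gam_mem_majorana _ (γ.gam_mem_majorana _ hχ)
      · simp [h]
  · rw [density, htr, hsum (fun μ v => eta μ * ip v v) (by simp)]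
    have hi : eta i = 1 := eta_succ _
    have hj : eta j = 1 := eta_succ _
    have h1 := ip_self_pos hχ0
    have h2 := ip_self_nonneg ((γ.gam i).mulVec ((γ.gam j).mulVec χ))
    rw [hi, hj, ip_zero_left]
    linarith

/-- A purely temporal polarisation has negative charge. -/
lemma exists_negative_const (hn : 2 ≤ n) (γ : GammaRep n) : ∃ ψ : Fin (n + 1) → Spinor n,
    (∀ μ, ψ μ ∈ γ.majorana) ∧ (∀ i : Fin n, ψ i.succ = 0) ∧ density γ ψ ψ < 0 := by
  obtain ⟨χ, hχ, hχ0⟩ := γ.exists_majorana_ne_zero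
  refine ⟨Pi.single 0 χ, fun μ => ?_, fun i => by simp, ?_⟩
  · by_cases h : μ = 0
    · subst h; simpa using hχ
    · simp [h]
  · rw [density, Fin.sum_univ_succ]
    simp only [Pi.single_eq_same, eta_zero, Pi.single_eq_of_ne (Fin.succ_ne_zero _),
      ip_zero_left, mul_zero, Finset.sum_const_zero, add_zero]
    have h1 := ip_self_pos hχ0
    have h2 := mul_nonneg (inv_dim_pos hn).le
      (ip_self_nonneg (gammaTrace γ (Pi.single 0 χ : Fin (n + 1) → Spinor n)))
    linarith

/-- The constant field of negative charge is generated by a source of negative norm. -/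
theorem not_isPositiveType_trivial (hn : 2 ≤ n) (γ : GammaRep n) :
    ¬ IsPositiveType (SpinStructure.trivial γ) := by
  intro h
  obtain ⟨ψ, hψ, -, hneg⟩ := exists_negative_const hn γ
  have hs := const_mem_sections hψ
  have hP := opP_const (γ := γ) ψ
  have hc := chargeForm_sourceOf hn hs hP
  rw [sliceCharge_const] at hc
  have hlt : (2 * Real.pi) ^ n * density γ ψ ψ < 0 :=
    mul_neg_of_pos_of_neg (pow_pos Real.two_pi_pos n) hneg
  by_cases hr : sourceOf hs hP ∈ rangeP (SpinStructure.trivial γ)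
  · rw [chargeForm_apply, ← pairing_causalProp hn, pairing_rangeP hn hr] at hc
    linarith
  · have := (isPositiveType_iff hn _).mp h _ hr
    rw [← chargeForm_apply, hc] at this
    linarith

end Solutions

/-! ### Fourier series of twisted periodic functions -/

section Parseval

open MeasureTheory

variable {n : ℕ}

section Unit

open UnitAddTorus

/-- The measure on the circle of length one for which Fourier series are set up in Mathlib. -/
noncomputable local instance : MeasureSpace UnitAddCircle := ⟨AddCircle.haarAddCircle⟩

local instance : IsProbabilityMeasure (volume : Measure UnitAddCircle) :=
  inferInstanceAs (IsProbabilityMeasure AddCircle.haarAddCircle)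

/-- Parseval's identity for continuous periodic functions on the unit cube. -/
lemma hasSum_sq_integral_unitCube {g : (Fin n → ℝ) → ℂ} (hg : Continuous g)
    (hper : ∀ (k : Fin n → ℤ) y, g (fun i => y i + k i) = g y) :
    HasSum (fun m : Fin n → ℤ => ‖∫ y in Set.Icc (0 : Fin n → ℝ) 1,
      Complex.exp (-(2 * Real.pi * Complex.I * ∑ i, (m i : ℂ) * y i)) * g y‖ ^ 2)
      (∫ y in Set.Icc (0 : Fin n → ℝ) 1, ‖g y‖ ^ 2) := by
  let p : (Fin n → ℝ) → UnitAddTorus (Fin n) := fun y i => (y i : UnitAddCircle)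
  have hopen : IsOpenMap p := IsOpenMap.piMap (fun _ => QuotientAddGroup.isOpenMap_coe) (by simp)
  have hcont : Continuous p :=
    continuous_pi fun i => (AddCircle.continuous_mk' _).comp (continuous_apply i)
  have hsurj : Function.Surjective p := by
    intro φ
    choose y hy using fun i => QuotientAddGroup.mk_surjective (φ i)
    exact ⟨y, funext hy⟩
  have hfac : ∀ y y', p y = p y' → g y = g y' := by
    intro y y' h
    have h1 : ∀ i, ∃ k : ℤ, y i = y' i + k := by
      intro i
      have h2 : ((y i - y' i : ℝ) : UnitAddCircle) = 0 := by
        rw [AddCircle.coe_sub, sub_eq_zero]; exact congrFun h i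
      obtain ⟨k, hk⟩ := (AddCircle.coe_eq_zero_iff (1 : ℝ)).mp h2
      refine ⟨k, ?_⟩
      rw [zsmul_eq_mul, mul_one] at hk
      linarith
    choose k hk using h1
    rw [show y = fun i => y' i + k i from funext hk, hper]
  let G₀ : UnitAddTorus (Fin n) → ℂ := fun φ => g (hsurj φ).choose
  have hG₀ : ∀ y, G₀ (p y) = g y := fun y => hfac _ _ (hsurj (p y)).choose_spec
  have hG₀c : Continuous G₀ := by
    rw [(hopen.isQuotientMap hcont hsurj).continuous_iff]
    exact hg.congr fun y => (hG₀ y).symm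
  let G : C(UnitAddTorus (Fin n), ℂ) := ⟨G₀, hG₀c⟩
  have hset : {x : Fin n → ℝ | ∀ i, x i ∈ Set.Ioc ((0 : Fin n → ℝ) i) ((0 : Fin n → ℝ) i + 1)} =
      Set.univ.pi fun i => Set.Ioc ((0 : Fin n → ℝ) i) ((1 : Fin n → ℝ) i) := by
    ext x; simp
  have hae : {x : Fin n → ℝ | ∀ i, x i ∈ Set.Ioc ((0 : Fin n → ℝ) i) ((0 : Fin n → ℝ) i + 1)}
      =ᵐ[volume] Set.Icc (0 : Fin n → ℝ) 1 := by
    rw [hset, volume_pi]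
    exact Measure.univ_pi_Ioc_ae_eq_Icc
  have key := hasSum_sq_mFourierCoeff (ContinuousMap.toLp 2 volume ℂ G)
  have e1 : ∫ t, ‖(ContinuousMap.toLp 2 volume ℂ G : UnitAddTorus (Fin n) → ℂ) t‖ ^ 2 =
      ∫ y in Set.Icc (0 : Fin n → ℝ) 1, ‖g y‖ ^ 2 := by
    have h1 : ∫ t, ‖(ContinuousMap.toLp 2 volume ℂ G : UnitAddTorus (Fin n) → ℂ) t‖ ^ 2 =
        ∫ t, ‖G t‖ ^ 2 := by
      refine integral_congr_ae ?_
      filter_upwards [ContinuousMap.coeFn_toLp (p := 2) (𝕜 := ℂ) volume G] with t ht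
      rw [ht]
    rw [h1, integral_preimage _ 0, setIntegral_congr_set hae]
    refine setIntegral_congr_fun measurableSet_Icc fun y _ => ?_
    change ‖G₀ (p y)‖ ^ 2 = _
    rw [hG₀]
  rw [e1] at key
  convert key using 2 with m
  rw [mFourierCoeff_toLp, mFourierCoeff_eq_integral _ _ 0, setIntegral_congr_set hae]
  congr 2
  refine setIntegral_congr_fun measurableSet_Icc fun y _ => ?_
  have h2 : mFourier (-m) (p y) =
      Complex.exp (-(2 * Real.pi * Complex.I * ∑ i, (m i : ℂ) * y i)) := by
    simp only [mFourier, ContinuousMap.coe_mk, p, fourier_coe_apply]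
    rw [← Complex.exp_sum]
    congr 1
    rw [Finset.mul_sum, ← Finset.sum_neg_distrib]
    refine Finset.sum_congr rfl fun i _ => ?_
    push_cast [Pi.neg_apply]
    ring
  change _ = mFourier (-m) (p y) • G₀ (p y)
  rw [hG₀, h2, smul_eq_mul]

end Unit

variable {γ : GammaRep n} (σ : SpinStructure γ)

/-- The fundamental cell of the torus. -/
def torusCell (n : ℕ) : Set (Fin n → ℝ) := Set.Icc 0 fun _ => 2 * Real.pi

/-- Wave vectors `κ ∈ ℤ^n + θ / 2`, where `θ_i = 1` along the circles with sign `-1`. -/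
noncomputable def waveVec (m : Fin n → ℤ) (i : Fin n) : ℝ :=
  m i + if σ.sgn (Pi.single i 1) = 1 then 0 else 1 / 2

/-- The plane wave `exp (-i κ · y)`. -/
noncomputable def mode (m : Fin n → ℤ) (y : Fin n → ℝ) : ℂ :=
  Complex.exp (-(Complex.I * ∑ i, (waveVec σ m i : ℂ) * y i))

/-- Functions which acquire the sign of the spin structure under translation by periods. -/
def IsTwisted {E : Type*} [AddCommGroup E] [Module ℝ E] (f : (Fin n → ℝ) → E) : Prop :=
  ∀ (k : Fin n → ℤ) y, f (fun i => y i + 2 * Real.pi * (k i : ℝ)) = σ.sgn k • f y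

lemma exp_waveVec_period (m k : Fin n → ℤ) :
    Complex.exp (-(Complex.I * ∑ i, (waveVec σ m i : ℂ) * (2 * Real.pi * k i))) = (σ.sgn k : ℂ) := by
  let φ₁ : (Fin n → ℤ) →+ Additive ℂ :=
    { toFun := fun k => Additive.ofMul
        (Complex.exp (-(Complex.I * ∑ i, (waveVec σ m i : ℂ) * (2 * Real.pi * k i))))
      map_zero' := by simp
      map_add' := fun k l => by
        rw [← ofMul_mul, ← Complex.exp_add]
        congr 2
        rw [← neg_add, ← mul_add, ← Finset.sum_add_distrib]
        congr 2
        refine Finset.sum_congr rfl fun i _ => ?_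
        push_cast [Pi.add_apply]
        ring }
  let φ₂ : (Fin n → ℤ) →+ Additive ℂ :=
    { toFun := fun k => Additive.ofMul (σ.sgn k : ℂ)
      map_zero' := by simp [σ.sgn_zero]
      map_add' := fun k l => by rw [σ.sgn_add, Complex.ofReal_mul, ofMul_mul] }
  have h : φ₁ = φ₂ := by
    refine AddMonoidHom.functions_ext' _ _ _ fun i => AddMonoidHom.ext_int ?_
    change Additive.ofMul (Complex.exp (-(Complex.I * ∑ j, (waveVec σ m j : ℂ) *
      (2 * Real.pi * ((Pi.single i (1 : ℤ) : Fin n → ℤ) j : ℂ))))) =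
        Additive.ofMul (σ.sgn (Pi.single i 1) : ℂ)
    congr 1
    rw [Finset.sum_eq_single i]
    · rw [Pi.single_eq_same, waveVec]
      rcases σ.sgn_eq (Pi.single i 1) with h | h
      · rw [h, if_pos rfl]
        have : -(Complex.I * ((((m i : ℝ) + 0 : ℝ) : ℂ) * (2 * Real.pi * ((1 : ℤ) : ℂ)))) =
            ((-m i : ℤ) : ℂ) * (2 * Real.pi * Complex.I) := by push_cast; ring
        rw [this, Complex.exp_int_mul_two_pi_mul_I]; simp
      · rw [h, if_neg (by norm_num)]
        have : -(Complex.I * ((((m i : ℝ) + 1 / 2 : ℝ) : ℂ) * (2 * Real.pi * ((1 : ℤ) : ℂ)))) =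
            ((-m i - 1 : ℤ) : ℂ) * (2 * Real.pi * Complex.I) + Real.pi * Complex.I := by
          push_cast; ring
        rw [this, Complex.exp_add, Complex.exp_int_mul_two_pi_mul_I, Complex.exp_pi_mul_I]; simp
    · intro j _ hj
      simp [hj]
    · simp
  exact congrArg Additive.toMul (DFunLike.congr_fun h k)

lemma mode_add_period (m k : Fin n → ℤ) (y : Fin n → ℝ) :
    mode σ m (fun i => y i + 2 * Real.pi * (k i : ℝ)) = σ.sgn k * mode σ m y := by
  rw [← exp_waveVec_period σ m k, mode, mode, ← Complex.exp_add]
  congr 1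
  rw [← neg_add, ← mul_add, ← Finset.sum_add_distrib]
  congr 2
  refine Finset.sum_congr rfl fun i _ => ?_
  push_cast
  ring

lemma contDiff_mode (m : Fin n → ℤ) : ContDiff ℝ ∞ (mode σ m) := by
  unfold mode
  refine ContDiff.cexp ((contDiff_const.mul (ContDiff.sum fun i _ => contDiff_const.mul ?_)).neg)
  exact Complex.ofRealCLM.contDiff.comp (contDiff_apply ℝ ℝ i)

lemma pd_mode (m : Fin n → ℤ) (j : Fin n) (y : Fin n → ℝ) :
    pd j (mode σ m) y = -(Complex.I * waveVec σ m j) * mode σ m y := by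
  have h : HasFDerivAt (fun y : Fin n → ℝ => -(Complex.I * ∑ i, (waveVec σ m i : ℂ) * (y i : ℂ)))
      (-(Complex.I • ∑ i, (waveVec σ m i : ℂ) •
        (Complex.ofRealCLM.comp (ContinuousLinearMap.proj (R := ℝ) (φ := fun _ : Fin n => ℝ) i)))) y := by
    refine ((HasFDerivAt.fun_sum fun i _ => ?_).const_mul Complex.I).neg
    exact ((Complex.ofRealCLM.comp
      (ContinuousLinearMap.proj (R := ℝ) (φ := fun _ : Fin n => ℝ) i)).hasFDerivAt).const_mul _
  unfold pd mode
  rw [h.cexp.fderiv]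
  have h1 : ∑ i, (waveVec σ m i : ℂ) * (((Pi.single j (1 : ℝ) : Fin n → ℝ) i : ℝ) : ℂ) =
      waveVec σ m j := by
    rw [Finset.sum_eq_single j]
    · simp
    · intro i _ hi; simp [hi]
    · simp
  simp only [smul_apply, neg_apply, sum_apply, ContinuousLinearMap.comp_apply,
    ContinuousLinearMap.proj_apply, Complex.ofRealCLM_apply, smul_eq_mul]
  rw [h1]
  ring

/-- Fourier coefficients of twisted functions. -/
noncomputable def modeCoeff {E : Type*} [NormedAddCommGroup E] [NormedSpace ℂ E] (m : Fin n → ℤ)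
    (f : (Fin n → ℝ) → E) : E := ∫ y in torusCell n, mode σ m y • f y

open scoped Pointwise in
lemma smul_unitCube {R : ℝ} (hR : 0 < R) :
    R • Set.Icc (0 : Fin n → ℝ) 1 = Set.Icc 0 fun _ => R := by
  ext y
  rw [Set.mem_smul_set_iff_inv_smul_mem₀ hR.ne']
  simp only [Set.mem_Icc, Pi.le_def, Pi.zero_apply, Pi.one_apply, Pi.smul_apply, smul_eq_mul]
  refine and_congr (forall_congr' fun i => ?_) (forall_congr' fun i => ?_)
  · rw [mul_nonneg_iff_of_pos_left (inv_pos.mpr hR)]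
  · rw [inv_mul_le_iff₀ hR, mul_one]

variable {σ}

/-- Parseval's identity for twisted functions. -/
lemma hasSum_sq_modeCoeff {h : (Fin n → ℝ) → ℂ} (hc : Continuous h) (ht : IsTwisted σ h) :
    HasSum (fun m => ‖modeCoeff σ m h‖ ^ 2)
      ((2 * Real.pi) ^ n * ∫ y in torusCell n, ‖h y‖ ^ 2) := by
  have hR := Real.two_pi_pos
  have hscale : ∀ {E : Type} [NormedAddCommGroup E] [NormedSpace ℝ E] (F : (Fin n → ℝ) → E),
      ∫ y in Set.Icc (0 : Fin n → ℝ) 1, F ((2 * Real.pi) • y) =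
        ((2 * Real.pi) ^ n)⁻¹ • ∫ y in torusCell n, F y := by
    intro E _ _ F
    rw [Measure.setIntegral_comp_smul_of_pos volume F _ hR, smul_unitCube hR, torusCell]
    simp only [Module.finrank_fin_fun]
  -- the factor `exp (-i θ · y / 2)` makes the function periodic
  let g : (Fin n → ℝ) → ℂ := fun y =>
    mode σ 0 ((2 * Real.pi) • y) * h ((2 * Real.pi) • y)
  have hsm : Continuous fun y : Fin n → ℝ => (2 * Real.pi) • y := by fun_prop
  have hg : Continuous g := (((contDiff_mode σ 0).continuous).comp hsm).mul (hc.comp hsm)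
  have hgper : ∀ (k : Fin n → ℤ) y, g (fun i => y i + k i) = g y := by
    intro k y
    have e : (2 * Real.pi) • (fun i => y i + (k i : ℝ)) =
        fun i => ((2 * Real.pi) • y) i + 2 * Real.pi * (k i : ℝ) := by
      funext i; simp [mul_add]
    simp only [g]
    rw [e, mode_add_period, ht k, Complex.real_smul, mul_mul_mul_comm, ← Complex.ofReal_mul,
      σ.sgn_mul_self, Complex.ofReal_one, one_mul]
  have key := hasSum_sq_integral_unitCube hg hgper
  have e1 : ∀ y, ‖g y‖ ^ 2 = ‖h ((2 * Real.pi) • y)‖ ^ 2 := by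
    intro y
    simp only [g]
    rw [norm_mul, mode, Complex.norm_exp]
    have : (-(Complex.I * ∑ i, (waveVec σ 0 i : ℂ) * (((2 * Real.pi) • y) i : ℂ))).re = 0 := by
      simp [← Complex.ofReal_mul, ← Complex.ofReal_sum]
    rw [this, Real.exp_zero, one_mul]
  have e2 : ∀ (m : Fin n → ℤ) y,
      Complex.exp (-(2 * Real.pi * Complex.I * ∑ i, (m i : ℂ) * (y i : ℂ))) * g y =
        mode σ m ((2 * Real.pi) • y) • h ((2 * Real.pi) • y) := by
    intro m y
    simp only [g]
    rw [← mul_assoc, smul_eq_mul]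
    congr 1
    rw [mode, mode, ← Complex.exp_add]
    congr 1
    rw [← neg_add, mul_assoc (2 * (Real.pi : ℂ)), mul_left_comm, ← mul_add, Finset.mul_sum,
      ← Finset.sum_add_distrib]
    congr 2
    refine Finset.sum_congr rfl fun i _ => ?_
    simp only [waveVec, Pi.smul_apply, smul_eq_mul, Pi.zero_apply]
    push_cast
    ring
  simp only [e1, e2] at key
  rw [hscale (fun y => ‖h y‖ ^ 2)] at key
  have e3 : ∀ m, ‖∫ y in Set.Icc (0 : Fin n → ℝ) 1,
      mode σ m ((2 * Real.pi) • y) • h ((2 * Real.pi) • y)‖ ^ 2 =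
        ((2 * Real.pi) ^ n)⁻¹ ^ 2 * ‖modeCoeff σ m h‖ ^ 2 := by
    intro m
    rw [hscale (fun y => mode σ m y • h y), norm_smul, mul_pow, modeCoeff]
    rw [Real.norm_of_nonneg (inv_nonneg.mpr (pow_nonneg hR.le n))]
  simp only [e3] at key
  have := key.mul_left (((2 * Real.pi) ^ n) ^ 2)
  have hpos : ((2 * Real.pi) ^ n) ≠ 0 := (pow_pos hR n).ne'
  have e4 : ∀ x : ℝ, ((2 * Real.pi) ^ n) ^ 2 * (((2 * Real.pi) ^ n)⁻¹ ^ 2 * x) = x := fun x => by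
    rw [← mul_assoc, ← mul_pow, mul_inv_cancel₀ hpos, one_pow, one_mul]
  have e5 : ∀ x : ℝ, ((2 * Real.pi) ^ n) ^ 2 * (((2 * Real.pi) ^ n)⁻¹ • x) =
      (2 * Real.pi) ^ n * x := fun x => by
    rw [smul_eq_mul, ← mul_assoc, sq, mul_assoc ((2 * Real.pi) ^ n), mul_inv_cancel₀ hpos, mul_one]
  simpa only [e4, e5] using this

end Parseval

/-! ### Fourier coefficients of spinor fields on the torus -/

section Coefficients

open MeasureTheory Matrix

variable {n : ℕ}

lemma isCompact_torusCell : IsCompact (torusCell n) := isCompact_Icc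

lemma torusCell_subset_closure_interior : torusCell n ⊆ closure (interior (torusCell n)) := by
  have h : torusCell n = Set.univ.pi fun _ : Fin n => Set.Icc 0 (2 * Real.pi) := by
    rw [torusCell, ← Set.pi_univ_Icc]; rfl
  rw [h, interior_pi_set Set.finite_univ, closure_pi_set]
  refine Set.pi_mono fun i _ => ?_
  rw [interior_Icc, closure_Ioo Real.two_pi_pos.ne]

lemma exists_add_period_mem_torusCell (y : Fin n → ℝ) :
    ∃ k : Fin n → ℤ, (fun i => y i + 2 * Real.pi * (k i : ℝ)) ∈ torusCell n := by
  have hp := Real.two_pi_pos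
  refine ⟨fun i => -⌊y i / (2 * Real.pi)⌋, fun i => ?_, fun i => ?_⟩
  · have h := Int.floor_le (y i / (2 * Real.pi))
    rw [le_div_iff₀ hp] at h
    push_cast
    simp only [Pi.zero_apply]
    linarith
  · have h := Int.lt_floor_add_one (y i / (2 * Real.pi))
    rw [div_lt_iff₀ hp] at h
    push_cast
    linarith

/-- Integrals of derivatives of periodic functions vanish. -/
lemma integral_pd_eq_zero {E : Type*} [NormedAddCommGroup E] [NormedSpace ℝ E] [CompleteSpace E]
    {F : (Fin n → ℝ) → E} (hF : ContDiff ℝ ∞ F)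
    (hper : ∀ (k : Fin n → ℤ) y, F (fun i => y i + 2 * Real.pi * (k i : ℝ)) = F y) (j : Fin n) :
    ∫ y in torusCell n, pd j F y = 0 := by
  cases n with
  | zero => exact j.elim0
  | succ m =>
    have hface : ∀ (i : Fin (m + 1)) (x x' : Mink m), x i = 2 * Real.pi → x' i = 0 →
        (∀ l ≠ i, x l = x' l) → F x = F x' := by
      intro i x x' hx hx' h
      rw [← hper (Pi.single i 1) x']
      congr 1
      funext l
      by_cases hl : l = i
      · subst hl; simp [hx, hx']
      · simp [hl, h l hl]
    let f : Fin (m + 1) → Mink m → E := fun ν => if ν = j then F else fun _ => 0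
    have hf : ∀ ν, ContDiff ℝ ∞ (f ν) := fun ν => by
      by_cases h : ν = j
      · simpa only [f, h, if_true] using hF
      · simpa only [f, h, if_false] using contDiff_const
    have hff : ∀ (i : Fin (m + 1)) (x x' : Mink m), x i = 2 * Real.pi → x' i = 0 →
        (∀ l ≠ i, x l = x' l) → f i x = f i x' := by
      intro i x x' h1 h2 h3
      by_cases h : i = j
      · simp only [f, h, if_true]; exact hface i x x' h1 h2 h3
      · simp only [f, h, if_false]
    have key := integral_div_box f hf Real.two_pi_pos.le (lo := 0) (hi := fun _ => 2 * Real.pi)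
      (fun _ => Real.two_pi_pos.le) fun i x x' _ h1 h2 h3 => hff i.succ x x' h1 h2 h3
    have hend : ∀ y : Fin m → ℝ, f 0 (Fin.cons (2 * Real.pi) y : Mink m) =
        f 0 (Fin.cons 0 y : Mink m) := fun y => hff 0 _ _ rfl rfl fun l hl => by
      obtain ⟨i, rfl⟩ := Fin.exists_succ_eq.mpr hl
      simp
    simp only [hend, sub_self] at key
    have hset : Set.Icc (Fin.cons 0 (0 : Fin m → ℝ) : Mink m)
        (Fin.cons (2 * Real.pi) fun _ => 2 * Real.pi) = torusCell (m + 1) := by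
      have h1 : (Fin.cons 0 (0 : Fin m → ℝ) : Mink m) = 0 := by
        funext l; refine Fin.cases rfl (fun i => ?_) l; simp
      have h2 : (Fin.cons (2 * Real.pi) fun _ => 2 * Real.pi : Mink m) = fun _ => 2 * Real.pi := by
        funext l; refine Fin.cases rfl (fun i => ?_) l; simp
      rw [h1, h2]; rfl
    rw [hset] at key
    rw [← key]
    congr 1
    funext y
    rw [Finset.sum_eq_single j]
    · simp [f]
    · intro ν _ hν
      simp only [f, hν, if_false]
      exact pd_const 0 ν y
    · simp

variable {γ : GammaRep n} {σ : SpinStructure γ}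

lemma integrableOn_mode_smul {E : Type*} [NormedAddCommGroup E] [NormedSpace ℂ E]
    {f : (Fin n → ℝ) → E} (hf : Continuous f) (m : Fin n → ℤ) :
    IntegrableOn (fun y => mode σ m y • f y) (torusCell n) :=
  (((contDiff_mode σ m).continuous).smul hf).continuousOn.integrableOn_compact isCompact_torusCell

lemma modeCoeff_clm {E F : Type*} [NormedAddCommGroup E] [NormedSpace ℂ E] [CompleteSpace E]
    [NormedAddCommGroup F] [NormedSpace ℂ F] [CompleteSpace F] (L : E →L[ℂ] F)
    {f : (Fin n → ℝ) → E} (hf : Continuous f) (m : Fin n → ℤ) :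
    modeCoeff σ m (fun y => L (f y)) = L (modeCoeff σ m f) := by
  unfold modeCoeff
  rw [← L.integral_comp_comm (integrableOn_mode_smul hf m)]
  simp only [map_smul]

lemma modeCoeff_mulVec (A : SpinMatrix n) {f : (Fin n → ℝ) → Spinor n} (hf : Continuous f)
    (m : Fin n → ℤ) : modeCoeff σ m (fun y => A *ᵥ f y) = A *ᵥ modeCoeff σ m f :=
  modeCoeff_clm (LinearMap.toContinuousLinearMap A.mulVecLin) hf m

lemma modeCoeff_apply {f : (Fin n → ℝ) → Spinor n} (hf : Continuous f) (m : Fin n → ℤ)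
    (s : Fin (spinDim n)) : modeCoeff σ m f s = modeCoeff σ m (fun y => f y s) :=
  (modeCoeff_clm (ContinuousLinearMap.proj (R := ℂ) (φ := fun _ : Fin (spinDim n) => ℂ) s) hf m).symm

lemma modeCoeff_sub {f g : (Fin n → ℝ) → Spinor n} (hf : Continuous f) (hg : Continuous g)
    (m : Fin n → ℤ) :
    modeCoeff σ m (fun y => f y - g y) = modeCoeff σ m f - modeCoeff σ m g := by
  unfold modeCoeff
  simp only [smul_sub]
  exact integral_sub (integrableOn_mode_smul hf m) (integrableOn_mode_smul hg m)

lemma modeCoeff_smul (c : ℝ) (f : (Fin n → ℝ) → Spinor n) (m : Fin n → ℤ) :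
    modeCoeff σ m (fun y => c • f y) = c • modeCoeff σ m f := by
  unfold modeCoeff
  simp only [smul_comm _ c]
  exact integral_smul c _

lemma modeCoeff_sum {ι : Type*} (s : Finset ι) {f : ι → (Fin n → ℝ) → Spinor n}
    (hf : ∀ i ∈ s, Continuous (f i)) (m : Fin n → ℤ) :
    modeCoeff σ m (fun y => ∑ i ∈ s, f i y) = ∑ i ∈ s, modeCoeff σ m (f i) := by
  unfold modeCoeff
  simp only [Finset.smul_sum]
  exact integral_finsetSum s fun i hi => integrableOn_mode_smul (hf i hi) m

/-- Derivatives multiply the Fourier coefficients by components of the wave vector. -/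
lemma modeCoeff_pd {f : (Fin n → ℝ) → Spinor n} (hf : ContDiff ℝ ∞ f) (ht : IsTwisted σ f)
    (m : Fin n → ℤ) (j : Fin n) :
    modeCoeff σ m (pd j f) = Complex.I • waveVec σ m j • modeCoeff σ m f := by
  have hmode := contDiff_mode σ m
  have h1 : ∀ y, pd j (fun y => mode σ m y • f y) y =
      mode σ m y • pd j f y - Complex.I • waveVec σ m j • (mode σ m y • f y) := by
    intro y
    have h2 : pd j (fun y => mode σ m y • f y) y =
        mode σ m y • pd j f y + pd j (mode σ m) y • f y := by
      unfold pd
      rw [fderiv_fun_smul (hmode.differentiable (by simp) y) (hf.differentiable (by simp) y)]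
      simp
    rw [h2, pd_mode, neg_mul, neg_smul, ← sub_eq_add_neg, mul_smul, mul_smul, Complex.coe_smul]
  have h0 := integral_pd_eq_zero (F := fun y => mode σ m y • f y) (hmode.smul hf) (fun k y => by
    rw [mode_add_period, ht k, smul_comm, mul_smul, Complex.coe_smul, smul_smul,
      σ.sgn_mul_self, one_smul]) j
  simp only [h1] at h0
  have hc : Continuous fun y => Complex.I • waveVec σ m j • (mode σ m y • f y) :=
    ((hmode.continuous.smul hf.continuous).const_smul (waveVec σ m j)).const_smul Complex.I
  rw [integral_sub (integrableOn_mode_smul (contDiff_pd hf j).continuous m)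
    (hc.continuousOn.integrableOn_compact isCompact_torusCell), integral_smul, integral_smul,
    sub_eq_zero] at h0
  exact h0

/-- Parseval's identity for spinor fields. -/
lemma hasSum_ip_modeCoeff {f : (Fin n → ℝ) → Spinor n} (hf : Continuous f) (ht : IsTwisted σ f) :
    HasSum (fun m => ip (modeCoeff σ m f) (modeCoeff σ m f))
      ((2 * Real.pi) ^ n * ∫ y in torusCell n, ip (f y) (f y)) := by
  have hs : ∀ s, Continuous fun y => f y s := fun s => (continuous_apply s).comp hf
  have h1 := hasSum_sum (s := Finset.univ) fun s _ => hasSum_sq_modeCoeff (hs s)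
    (fun k y => congrFun (ht k y) s : IsTwisted σ fun y => f y s)
  simp only [ip_self_eq_sum]
  have hi : ∀ s ∈ Finset.univ, Integrable (fun y => ‖f y s‖ ^ 2)
      (volume.restrict (torusCell n)) := fun s _ =>
    ((hs s).norm.pow 2).continuousOn.integrableOn_compact isCompact_torusCell
  rw [integral_finsetSum _ hi, Finset.mul_sum]
  simpa only [modeCoeff_apply hf] using h1

lemma eq_zero_of_integral_ip_eq_zero {f : (Fin n → ℝ) → Spinor n} (hf : Continuous f)
    (ht : IsTwisted σ f) (h : ∫ y in torusCell n, ip (f y) (f y) = 0) : f = 0 := by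
  have hc : Continuous fun y => ip (f y) (f y) := by
    simp only [ip_self_eq_sum]
    exact continuous_finsetSum _ fun s _ => ((continuous_apply s).comp hf).norm.pow 2
  have h0 := (setIntegral_eq_zero_iff_of_nonneg_ae
    (Filter.Eventually.of_forall fun y => ip_self_nonneg (f y))
    (hc.continuousOn.integrableOn_compact isCompact_torusCell)).mp h
  have h1 := Measure.eqOn_of_ae_eq h0 hc.continuousOn continuousOn_const
    torusCell_subset_closure_interior
  funext y
  obtain ⟨k, hk⟩ := exists_add_period_mem_torusCell y
  have h2 := ip_self_eq_zero.mp (h1 hk)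
  rw [ht k] at h2
  rcases σ.sgn_eq k with h3 | h3 <;> simpa [h3] using h2

/-- A twisted field all of whose Fourier coefficients vanish is zero. -/
lemma eq_zero_of_modeCoeff_eq_zero {f : (Fin n → ℝ) → Spinor n} (hf : Continuous f)
    (ht : IsTwisted σ f) (h : ∀ m, modeCoeff σ m f = 0) : f = 0 := by
  refine eq_zero_of_integral_ip_eq_zero hf ht ?_
  have h1 := hasSum_ip_modeCoeff hf ht
  simp only [h, ip_zero_left] at h1
  have h2 := h1.unique hasSum_zero
  rcases mul_eq_zero.mp h2 with h3 | h3
  · exact absurd h3 (pow_pos Real.two_pi_pos n).ne'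
  · exact h3

lemma waveVec_sq_pos {i : Fin n} (hi : σ.sgn (Pi.single i 1) = -1) (m : Fin n → ℤ) :
    0 < ∑ j, waveVec σ m j ^ 2 := by
  have h : waveVec σ m i ≠ 0 := by
    rw [waveVec, hi, if_neg (by norm_num)]
    intro h0
    have h1 : ((2 * m i + 1 : ℤ) : ℝ) = 0 := by push_cast; linarith
    have h2 : 2 * m i + 1 = 0 := by exact_mod_cast h1
    omega
  exact lt_of_lt_of_le (by positivity) (Finset.single_le_sum (f := fun j => waveVec σ m j ^ 2)
    (fun j _ => sq_nonneg _) (Finset.mem_univ i))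

lemma isTwisted_of_isTorusSpinor {t : ℝ} {χ : (Fin n → ℝ) → Spinor n}
    (h : IsTorusSpinor σ t χ) : IsTwisted σ χ := fun k y => by
  rw [h.2 k y, SpinStructure.transition_mulVec]

lemma IsTwisted.pd {f : (Fin n → ℝ) → Spinor n} (ht : IsTwisted σ f) (hf : ContDiff ℝ ∞ f)
    (j : Fin n) : IsTwisted σ (pd j f) := fun k y => by
  have h1 : (fun y : Fin n → ℝ => f (y + fun i => 2 * Real.pi * (k i : ℝ))) =
      fun y => σ.sgn k • f y := funext fun y => ht k y
  have h2 := pd_comp_add f (fun i => 2 * Real.pi * (k i : ℝ)) y j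
  rw [h1] at h2
  have h3 : RaritaSchwinger.pd j (fun y => σ.sgn k • f y) y = σ.sgn k • RaritaSchwinger.pd j f y :=
    pd_clm (σ.sgn k • ContinuousLinearMap.id ℝ (Spinor n)) (hf.differentiable (by simp) y) j
  exact h2.symm.trans h3

/-- On a slice with a nontrivial spin structure no wave vector vanishes, so that the Dirac
operator, which multiplies Fourier coefficients by invertible matrices, is injective. -/
theorem torusDirac_injective {i : Fin n} (hi : σ.sgn (Pi.single i 1) = -1) {t : ℝ}
    {χ : (Fin n → ℝ) → Spinor n} (hχ : IsTorusSpinor σ t χ) (h : torusDirac γ χ = 0) : χ = 0 := by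
  have ht := isTwisted_of_isTorusSpinor hχ
  refine eq_zero_of_modeCoeff_eq_zero hχ.1.continuous ht fun m => ?_
  have h1 : modeCoeff σ m (torusDirac γ χ) = Complex.I • spatialSlash γ (waveVec σ m)
      (modeCoeff σ m χ) := by
    unfold torusDirac
    rw [modeCoeff_sum _ fun j _ => (contDiff_mulVec _ (contDiff_pd hχ.1 j)).continuous,
      spatialSlash, Finset.smul_sum]
    refine Finset.sum_congr rfl fun j _ => ?_
    rw [modeCoeff_mulVec _ (contDiff_pd hχ.1 j).continuous, modeCoeff_pd hχ.1 ht, mulVec_smul,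
      mulVec_smul_real]
  have h2 : modeCoeff σ m (torusDirac γ χ) = 0 := by
    rw [h]
    simp [modeCoeff]
  rw [h2] at h1
  have h3 := (smul_eq_zero.mp h1.symm).resolve_left Complex.I_ne_zero
  have h4 := spatialSlash_spatialSlash γ (waveVec σ m) (modeCoeff σ m χ)
  rw [h3] at h4
  have h5 : spatialSlash γ (waveVec σ m) 0 = 0 := by simp [spatialSlash]
  rw [h5] at h4
  exact (smul_eq_zero.mp h4.symm).resolve_left (waveVec_sq_pos hi m).ne'

end Coefficients

/-! ### Positivity of the charge for nontrivial spin structures -/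

section Positivity

open MeasureTheory Matrix

variable {n : ℕ} {γ : GammaRep n}

/-- The field `ω_μ = ψ_μ - (D - 2)⁻¹ γ_μ γ^ν ψ_ν`; it equals `∂_μ ε` when `ψ = K ε`. -/
noncomputable def gaugeForm (γ : GammaRep n) (v : Fin (n + 1) → Spinor n) :
    Fin (n + 1) → Spinor n :=
  fun μ => v μ - ((n : ℝ) - 1)⁻¹ • γ.low μ *ᵥ gammaTrace γ v

/-- For a single Fourier mode with wave vector `κ`, the Gauss constraint turns the charge density
into the squared norm of the part of `ω` transverse to `κ`. -/
lemma density_eq_sum_transverse (hn : 2 ≤ n) {κ : Fin n → ℝ} (hκ : 0 < ∑ j, κ j ^ 2)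
    {v : Fin (n + 1) → Spinor n}
    (hv : ∑ i, κ i • v i.succ = γ.gam 0 *ᵥ spatialSlash γ κ (v 0)) :
    density γ v v = ∑ i : Fin n,
      ip (gaugeForm γ v i.succ - (κ i * (∑ j, κ j ^ 2)⁻¹) • ∑ j, κ j • gaugeForm γ v j.succ)
        (gaugeForm γ v i.succ - (κ i * (∑ j, κ j ^ 2)⁻¹) • ∑ j, κ j • gaugeForm γ v j.succ) := by
  set K := ∑ j, κ j ^ 2 with hK
  set g := gammaTrace γ v with hg
  set a : ℝ := ((n : ℝ) - 1)⁻¹ with ha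
  set w : Fin n → Spinor n := fun i => gaugeForm γ v i.succ with hw
  set W := ∑ j, κ j • w j with hW
  have hn1 : (n : ℝ) - 1 ≠ 0 := by
    have : (2 : ℝ) ≤ n := by exact_mod_cast hn
    linarith
  have hna : (n : ℝ) * a = 1 + a := by
    rw [ha]; field_simp; ring
  have hwi : ∀ i, w i = v i.succ - a • γ.gam i.succ *ᵥ g := fun i => by
    simp only [hw, gaugeForm, low_mulVec, eta_succ, one_smul]; rfl
  -- the right-hand side is `∑ |w_i|² - |κ · w|² / |κ|²`
  have h1 : ∑ i, ip (w i - (κ i * K⁻¹) • W) (w i - (κ i * K⁻¹) • W) =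
      ∑ i, ip (w i) (w i) - K⁻¹ * ip W W := by
    have h2 : ∀ i, ip (w i - (κ i * K⁻¹) • W) (w i - (κ i * K⁻¹) • W) =
        ip (w i) (w i) - 2 * K⁻¹ * ip (κ i • w i) W + κ i ^ 2 * (K⁻¹ ^ 2 * ip W W) := fun i => by
      simp only [ip_sub_left, ip_sub_right, ip_smul_left, ip_smul_right, ip_comm W (w i)]
      ring
    simp only [h2, Finset.sum_add_distrib, Finset.sum_sub_distrib, ← Finset.mul_sum,
      ← Finset.sum_mul, ← ip_sum_left, ← hW, ← hK]
    field_simp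
    ring
  have h0 : ∑ i : Fin n, γ.gam i.succ *ᵥ v i.succ = g - γ.gam 0 *ᵥ v 0 := by
    rw [hg, gammaTrace, Fin.sum_univ_succ]; abel
  have h3 : ∑ i, ip (w i) (w i) = ∑ i : Fin n, ip (v i.succ) (v i.succ) -
      2 * a * (ip g g - ip (γ.gam 0 *ᵥ v 0) g) + a * (1 + a) * ip g g := by
    have h4 : ∀ i, ip (w i) (w i) = ip (v i.succ) (v i.succ) -
        2 * a * ip (γ.gam i.succ *ᵥ v i.succ) g + a ^ 2 * ip g g := fun i => by
      rw [hwi]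
      simp only [ip_sub_left, ip_sub_right, ip_smul_left, ip_smul_right,
        γ.ip_gam_succ_gam_succ, γ.ip_gam_succ]
      rw [ip_comm g (γ.gam i.succ *ᵥ v i.succ), γ.ip_gam_succ]
      ring
    have h10 : ∑ i : Fin n, ip (γ.gam i.succ *ᵥ v i.succ) g =
        ip g g - ip (γ.gam 0 *ᵥ v 0) g := by
      rw [← ip_sum_left, h0, ip_sub_left]
    simp only [h4, Finset.sum_add_distrib, Finset.sum_sub_distrib, ← Finset.mul_sum, h10,
      Finset.sum_const, Finset.card_univ, Fintype.card_fin, nsmul_eq_mul]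
    linear_combination (a * ip g g) * hna
  have h5 : W = -spatialSlash γ κ (γ.gam 0 *ᵥ v 0 + a • g) := by
    have h6 : W = ∑ i, κ i • v i.succ - a • spatialSlash γ κ g := by
      simp only [hW, hwi, smul_sub, Finset.sum_sub_distrib, spatialSlash, Finset.smul_sum]
      congr 1
      exact Finset.sum_congr rfl fun i _ => smul_comm _ _ _
    have h7 : γ.gam 0 *ᵥ spatialSlash γ κ (v 0) = -spatialSlash γ κ (γ.gam 0 *ᵥ v 0) := by
      simp only [spatialSlash, mulVec_sum, mulVec_smul_real, ← Finset.sum_neg_distrib]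
      refine Finset.sum_congr rfl fun i _ => ?_
      rw [γ.anticomm_apply (Fin.succ_ne_zero i).symm, smul_neg]
    have h8 : spatialSlash γ κ (γ.gam 0 *ᵥ v 0 + a • g) =
        spatialSlash γ κ (γ.gam 0 *ᵥ v 0) + a • spatialSlash γ κ g := by
      simp only [spatialSlash, mulVec_add, mulVec_smul_real, smul_add, Finset.sum_add_distrib,
        Finset.smul_sum]
      congr 1
      exact Finset.sum_congr rfl fun i _ => smul_comm _ _ _
    rw [h6, hv, h7, h8]
    abel
  have h9 : ip W W = K * (ip (v 0) (v 0) + 2 * a * ip (γ.gam 0 *ᵥ v 0) g + a ^ 2 * ip g g) := by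
    rw [h5, ip_neg_left, ip_neg_right, neg_neg, ip_spatialSlash, spatialSlash_spatialSlash,
      ip_smul_right]
    simp only [ip_add_left, ip_add_right, ip_smul_left, ip_smul_right, γ.ip_gam_zero_gam_zero]
    rw [ip_comm g (γ.gam 0 *ᵥ v 0)]
    ring
  change _ = ∑ i, ip (w i - (κ i * K⁻¹) • W) (w i - (κ i * K⁻¹) • W)
  have hdim : (((n + 1 : ℕ) : ℝ) - 2)⁻¹ = a := by rw [ha]; push_cast; congr 1; ring
  rw [h1, h3, h9, ← mul_assoc, inv_mul_cancel₀ hκ.ne', one_mul, density, hdim, Fin.sum_univ_succ,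
    ← hg]
  simp only [eta_zero, eta_succ, one_mul]
  ring

variable {σ : SpinStructure γ}

/-- The restriction of a component of a field to the slice at time `t`. -/
def sliceField (t : ℝ) (u : Mink n → Spinor n) : (Fin n → ℝ) → Spinor n := fun y => u (Fin.cons t y)

lemma contDiff_sliceField {u : Mink n → Spinor n} (hu : ContDiff ℝ ∞ u) (t : ℝ) :
    ContDiff ℝ ∞ (sliceField t u) := hu.comp (contDiff_cons t)

lemma pd_sliceField {u : Mink n → Spinor n} (hu : ContDiff ℝ ∞ u) (t : ℝ) (j : Fin n)
    (y : Fin n → ℝ) : pd j (sliceField t u) y = pd j.succ u (Fin.cons t y) := by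
  have h1 : sliceField t u = fun y => u ((fun y : Fin n → ℝ => (Fin.cons 0 y : Mink n)) y +
      (Fin.cons t 0 : Mink n)) := by
    funext y
    simp only [sliceField]
    congr 1
    funext μ
    refine Fin.cases ?_ (fun i => ?_) μ <;> simp
  let L : (Fin n → ℝ) →L[ℝ] Mink n := ContinuousLinearMap.pi fun μ =>
    Fin.cases 0 (fun i => ContinuousLinearMap.proj (R := ℝ) (φ := fun _ : Fin n => ℝ) i) μ
  have hL : ∀ y : Fin n → ℝ, L y = (Fin.cons 0 y : Mink n) := fun y => by
    funext μ
    refine Fin.cases ?_ (fun i => ?_) μ <;> simp [L]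
  have h2 : sliceField t u = (fun x => u (x + (Fin.cons t 0 : Mink n))) ∘ L := by
    rw [h1]; funext y; simp [hL]
  have hd : Differentiable ℝ fun x => u (x + (Fin.cons t 0 : Mink n)) :=
    (hu.comp (contDiff_id.add contDiff_const)).differentiable (by simp)
  have h3 : L (Pi.single j 1) = Pi.single j.succ 1 := by
    rw [hL]
    funext μ
    refine Fin.cases ?_ (fun i => ?_) μ
    · simp
    · by_cases h : i = j
      · subst h; simp
      · simp [h]
  have h4 : L y + (Fin.cons t 0 : Mink n) = Fin.cons t y := by
    rw [hL]
    funext μ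
    refine Fin.cases ?_ (fun i => ?_) μ <;> simp
  rw [pd, h2, fderiv_comp _ (hd _) L.differentiableAt, ContinuousLinearMap.fderiv,
    ContinuousLinearMap.comp_apply, h3, fderiv_comp_add_right, h4]
  rfl

lemma isTwisted_sliceField {u : Mink n → Spinor n} (hu : ∀ k x, u (deck k x) = σ.sgn k • u x)
    (t : ℝ) : IsTwisted σ (sliceField t u) := fun k y => by
  rw [sliceField, sliceField, ← hu]
  congr 1
  funext μ
  refine Fin.cases ?_ (fun i => ?_) μ <;> simp [deck]

/-- The Gauss constraint `∂_i ψ_i = γ⁰ γ^i ∂_i ψ_0` of a divergence-free solution of the Dirac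
equation. -/
lemma gauss_constraint {ψ : Field n} (hψ : ContDiff ℝ ∞ ψ) (hdiv : divergence ψ = 0)
    (hdir : dirac γ ψ = 0) (x : Mink n) :
    ∑ i : Fin n, pd i.succ (fun y => ψ y i.succ) x =
      γ.gam 0 *ᵥ ∑ i : Fin n, γ.gam i.succ *ᵥ pd i.succ (fun y => ψ y 0) x := by
  have h1 := congrFun hdiv x
  rw [divergence_eq hψ, Fin.sum_univ_succ] at h1
  simp only [eta_zero, eta_succ, one_smul, neg_smul, Pi.zero_apply] at h1
  have h2 := congrFun (congrFun hdir x) 0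
  rw [dirac_apply hψ, slash, Fin.sum_univ_succ, Pi.zero_apply, Pi.zero_apply] at h2
  have h3 := congrArg (fun w => γ.gam 0 *ᵥ w) h2
  simp only [mulVec_add, γ.sq_apply, eta_zero, neg_smul, one_smul, mulVec_zero] at h3
  rw [neg_add_eq_zero] at h1 h3
  rw [← h1, h3]

/-- Fourier coefficients of a field on a slice. -/
noncomputable def sliceCoeff (σ : SpinStructure γ) (t : ℝ) (m : Fin n → ℤ) (ψ : Field n) :
    Fin (n + 1) → Spinor n := fun μ => modeCoeff σ m (sliceField t fun y => ψ y μ)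

lemma continuous_sliceField {ψ : Field n} (hψ : ContDiff ℝ ∞ ψ) (t : ℝ) (μ : Fin (n + 1)) :
    Continuous (sliceField t fun y => ψ y μ) :=
  (contDiff_sliceField (contDiff_comp_field hψ μ) t).continuous

lemma gammaTrace_sliceCoeff {ψ : Field n} (hψ : ContDiff ℝ ∞ ψ) (t : ℝ) (m : Fin n → ℤ) :
    gammaTrace γ (sliceCoeff σ t m ψ) =
      modeCoeff σ m (sliceField t fun y => gammaTrace γ (ψ y)) := by
  have h := modeCoeff_sum (σ := σ) Finset.univ (f := fun (μ : Fin (n + 1)) (y : Fin n → ℝ) =>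
    γ.gam μ *ᵥ sliceField t (fun y => ψ y μ) y)
    (fun μ _ => (contDiff_mulVec _ (contDiff_sliceField (contDiff_comp_field hψ μ) t)).continuous) m
  simp only [modeCoeff_mulVec _ (continuous_sliceField hψ t _)] at h
  exact h.symm

lemma gaugeForm_sliceCoeff {ψ : Field n} (hψ : ContDiff ℝ ∞ ψ) (t : ℝ) (m : Fin n → ℤ) :
    gaugeForm γ (sliceCoeff σ t m ψ) = sliceCoeff σ t m (fun x => gaugeForm γ (ψ x)) := by
  have hg : Continuous (sliceField t fun y => gammaTrace γ (ψ y)) :=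
    (contDiff_sliceField (ContDiff.sum fun μ _ =>
      contDiff_mulVec _ (contDiff_comp_field hψ μ)) t).continuous
  have hA : ∀ A : SpinMatrix n, Continuous fun y => A *ᵥ sliceField t (fun y => gammaTrace γ (ψ y)) y :=
    fun A => (mulVecCLM A).continuous.comp hg
  funext μ
  have h := modeCoeff_sub (σ := σ) (continuous_sliceField hψ t μ)
    (g := fun y => ((n : ℝ) - 1)⁻¹ • γ.low μ *ᵥ sliceField t (fun y => gammaTrace γ (ψ y)) y)
    ((hA (γ.low μ)).const_smul ((n : ℝ) - 1)⁻¹) m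
  rw [modeCoeff_smul, modeCoeff_mulVec _ hg, ← gammaTrace_sliceCoeff hψ] at h
  exact h.symm

lemma contDiff_gaugeForm {ψ : Field n} (hψ : ContDiff ℝ ∞ ψ) :
    ContDiff ℝ ∞ (fun x => gaugeForm γ (ψ x)) := by
  have hg : ContDiff ℝ ∞ fun x => gammaTrace γ (ψ x) :=
    ContDiff.sum fun ν _ => contDiff_mulVec _ (contDiff_comp_field hψ ν)
  refine contDiff_pi.2 fun μ => ?_
  have h : ContDiff ℝ ∞ fun x => ((n : ℝ) - 1)⁻¹ • γ.low μ *ᵥ gammaTrace γ (ψ x) :=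
    (contDiff_mulVec _ hg).const_smul _
  exact (contDiff_comp_field hψ μ).sub h

lemma sliceCoeff_constraint {ψ : Field n} (hψ : ψ ∈ sections σ) (hdiv : divergence ψ = 0)
    (hdir : dirac γ ψ = 0) (t : ℝ) (m : Fin n → ℤ) :
    ∑ i, waveVec σ m i • sliceCoeff σ t m ψ i.succ =
      γ.gam 0 *ᵥ spatialSlash γ (waveVec σ m) (sliceCoeff σ t m ψ 0) := by
  rw [mem_sections_iff] at hψ
  have hc : ∀ μ, ContDiff ℝ ∞ (sliceField t fun y => ψ y μ) := fun μ =>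
    contDiff_sliceField (contDiff_comp_field hψ.1 μ) t
  have htw : ∀ μ, IsTwisted σ (sliceField t fun y => ψ y μ) := fun μ =>
    isTwisted_sliceField (fun k x => by rw [hψ.2.2]; rfl) t
  have hpd : ∀ μ (i : Fin n), Continuous (pd i (sliceField t fun y => ψ y μ)) := fun μ i =>
    (contDiff_pd (hc μ) i).continuous
  have h1 : (fun y => ∑ i : Fin n, pd i (sliceField t fun y => ψ y i.succ) y) =
      fun y => γ.gam 0 *ᵥ ∑ i : Fin n, γ.gam i.succ *ᵥ pd i (sliceField t fun y => ψ y 0) y := by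
    funext y
    simp only [pd_sliceField (contDiff_comp_field hψ.1 _)]
    exact gauss_constraint hψ.1 hdiv hdir _
  have h2 := congrArg (modeCoeff σ m) h1
  have hA : ∀ i : Fin n, Continuous fun y => γ.gam i.succ *ᵥ pd i (sliceField t fun y => ψ y 0) y :=
    fun i => (mulVecCLM _).continuous.comp (hpd 0 i)
  rw [modeCoeff_sum _ fun i _ => hpd _ i, modeCoeff_mulVec _ (continuous_finsetSum _ fun i _ => hA i),
    modeCoeff_sum _ fun i _ => hA i] at h2
  simp only [modeCoeff_mulVec _ (hpd _ _), modeCoeff_pd (hc _) (htw _), mulVec_smul,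
    ← Finset.smul_sum] at h2
  exact smul_right_injective _ Complex.I_ne_zero h2

/-- Parseval's identity for the charge. -/
lemma hasSum_density_sliceCoeff {ψ : Field n} (hψ : ψ ∈ sections σ) (t : ℝ) :
    HasSum (fun m => density γ (sliceCoeff σ t m ψ) (sliceCoeff σ t m ψ))
      ((2 * Real.pi) ^ n * sliceCharge γ t ψ ψ) := by
  rw [mem_sections_iff] at hψ
  have hc : ∀ μ, Continuous (sliceField t fun y => ψ y μ) := fun μ => continuous_sliceField hψ.1 t μ
  have htw : ∀ μ, IsTwisted σ (sliceField t fun y => ψ y μ) := fun μ =>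
    isTwisted_sliceField (fun k x => by rw [hψ.2.2]; rfl) t
  have hgc : Continuous (sliceField t fun y => gammaTrace γ (ψ y)) :=
    (contDiff_sliceField (ContDiff.sum fun μ _ =>
      contDiff_mulVec _ (contDiff_comp_field hψ.1 μ)) t).continuous
  have hgt : IsTwisted σ (sliceField t fun y => gammaTrace γ (ψ y)) :=
    isTwisted_sliceField (fun k x => by rw [hψ.2.2, gammaTrace_smul]) t
  have hint : ∀ {f : (Fin n → ℝ) → Spinor n}, Continuous f →
      IntegrableOn (fun y => ip (f y) (f y)) (torusCell n) := fun {f} hf => by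
    have : Continuous fun y => ip (f y) (f y) := by
      simp only [ip_self_eq_sum]
      exact continuous_finsetSum _ fun s _ => ((continuous_apply s).comp hf).norm.pow 2
    exact this.continuousOn.integrableOn_compact isCompact_torusCell
  have h1 := (hasSum_sum (s := Finset.univ) fun μ _ =>
    (hasSum_ip_modeCoeff (hc μ) (htw μ)).mul_left (eta μ)).sub
      ((hasSum_ip_modeCoeff hgc hgt).mul_left (((n + 1 : ℕ) : ℝ) - 2)⁻¹)
  simp only [← gammaTrace_sliceCoeff hψ.1] at h1
  have h2 : (2 * Real.pi) ^ n * sliceCharge γ t ψ ψ =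
      ∑ μ, eta μ * ((2 * Real.pi) ^ n * ∫ y in torusCell n,
        ip (sliceField t (fun y => ψ y μ) y) (sliceField t (fun y => ψ y μ) y)) -
      (((n + 1 : ℕ) : ℝ) - 2)⁻¹ * ((2 * Real.pi) ^ n * ∫ y in torusCell n,
        ip (sliceField t (fun y => gammaTrace γ (ψ y)) y)
          (sliceField t (fun y => gammaTrace γ (ψ y)) y)) := by
    have h3 : sliceCharge γ t ψ ψ = ∫ y in torusCell n,
        (∑ μ, eta μ * ip (sliceField t (fun y => ψ y μ) y) (sliceField t (fun y => ψ y μ) y) -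
          (((n + 1 : ℕ) : ℝ) - 2)⁻¹ * ip (sliceField t (fun y => gammaTrace γ (ψ y)) y)
          (sliceField t (fun y => gammaTrace γ (ψ y)) y)) := rfl
    rw [h3, integral_sub (integrable_finsetSum _ fun μ _ => (hint (hc μ)).const_mul _)
      ((hint hgc).const_mul _), integral_finsetSum _ fun μ _ => (hint (hc μ)).const_mul _,
      integral_const_mul, mul_sub, Finset.mul_sum]
    congr 1
    · refine Finset.sum_congr rfl fun μ _ => ?_
      rw [integral_const_mul]; ring
    · ring
  rw [h2]
  exact h1

variable {i₀ : Fin n}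

lemma density_sliceCoeff_nonneg (hn : 2 ≤ n) (hi : σ.sgn (Pi.single i₀ 1) = -1) {ψ : Field n}
    (hψ : ψ ∈ sections σ) (hdiv : divergence ψ = 0) (hdir : dirac γ ψ = 0) (t : ℝ)
    (m : Fin n → ℤ) : 0 ≤ density γ (sliceCoeff σ t m ψ) (sliceCoeff σ t m ψ) := by
  rw [density_eq_sum_transverse hn (waveVec_sq_pos hi m) (sliceCoeff_constraint hψ hdiv hdir t m)]
  exact Finset.sum_nonneg fun i _ => ip_self_nonneg _

lemma sliceCharge_nonneg (hn : 2 ≤ n) (hi : σ.sgn (Pi.single i₀ 1) = -1) {ψ : Field n}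
    (hψ : ψ ∈ sections σ) (hdiv : divergence ψ = 0) (hdir : dirac γ ψ = 0) (t : ℝ) :
    0 ≤ sliceCharge γ t ψ ψ := by
  have h := (hasSum_density_sliceCoeff hψ t).nonneg
    (density_sliceCoeff_nonneg hn hi hψ hdiv hdir t)
  exact nonneg_of_mul_nonneg_right h (pow_pos Real.two_pi_pos n)

/-- If the charge vanishes, the field `ω` is curl-free along the slice. -/
lemma spatial_curl_eq_zero (hn : 2 ≤ n) (hi : σ.sgn (Pi.single i₀ 1) = -1) {ψ : Field n}
    (hψ : ψ ∈ sections σ) (hdiv : divergence ψ = 0) (hdir : dirac γ ψ = 0) (t : ℝ)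
    (h : sliceCharge γ t ψ ψ = 0) (i j : Fin n) (y : Fin n → ℝ) :
    pd i.succ (fun x => gaugeForm γ (ψ x) j.succ) (Fin.cons t y) =
      pd j.succ (fun x => gaugeForm γ (ψ x) i.succ) (Fin.cons t y) := by
  have hsum := hasSum_density_sliceCoeff hψ t
  rw [h, mul_zero, hasSum_zero_iff_of_nonneg (density_sliceCoeff_nonneg hn hi hψ hdiv hdir t)] at hsum
  have hψ' := mem_sections_iff.mp hψ
  have hω := contDiff_gaugeForm (γ := γ) hψ'.1
  have hc : ∀ μ, ContDiff ℝ ∞ (sliceField t fun x => gaugeForm γ (ψ x) μ) := fun μ =>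
    contDiff_sliceField (contDiff_comp_field hω μ) t
  have htw : ∀ μ, IsTwisted σ (sliceField t fun x => gaugeForm γ (ψ x) μ) := fun μ =>
    isTwisted_sliceField (fun k x => by
      simp only [gaugeForm, hψ'.2.2, gammaTrace_smul, Pi.smul_apply, mulVec_smul_real, smul_sub,
        smul_comm (σ.sgn k)]) t
  have hmode : ∀ m (i : Fin n), sliceCoeff σ t m (fun x => gaugeForm γ (ψ x)) i.succ =
      waveVec σ m i • (∑ l, waveVec σ m l ^ 2)⁻¹ •
        ∑ l : Fin n, waveVec σ m l • sliceCoeff σ t m (fun x => gaugeForm γ (ψ x)) l.succ := by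
    intro m i
    have h1 := congrFun hsum m
    rw [density_eq_sum_transverse hn (waveVec_sq_pos hi m)
      (sliceCoeff_constraint hψ hdiv hdir t m)] at h1
    have h2 := (Finset.sum_eq_zero_iff_of_nonneg fun i _ => ip_self_nonneg _).mp h1 i
      (Finset.mem_univ i)
    have h3 := sub_eq_zero.mp (ip_self_eq_zero.mp h2)
    rw [gaugeForm_sliceCoeff hψ'.1, mul_smul] at h3
    exact h3
  have hzero : (fun y => pd i (sliceField t fun x => gaugeForm γ (ψ x) j.succ) y -
      pd j (sliceField t fun x => gaugeForm γ (ψ x) i.succ) y) = 0 := by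
    refine eq_zero_of_modeCoeff_eq_zero (σ := σ)
      (((contDiff_pd (hc _) i).sub (contDiff_pd (hc _) j)).continuous) (fun k y => ?_) fun m => ?_
    · rw [(htw _).pd (hc _) i k, (htw _).pd (hc _) j k, smul_sub]
    · rw [modeCoeff_sub (contDiff_pd (hc _) i).continuous (contDiff_pd (hc _) j).continuous,
        modeCoeff_pd (hc _) (htw _), modeCoeff_pd (hc _) (htw _)]
      change Complex.I • waveVec σ m i • sliceCoeff σ t m (fun x => gaugeForm γ (ψ x)) j.succ -
        Complex.I • waveVec σ m j • sliceCoeff σ t m (fun x => gaugeForm γ (ψ x)) i.succ = 0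
      rw [hmode m i, hmode m j, smul_comm (waveVec σ m i), sub_self]
  have h4 := sub_eq_zero.mp (congrFun hzero y)
  rwa [pd_sliceField (contDiff_comp_field hω _), pd_sliceField (contDiff_comp_field hω _)] at h4

end Positivity

/-! ### Solutions of vanishing charge are pure gauge -/

section PureGauge

open Matrix

variable {n : ℕ} {γ : GammaRep n} {σ : SpinStructure γ}

/-- The Poincaré lemma for spinor-valued one-forms on the universal cover. -/
lemma exists_primitive {α : Field n} (hα : ContDiff ℝ ∞ α)
    (hc : ∀ μ ν x, pd μ (fun y => α y ν) x = pd ν (fun y => α y μ) x) :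
    ∃ ε : Mink n → Spinor n, ContDiff ℝ ∞ ε ∧ ∀ μ x, pd μ ε x = α x μ := by
  let P : Fin (n + 1) → Mink n →L[ℝ] ℝ := fun μ =>
    ContinuousLinearMap.proj (R := ℝ) (φ := fun _ : Fin (n + 1) => ℝ) μ
  let W : Mink n → Mink n →L[ℝ] Spinor n := fun x => ∑ μ, (P μ).smulRight (α x μ)
  have hWv : ∀ x v, W x v = ∑ μ, v μ • α x μ := fun x v => by
    simp [W, P]
  have hWc : ContDiff ℝ ∞ W := ContDiff.sum fun μ _ =>
    contDiff_const.smulRight (contDiff_comp_field hα μ)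
  have hWd : Differentiable ℝ W := hWc.differentiable (by simp)
  have hfd : ∀ x a v, fderiv ℝ W x a v = ∑ ν, ∑ μ, (a ν * v μ) • pd ν (fun y => α y μ) x := by
    intro x a v
    rw [fderiv_apply_eq_sum_pd, _root_.sum_apply]
    refine Finset.sum_congr rfl fun ν _ => ?_
    have h1 := pd_clm (ContinuousLinearMap.apply ℝ (Spinor n) v) (hWd x) ν
    simp only [ContinuousLinearMap.apply_apply, hWv] at h1
    rw [_root_.smul_apply, ← h1, pd_fun_sum fun μ _ =>
      ((contDiff_comp_field hα μ).const_smul (v μ)).differentiable (by simp) x, Finset.smul_sum]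
    refine Finset.sum_congr rfl fun μ _ => ?_
    rw [mul_smul]
    congr 1
    exact pd_clm (v μ • ContinuousLinearMap.id ℝ (Spinor n))
      ((contDiff_comp_field hα μ).differentiable (by simp) x) ν
  obtain ⟨ε, hε⟩ := convex_univ.exists_forall_hasFDerivAt_of_fderiv_symmetric isOpen_univ
    hWd.differentiableOn fun x _ a v => by
      rw [hfd, hfd, Finset.sum_comm]
      exact Finset.sum_congr rfl fun μ _ => Finset.sum_congr rfl fun ν _ => by
        rw [hc ν μ, mul_comm]
  have hε' : fderiv ℝ ε = W := funext fun x => (hε x (Set.mem_univ x)).fderiv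
  refine ⟨ε, contDiff_infty_iff_fderiv.2
    ⟨fun x => (hε x (Set.mem_univ x)).differentiableAt, hε' ▸ hWc⟩, fun μ x => ?_⟩
  rw [pd, hε', hWv, Finset.sum_eq_single μ (fun ν _ h => by simp [h]) (by simp)]
  simp

lemma eq_of_pd_eq_zero {u : Mink n → Spinor n} (hu : Differentiable ℝ u)
    (h : ∀ μ x, pd μ u x = 0) (x y : Mink n) : u x = u y :=
  is_const_of_fderiv_eq_zero hu
    (fun x => ContinuousLinearMap.ext fun v => by simp [fderiv_apply_eq_sum_pd, h]) x y

/-- A constant that changes sign under a translation vanishes. -/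
lemma eq_zero_of_pd_eq_zero_of_odd {u : Mink n → Spinor n} (hu : Differentiable ℝ u)
    (h : ∀ μ x, pd μ u x = 0) {k : Fin n → ℤ} (hk : ∀ x, u (deck k x) = -u x) (x : Mink n) :
    u x = 0 :=
  self_eq_neg.mp ((eq_of_pd_eq_zero hu h x (deck k x)).trans (hk x))

variable {i₀ : Fin n}

/-- For a nontrivial spin structure, closed one-forms with values in Majorana spinors are exact. -/
lemma exists_twisted_primitive (hi : σ.sgn (Pi.single i₀ 1) = -1) {α : Field n}
    (hα : α ∈ sections σ) (hc : ∀ μ ν x, pd μ (fun y => α y ν) x = pd ν (fun y => α y μ) x) :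
    ∃ ε : Mink n → Spinor n, ContDiff ℝ ∞ ε ∧ (∀ x, ε x ∈ γ.majorana) ∧
      (∀ k x, ε (deck k x) = σ.sgn k • ε x) ∧ ∀ μ x, pd μ ε x = α x μ := by
  rw [mem_sections_iff] at hα
  obtain ⟨δ, hδ, hδα⟩ := exists_primitive hα.1 hc
  have hpd : ∀ k μ x, pd μ (fun y => δ (deck k y)) x = σ.sgn k • pd μ δ x := fun k μ x => by
    rw [pd_comp_deck, hδα, hα.2.2, hδα]; rfl
  have hdeck : ∀ {u : Mink n → Spinor n}, ContDiff ℝ ∞ u → ∀ k,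
      Differentiable ℝ fun x => u (deck k x) :=
    fun {u} hu k => (hu.comp (contDiff_deck k)).differentiable (by simp)
  set k₀ : Fin n → ℤ := Pi.single i₀ 1 with hk₀
  have hδd : Differentiable ℝ δ := hδ.differentiable (by simp)
  -- the additive constant in the primitive is fixed by antiperiodicity along `i₀`
  set c : Spinor n := (1 / 2 : ℝ) • (δ (deck k₀ 0) + δ 0) with hcdef
  have hodd : ∀ x, δ (deck k₀ x) + δ x = (2 : ℝ) • c := fun x => by
    have h1 := eq_of_pd_eq_zero (u := fun x => δ (deck k₀ x) + δ x) ((hdeck hδ k₀).add hδd)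
      (fun μ x => ?_) x 0
    · rw [h1, hcdef, smul_smul]
      norm_num
    · rw [pd_fun_add (hdeck hδ k₀ x) (hδd x), hpd, hi, neg_one_smul, neg_add_cancel]
  set ε : Mink n → Spinor n := fun x => δ x - c with hε
  have hεs : ContDiff ℝ ∞ ε := hδ.sub contDiff_const
  have hεd : Differentiable ℝ ε := hεs.differentiable (by simp)
  have hεα : ∀ μ x, pd μ ε x = α x μ := fun μ x => by
    rw [hε, pd_fun_sub (hδd x) (differentiableAt_const c), pd_const, sub_zero, hδα]
  have hε0 : ∀ x, ε (deck k₀ x) = -ε x := fun x => by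
    have := hodd x
    rw [two_smul] at this
    simp only [hε]
    rw [neg_sub, sub_eq_iff_eq_add, eq_sub_of_add_eq this]
    abel
  refine ⟨ε, hεs, fun x => ?_, fun k x => ?_, hεα⟩
  · rw [mem_majorana, ← γ.chargeConjCLM_apply, ← sub_eq_zero]
    have hcc : Differentiable ℝ fun x => γ.chargeConjCLM (ε x) :=
      γ.chargeConjCLM.differentiable.comp hεd
    refine eq_zero_of_pd_eq_zero_of_odd (u := fun x => γ.chargeConjCLM (ε x) - ε x) (k := k₀)
      (hcc.sub hεd) (fun μ x => ?_) (fun x => ?_) x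
    · rw [pd_fun_sub (hcc x) (hεd x), pd_clm _ (hεd x), hεα, γ.chargeConjCLM_apply,
        (mem_majorana γ).1 (hα.2.1 x μ), sub_self]
    · rw [hε0, map_neg]; abel
  · have hsd : Differentiable ℝ fun x => σ.sgn k • ε x := hεd.const_smul (σ.sgn k)
    rw [← sub_eq_zero]
    refine eq_zero_of_pd_eq_zero_of_odd (u := fun x => ε (deck k x) - σ.sgn k • ε x) (k := k₀)
      ((hdeck hεs k).sub hsd) (fun μ x => ?_) (fun x => ?_) x
    · have h1 : pd μ (fun x => σ.sgn k • ε x) x = σ.sgn k • pd μ ε x :=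
        pd_clm (σ.sgn k • ContinuousLinearMap.id ℝ (Spinor n)) (hεd x) μ
      rw [pd_fun_sub (hdeck hεs k x) (hsd x), h1, pd_comp_deck, hεα, hεα, hα.2.2]
      exact sub_self _
    · rw [← deck_add, add_comm, deck_add, hε0, hε0, smul_neg]; abel

/-- Anticommuting the Dirac operator past `γ_μ`. -/
lemma slash_low {u : Mink n → Spinor n} (hu : ContDiff ℝ ∞ u) (μ : Fin (n + 1)) (x : Mink n) :
    slash γ (fun y => γ.low μ *ᵥ u y) x = (2 : ℝ) • pd μ u x - γ.low μ *ᵥ slash γ u x := by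
  have h0 : ∀ ν, pd ν (fun y => γ.low μ *ᵥ u y) x = γ.low μ *ᵥ pd ν u x :=
    pd_mulVec _ (hu.differentiable (by simp) x)
  unfold slash
  simp only [h0]
  simp only [low_mulVec, mulVec_smul_real, mulVec_sum]
  have h : ∀ ν, eta μ • γ.gam ν *ᵥ (γ.gam μ *ᵥ pd ν u x) =
      (if ν = μ then (2 : ℝ) • pd μ u x else 0) - eta μ • γ.gam μ *ᵥ (γ.gam ν *ᵥ pd ν u x) := by
    intro ν
    rw [γ.clifford_apply ν μ, smul_sub]
    congr 1
    split_ifs with hν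
    · subst hν
      rw [smul_smul, mul_left_comm, eta_mul_eta, mul_one]
    · exact smul_zero _
  simp only [h, Finset.sum_sub_distrib, Finset.sum_ite_eq', Finset.mem_univ, if_true]

/-- In particular, the gamma trace of a divergence-free solution of the Dirac equation solves the
Dirac equation. -/
lemma slash_gammaTrace {ψ : Field n} (hψ : ContDiff ℝ ∞ ψ) (x : Mink n) :
    slash γ (fun y => gammaTrace γ (ψ y)) x =
      (2 : ℝ) • divergence ψ x - gammaTrace γ (dirac γ ψ x) := by
  have hd : ∀ μ, DifferentiableAt ℝ (fun y => ψ y μ) x := fun μ =>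
    (contDiff_comp_field hψ μ).differentiable (by simp) x
  have h1 : ∀ ν, pd ν (fun y => gammaTrace γ (ψ y)) x =
      ∑ μ, γ.gam μ *ᵥ pd ν (fun y => ψ y μ) x := fun ν => by
    unfold gammaTrace
    rw [pd_fun_sum fun μ _ =>
      (contDiff_mulVec _ (contDiff_comp_field hψ μ)).differentiable (by simp) x]
    exact Finset.sum_congr rfl fun μ _ => pd_mulVec _ (hd μ) ν
  rw [divergence_eq hψ, gammaTrace]
  simp only [dirac_apply hψ, slash, h1, mulVec_sum]
  have h2 : ∀ ν μ, γ.gam ν *ᵥ (γ.gam μ *ᵥ pd ν (fun y => ψ y μ) x) =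
      (if ν = μ then (2 * eta ν) • pd ν (fun y => ψ y μ) x else 0) -
        γ.gam μ *ᵥ (γ.gam ν *ᵥ pd ν (fun y => ψ y μ) x) := fun ν μ => γ.clifford_apply ν μ _
  simp only [h2, Finset.sum_sub_distrib, Finset.sum_ite_eq, Finset.mem_univ, if_true]
  rw [Finset.smul_sum, Finset.sum_comm (f := fun ν μ =>
    γ.gam μ *ᵥ (γ.gam ν *ᵥ pd ν (fun y => ψ y μ) x))]
  simp only [mul_smul]

lemma contDiff_opK {ε : Mink n → Spinor n} (hε : ContDiff ℝ ∞ ε) : ContDiff ℝ ∞ (opK γ ε) := by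
  refine contDiff_pi.2 fun μ => ?_
  have h : ContDiff ℝ ∞ fun x => (1 / 2 : ℝ) • γ.low μ *ᵥ slash γ ε x :=
    (contDiff_mulVec _ (contDiff_slash γ hε)).const_smul _
  exact (contDiff_pd hε μ).sub h

/-- Gauge invariance `P K = 0`. -/
lemma opP_opK {ε : Mink n → Spinor n} (hε : ContDiff ℝ ∞ ε) : opP γ (opK γ ε) = 0 := by
  have hs := contDiff_slash γ hε
  have hK := contDiff_opK (γ := γ) hε
  have h0 : ∀ μ, ContDiff ℝ ∞ fun x => γ.low μ *ᵥ slash γ ε x := fun μ => contDiff_mulVec _ hs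
  have h0' : ∀ μ, ContDiff ℝ ∞ fun x => (1 / 2 : ℝ) • γ.low μ *ᵥ slash γ ε x := fun μ =>
    (h0 μ).const_smul _
  have hc : ∀ μ, (fun x => opK γ ε x μ) =
      fun x => pd μ ε x - (1 / 2 : ℝ) • γ.low μ *ᵥ slash γ ε x := fun μ => rfl
  have hdir : ∀ x μ, dirac γ (opK γ ε) x μ = (1 / 2 : ℝ) • γ.low μ *ᵥ box ε x := fun x μ => by
    rw [dirac_apply hK, hc, slash_sub γ (contDiff_pd hε μ) (h0' μ), slash_smul γ _ (h0 μ),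
      slash_low hs, slash_slash γ hε, pd_slash γ hε, smul_sub, smul_smul]
    norm_num
  have hdiv : ∀ x, divergence (opK γ ε) x = (1 / 2 : ℝ) • box ε x := fun x => by
    have h1 : ∀ ν, pd ν (fun x => (1 / 2 : ℝ) • γ.low ν *ᵥ slash γ ε x) x =
        (1 / 2 : ℝ) • eta ν • γ.gam ν *ᵥ pd ν (slash γ ε) x := fun ν => by
      have h2 := pd_clm ((1 / 2 : ℝ) • mulVecCLM (γ.low ν)) (hs.differentiable (by simp) x) ν
      rw [← low_mulVec]
      exact h2
    rw [divergence_eq hK]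
    simp only [hc, pd_fun_sub ((contDiff_pd hε _).differentiable (by simp) x)
      ((h0' _).differentiable (by simp) x), h1, smul_sub, Finset.sum_sub_distrib]
    have h3 : ∑ ν, eta ν • (1 / 2 : ℝ) • eta ν • γ.gam ν *ᵥ pd ν (slash γ ε) x =
        (1 / 2 : ℝ) • slash γ (slash γ ε) x := by
      conv_rhs => rw [slash, Finset.smul_sum]
      refine Finset.sum_congr rfl fun ν _ => ?_
      rw [smul_comm, smul_smul (eta ν), eta_mul_eta, one_smul]
    rw [h3, slash_slash γ hε, show ∑ ν, eta ν • pd ν (pd ν ε) x = box ε x from rfl]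
    module
  funext x μ
  rw [opP, hdir, hdiv, mulVec_smul_real, sub_self]; rfl

/-- A solution of vanishing charge is of the form `K ε`. -/
lemma exists_eq_opK (hn : 2 ≤ n) (hi : σ.sgn (Pi.single i₀ 1) = -1) {ψ : Field n}
    (hψ : ψ ∈ sections σ) (hdiv : divergence ψ = 0) (hdir : dirac γ ψ = 0)
    (h : ∀ t, sliceCharge γ t ψ ψ = 0) :
    ∃ ε : Mink n → Spinor n, ContDiff ℝ ∞ ε ∧ (∀ x, ε x ∈ γ.majorana) ∧
      (∀ k x, ε (deck k x) = σ.sgn k • ε x) ∧ opK γ ε = ψ := by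
  have hψ' := mem_sections_iff.mp hψ
  set a : ℝ := ((n : ℝ) - 1)⁻¹ with ha
  have hna : (n : ℝ) * a = 1 + a := by
    have : (2 : ℝ) ≤ n := by exact_mod_cast hn
    have hn1 : (n : ℝ) - 1 ≠ 0 := by linarith
    rw [ha]; field_simp; ring
  set g : Mink n → Spinor n := fun x => gammaTrace γ (ψ x) with hg
  set α : Field n := fun x => gaugeForm γ (ψ x) with hα
  have hgs : ContDiff ℝ ∞ g :=
    ContDiff.sum fun ν _ => contDiff_mulVec _ (contDiff_comp_field hψ'.1 ν)
  have hαs : ContDiff ℝ ∞ α := contDiff_gaugeForm hψ'.1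
  have hαapp : ∀ x μ, α x μ = ψ x μ - a • γ.low μ *ᵥ g x := fun x μ => rfl
  have hαmem : α ∈ sections σ := mem_sections_iff.mpr ⟨hαs, fun x μ =>
    Submodule.sub_mem _ (hψ'.2.1 x μ) (Submodule.smul_mem _ _
      (γ.low_mem_majorana μ (gammaTrace_mem_majorana γ (hψ'.2.1 x)))), fun k x => by
    funext μ
    have h1 : g (deck k x) = σ.sgn k • g x := by
      simp only [hg, hψ'.2.2, gammaTrace_smul]
    rw [Pi.smul_apply, hαapp, hαapp, h1, hψ'.2.2, mulVec_smul_real, smul_sub, smul_comm a]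
    rfl⟩
  have hgslash : ∀ x, slash γ g x = 0 := fun x => by
    rw [hg, slash_gammaTrace hψ'.1, hdiv, hdir]; simp [gammaTrace]
  have htr : ∀ x, gammaTrace γ (α x) = (-(2 * a)) • g x := fun x => by
    have h1 : α x = ψ x + (-a) • fun μ => γ.low μ *ᵥ g x := by
      funext μ
      rw [hαapp, Pi.add_apply, Pi.smul_apply, neg_smul, sub_eq_add_neg]
    rw [h1, gammaTrace_add, gammaTrace_smul, gammaTrace_low, smul_smul]
    have h2 : -a * ((n : ℝ) + 1) = -(2 * a) - 1 := by linear_combination -hna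
    rw [h2, sub_smul, one_smul]
    change g x + _ = _
    abel
  have hαslash : ∀ μ x, slash γ (fun y => α y μ) x = (-(2 * a)) • pd μ g x := fun μ x => by
    have h1 : ContDiff ℝ ∞ fun y => γ.low μ *ᵥ g y := contDiff_mulVec _ hgs
    have h2 : ContDiff ℝ ∞ fun y => a • γ.low μ *ᵥ g y := h1.const_smul _
    simp only [hαapp]
    rw [slash_sub γ (contDiff_comp_field hψ'.1 μ) h2, ← dirac_apply hψ'.1, hdir,
      slash_smul γ _ h1, slash_low hgs, hgslash, mulVec_zero, sub_zero, Pi.zero_apply,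
      Pi.zero_apply]
    module
  -- the contracted curl `γ^ν (∂_ν α_μ - ∂_μ α_ν)` vanishes
  have hcurl : ∀ μ x, ∑ ν, γ.gam ν *ᵥ (pd ν (fun y => α y μ) x - pd μ (fun y => α y ν) x) = 0 := by
    intro μ x
    have h1 : pd μ (fun y => gammaTrace γ (α y)) x =
        ∑ ν, γ.gam ν *ᵥ pd μ (fun y => α y ν) x := by
      unfold gammaTrace
      rw [pd_fun_sum fun ν _ =>
        (contDiff_mulVec _ (contDiff_comp_field hαs ν)).differentiable (by simp) x]
      exact Finset.sum_congr rfl fun ν _ =>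
        pd_mulVec _ ((contDiff_comp_field hαs ν).differentiable (by simp) x) μ
    have h2 : pd μ (fun y => gammaTrace γ (α y)) x = (-(2 * a)) • pd μ g x := by
      simp only [htr]
      exact pd_clm ((-(2 * a)) • ContinuousLinearMap.id ℝ (Spinor n))
        (hgs.differentiable (by simp) x) μ
    have h3 := hαslash μ x
    rw [slash, ← h2, h1] at h3
    simp only [mulVec_sub, Finset.sum_sub_distrib, h3, sub_self]
  have hspace : ∀ (i j : Fin n) x, pd i.succ (fun y => α y j.succ) x =
      pd j.succ (fun y => α y i.succ) x := fun i j x => by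
    have := spatial_curl_eq_zero hn hi hψ hdiv hdir (x 0) (h _) i j (fun l => x l.succ)
    rwa [show (Fin.cons (x 0) fun l => x l.succ : Mink n) = x from Fin.cons_self_tail x] at this
  -- without spatial curl only `γ⁰ (∂_0 α_i - ∂_i α_0)` is left of the contracted curl
  have htime : ∀ (i : Fin n) x, pd 0 (fun y => α y i.succ) x = pd i.succ (fun y => α y 0) x := by
    intro i x
    have h1 := hcurl i.succ x
    rw [Fin.sum_univ_succ, Finset.sum_eq_zero fun j _ => by rw [hspace j i, sub_self, mulVec_zero],
      add_zero] at h1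
    have h2 := congrArg (fun w => γ.gam 0 *ᵥ w) h1
    simp only [γ.sq_apply, mulVec_zero, eta_zero, neg_smul, one_smul, neg_eq_zero] at h2
    exact sub_eq_zero.mp h2
  obtain ⟨ε, hε, hεm, hεk, hεα⟩ := exists_twisted_primitive hi hαmem fun μ ν x => by
    refine Fin.cases ?_ (fun i => ?_) μ <;> refine Fin.cases ?_ (fun j => ?_) ν
    · rfl
    · exact htime j x
    · exact (htime i x).symm
    · exact hspace i j x
  refine ⟨ε, hε, hεm, hεk, ?_⟩
  funext x μ
  have h1 : ∑ ν, γ.gam ν *ᵥ pd ν ε x = (-(2 * a)) • g x := by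
    rw [← htr x]
    exact Finset.sum_congr rfl fun ν _ => by rw [hεα]
  rw [opK, h1, hεα, hαapp, mulVec_smul_real]
  module

lemma opK_mem_sections {ε : Mink n → Spinor n} (hε : ContDiff ℝ ∞ ε)
    (hm : ∀ x, ε x ∈ γ.majorana) (hk : ∀ k x, ε (deck k x) = σ.sgn k • ε x) :
    opK γ ε ∈ sections σ := by
  have hp : ∀ μ x, pd μ ε x ∈ γ.majorana := fun μ x =>
    pd_mem_majorana γ (hε.differentiable (by simp) x) hm μ
  refine mem_sections_iff.mpr ⟨contDiff_opK hε, fun x μ => ?_, fun k x => ?_⟩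
  · exact Submodule.sub_mem _ (hp μ x) (Submodule.smul_mem _ _ (γ.low_mem_majorana μ
      (Submodule.sum_mem _ fun ν _ => γ.gam_mem_majorana ν (hp ν x))))
  · have h1 : ∀ μ, pd μ ε (deck k x) = σ.sgn k • pd μ ε x := fun μ => by
      rw [← pd_comp_deck]
      simp only [hk]
      exact pd_clm (σ.sgn k • ContinuousLinearMap.id ℝ (Spinor n))
        (hε.differentiable (by simp) x) μ
    funext μ
    simp only [opK, h1, mulVec_smul_real, ← Finset.smul_sum, Pi.smul_apply, smul_sub]
    rw [smul_comm (1 / 2 : ℝ)]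

/-- A source that generates a solution of vanishing charge lies in the range of `P`: cutting off
the gauge parameter instead of the solution does not change the source. -/
lemma mem_rangeP_of_sliceCharge_eq_zero (hn : 2 ≤ n) (hi : σ.sgn (Pi.single i₀ 1) = -1)
    (f : kerKdag σ) (h : sliceCharge γ 0 (causalProp σ f).1 (causalProp σ f).1 = 0) :
    f ∈ rangeP σ := by
  have hψ := (causalProp σ f).2
  obtain ⟨ε, hε, hεm, hεk, hεψ⟩ := exists_eq_opK hn hi hψ (divergence_causalProp f)
    (dirac_causalProp f) fun t => by
      rw [sliceCharge_eq hn hψ hψ (opP_causalProp f) (opP_causalProp f) t 0, h]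
  -- `K δ` vanishes at early times and agrees with the solution at late times, as `ψp` does; so
  -- `ψp - K δ` has compact support, and `P K = 0`
  obtain ⟨ψp, hψp, hP, ⟨a, ha⟩, b, hb⟩ := exists_future_part f
  set δ : Mink n → Spinor n := fun x => Real.smoothTransition (x 0) • ε x with hδdef
  have hδ : ContDiff ℝ ∞ δ :=
    (Real.smoothTransition.contDiff.comp (contDiff_apply ℝ ℝ 0)).smul hε
  have hδK : opK γ δ ∈ sections σ := opK_mem_sections hδ
    (fun x => Submodule.smul_mem _ _ (hεm x)) fun k x => by
      simp only [hδdef]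
      rw [hεk, smul_comm]
      simp [deck]
  have hloc : ∀ {u v : Mink n → Spinor n} {x : Mink n}, u =ᶠ[nhds x] v →
      opK γ u x = opK γ v x := fun {u v x} huv => by
    funext μ
    simp only [opK, pd_eq_of_eventuallyEq huv]
  have hpast : ∀ y : Mink n, y 0 < 0 → opK γ δ y = 0 := fun y hy => by
    have : δ =ᶠ[nhds y] fun _ => 0 := by
      filter_upwards [(isOpen_lt (continuous_apply 0) continuous_const).mem_nhds hy] with z hz
      simp only [hδdef, Real.smoothTransition.zero_of_nonpos (le_of_lt hz), zero_smul]
    rw [hloc this]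
    funext μ
    simp [opK, pd_const]
  have hfuture : ∀ y : Mink n, 1 < y 0 → opK γ δ y = (causalProp σ f).1 y := fun y hy => by
    have : δ =ᶠ[nhds y] ε := by
      filter_upwards [(isOpen_lt continuous_const (continuous_apply 0)).mem_nhds hy] with z hz
      simp only [hδdef, Real.smoothTransition.one_of_one_le (le_of_lt hz), one_smul]
    rw [hloc this, hεψ]
  refine ⟨ψp - opK γ δ, ⟨sub_mem hψp hδK,
    isCompact_supp (a := min a 0) (b := max b 1) fun x hx => ⟨?_, ?_⟩⟩, ?_⟩
  · by_contra hlt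
    obtain ⟨h1, h2⟩ := lt_min_iff.mp (not_le.mp hlt)
    exact hx (by rw [Pi.sub_apply, ha x h1, hpast x h2, sub_zero])
  · by_contra hlt
    obtain ⟨h1, h2⟩ := max_lt_iff.mp (not_le.mp hlt)
    exact hx (by rw [Pi.sub_apply, hb x h1, hfuture x h2, sub_self])
  · rw [opP_sub hψp.1 hδK.1, opP_opK hδ, sub_zero, hP]

theorem isPositiveType_of_not_isIso_trivial (hn : 2 ≤ n)
    (h : ¬ σ.IsIso (SpinStructure.trivial γ)) : IsPositiveType σ := by
  obtain ⟨i, hi⟩ := SpinStructure.exists_sgn_eq_neg_one h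
  refine (isPositiveType_iff hn σ).mpr fun f hf => ?_
  exact lt_of_le_of_ne (sliceCharge_nonneg hn hi (causalProp σ f).2 (divergence_causalProp f)
    (dirac_causalProp f) 0) fun h0 => hf (mem_rangeP_of_sliceCharge_eq_zero hn hi f h0.symm)

end PureGauge

end RaritaSchwinger

open RaritaSchwinger

theorem mainTheorem3 (n : ℕ) (hn : 2 ≤ n)
    (hD : (n + 1) % 8 = 2 ∨ (n + 1) % 8 = 3 ∨ (n + 1) % 8 = 4) (γ : GammaRep n) :
    (∀ σ : SpinStructure γ, ∃! τ : Obs σ →ₗ[ℝ] Obs σ →ₗ[ℝ] ℝ, IsTau σ τ) ∧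
    ¬ IsPositiveType (SpinStructure.trivial γ) ∧
    (∀ ψ : Fin (n + 1) → Spinor n, (∀ μ, ψ μ ∈ γ.majorana) →
      IsSol (SpinStructure.trivial γ) (fun _ => ψ) ∧
      IsSolPairing (SpinStructure.trivial γ) (fun _ => ψ) (fun _ => ψ)
        ((2 * Real.pi) ^ n * (∑ μ, eta μ * normSq (ψ μ) -
          (((n + 1 : ℕ) : ℝ) - 2)⁻¹ * normSq (gammaTrace γ ψ)))) ∧
    (∃ ψ : Fin (n + 1) → Spinor n, (∀ μ, ψ μ ∈ γ.majorana) ∧ ψ 0 = 0 ∧ gammaTrace γ ψ = 0 ∧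
      ∃ r : ℝ, 0 < r ∧ IsSolPairing (SpinStructure.trivial γ) (fun _ => ψ) (fun _ => ψ) r) ∧
    (∃ ψ : Fin (n + 1) → Spinor n, (∀ μ, ψ μ ∈ γ.majorana) ∧ (∀ i : Fin n, ψ i.succ = 0) ∧
      ∃ r : ℝ, r < 0 ∧ IsSolPairing (SpinStructure.trivial γ) (fun _ => ψ) (fun _ => ψ) r) ∧
    Nat.card {q : Quot (SpinStructure.IsIso (γ := γ)) //
      q ≠ Quot.mk _ (SpinStructure.trivial γ)} = 2 ^ n - 1 ∧
    ∀ σ : SpinStructure γ, ¬ σ.IsIso (SpinStructure.trivial γ) →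
      (∀ t χ, IsTorusSpinor σ t χ → torusDirac γ χ = 0 → χ = 0) ∧ IsPositiveType σ := by
  obtain ⟨ψp, hp, hp0, hptr, hpos⟩ := exists_positive_const hn γ
  obtain ⟨ψm, hm, hm0, hneg⟩ := exists_negative_const hn γ
  have hπ : 0 < (2 * Real.pi) ^ n := pow_pos Real.two_pi_pos n
  refine ⟨existsUnique_isTau hn, not_isPositiveType_trivial hn γ, fun ψ hψ =>
    ⟨isSol_of_opP_eq_zero (const_mem_sections hψ) (opP_const ψ), isSolPairing_const hn hψ⟩,
    ⟨ψp, hp, hp0, hptr, _, mul_pos hπ hpos, isSolPairing_const hn hp⟩,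
    ⟨ψm, hm, hm0, _, mul_neg_of_pos_of_neg hπ hneg, isSolPairing_const hn hm⟩,
    SpinStructure.card_nontrivial γ, fun σ h => ⟨fun t χ hχ h0 => ?_,
    isPositiveType_of_not_isIso_trivial hn h⟩⟩
  obtain ⟨i, hi⟩ := SpinStructure.exists_sgn_eq_neg_one h
  exact torusDirac_injective hi hχ h0
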